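/- Let $\theta\ge 1$ and $\mu>0$. For $n\ge1$ let $\nu_n$ be the Ewens probability measure on the symmetric group $\mathbf S_n$, $$\nu_n(A)=\frac1{\theta(\theta+1)\cdots(\theta+n-1)}\sum_{\sigma\in A}\theta^{w(\sigma)},\qquad A\subset\mathbf S_n,$$ where $w(\sigma)$ is the number of cycles of $\sigma$. Let $k_j(\sigma)$ be the number of cycles of length $j$ of $\sigma$, let $a_{nj}\in\mathbf Z$ $(1\le j\le n)$ be an arbitrary array of integers, and put $h_n(\sigma)=\sum_{j\le n}a_{nj}k_j(\sigma)$ and $T_n(x)=\nu_n(h_n(\sigma)<x)$, $x\in\mathbf R$. Let $\Pi_\mu(x)=P(Y<x)$ be the distribution function of a Poisson random variable $Y$ with parameter $\mu$. For $x\in\mathbf R$ write $x_{(r)}=x(x-1)\cdots(x-r+1)$. For $m\in\mathbf N$ let $a_{nj}(m)=\min\{\max\{a_{nj},0\},m\}$ be the truncated coefficients, and for $l\in\mathbf N$ set $$\Upsilon_n(l,m)=\sum_{u=1}^l\theta^u\sum_{\substack{r_1+\cdots+r_u=l\\ 1\le r_i\le m,\ i\le u}}\binom{l-1}{r_1-1}\cdots\binom{l-r_1-\cdots-r_{u-1}-1}{r_u-1}\sum_{\substack{1\le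 j_1,\dots,j_u\le n\\ j_1+\cdots+j_u<n}}\frac{a_{nj_1}(m)_{(r_1)}\cdots a_{nj_u}(m)_{(r_u)}}{j_1\cdots j_u}\Big(1-\frac{j_1+\cdots+j_u}n\Big)^{\theta-1}.$$ Then $T_n$ converges weakly to $\Pi_\mu$ as $n\to\infty$ (that is, $T_n(x)\to\Pi_\mu(x)$ at every continuity point $x$ of $\Pi_\mu$) if and only if $$\sum_{1\le j<n}\frac{\mathbf 1\{a_{nj}\le-1\}}{j}\Big(1-\frac jn\Big)^{\theta-1}\to0\qquad(n\to\infty)$$ and, for every $l\in\mathbf N=\{1,2,\dots\}$, $$\lim_{m\to\infty}\limsup_{n\to\infty}\big|\Upsilon_n(l,m)-\mu^l\big|=0.$$ -/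

import Mathlib

open Filter Topology

noncomputable section

namespace EwensAdditive

/-- `k_j(σ)`: the number of cycles of length `j` of `σ` (fixed points are cycles of length `1`). -/
def cycleCount {n : ℕ} (j : ℕ) (σ : Equiv.Perm (Fin n)) : ℕ :=
  σ.partition.parts.count j

/-- `w(σ)`: the total number of cycles of `σ`, fixed points included. -/
def numCycles {n : ℕ} (σ : Equiv.Perm (Fin n)) : ℕ :=
  σ.partition.parts.card

/-- The rising factorial `θ^{(n)} = θ (θ + 1) ⋯ (θ + n - 1)`. -/
def risingFactorial (θ : ℝ) (n : ℕ) : ℝ :=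
  ∏ i ∈ Finset.range n, (θ + i)

open Classical in
/-- The Ewens probability `ν_n(A) = (1 / θ^{(n)}) ∑_{σ ∈ A} θ^{w(σ)}` of a set `A` of
permutations. -/
def ewens (θ : ℝ) (n : ℕ) (A : Set (Equiv.Perm (Fin n))) : ℝ :=
  (1 / risingFactorial θ n) * ∑ σ : Equiv.Perm (Fin n) with σ ∈ A, θ ^ numCycles σ

/-- The (completely) additive function `h(σ) = ∑_{j ≤ n} a_j k_j(σ)` with integer coefficients. -/
def additiveFun {n : ℕ} (a : ℕ → ℤ) (σ : Equiv.Perm (Fin n)) : ℤ :=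
  ∑ j ∈ Finset.Icc 1 n, a j * (cycleCount j σ : ℤ)

/-- The distribution function `T_n(x) = ν_n(h_n(σ) < x)`, where `h_n` has coefficients `a n j`. -/
def T (θ : ℝ) (a : ℕ → ℕ → ℤ) (n : ℕ) (x : ℝ) : ℝ :=
  ewens θ n {σ | (additiveFun (a n) σ : ℝ) < x}

/-- The distribution function `x ↦ P(Y < x)` of a Poisson variable `Y` with parameter `μ`. -/
def poissonDF (μ : NNReal) (x : ℝ) : ℝ :=
  (ProbabilityTheory.poissonMeasure μ).real {k : ℕ | (k : ℝ) < x}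

/-- Weak convergence `F_n ⇒ G` of distribution functions: pointwise convergence at every
continuity point of `G`. -/
def WeaklyConverges (F : ℕ → ℝ → ℝ) (G : ℝ → ℝ) : Prop :=
  ∀ x : ℝ, ContinuousAt G x → Tendsto (fun n => F n x) atTop (𝓝 (G x))

/-- The condition `∑_{j < n} 1{a_{nj} ≤ -1} j⁻¹ (1 - j/n)^{θ-1} = o(1)` as `n → ∞`. -/
def NegativePartNegligible (θ : ℝ) (a : ℕ → ℕ → ℤ) : Prop :=
  Tendsto
    (fun n : ℕ => ∑ j ∈ Finset.Ico 1 n with a n j ≤ -1,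
      (1 / (j : ℝ)) * (1 - (j : ℝ) / n) ^ (θ - 1))
    atTop (𝓝 0)

/-- The truncated coefficient `a(m)`: the positive part of `a`, cut off at the level `m`. -/
def trunc (m : ℕ) (a : ℤ) : ℕ :=
  min a.toNat m

/-- The inner sum over `j_1, …, j_u ∈ {1, …, n}` with `j_1 + ⋯ + j_u < n` in `Υ_n(l, m)`; here
`(trunc m (a j)).descFactorial r` is the falling factorial of order `r` of the truncated
coefficient. -/
def innerSum (θ : ℝ) (a : ℕ → ℤ) (n m u : ℕ) (r : Fin u → ℕ) : ℝ :=
  ∑ j ∈ Fintype.piFinset (fun _ : Fin u => Finset.Icc 1 n) with ∑ i, j i < n,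
    (∏ i, ((trunc m (a (j i))).descFactorial (r i) : ℝ) / (j i : ℝ)) *
      (1 - (∑ i, (j i : ℝ)) / n) ^ (θ - 1)

/-- `Υ_n(l, m)`. The second sum runs over the `u`-tuples `r` with `r_1 + ⋯ + r_u = l` and
`1 ≤ r_i ≤ m`, weighted by the product of the binomial coefficients
`(l - r_1 - ⋯ - r_{i-1} - 1).choose (r_i - 1)`. -/
def Upsilon (θ : ℝ) (a : ℕ → ℕ → ℤ) (n l m : ℕ) : ℝ :=
  ∑ u ∈ Finset.Icc 1 l, θ ^ u *
    ∑ r ∈ Fintype.piFinset (fun _ : Fin u => Finset.Icc 1 m) with ∑ i, r i = l,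
      ((∏ i, (l - (∑ k ∈ Finset.Iio i, r k) - 1).choose (r i - 1) : ℕ) : ℝ) *
        innerSum θ (a n) n m u r

/-- `ρ_n(m)` is an admissible error term: `lim_{m → ∞} limsup_{n → ∞} |ρ_n(m)| = 0`, the upper
limit being taken in `[0, ∞]`. -/
def IsErrorTerm (ρ : ℕ → ℕ → ℝ) : Prop :=
  Tendsto (fun m : ℕ => limsup (fun n : ℕ => ENNReal.ofReal |ρ n m|) atTop) atTop (𝓝 0)

end EwensAdditive

end

open Filter Topology

noncomputable section

namespace EwensAdditive

/-! By Cauchy's formula an Ewens mean is a sum over the partitions of n with weights `cycleWeight`,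
divided by p_n = `binomCoeff θ n`, the coefficient of z^n in (1-z)^(-θ). For a multiplicative
function ∏ f(j) this sum (`multSum`) is the coefficient of z^n in exp(θ ∑ f(j) z^j/j).

Marking a cycle gives a recursion for the factorial moments of an additive function with
coefficients in ℕ. Unfolded, it is Υ_n(l,m) with p_(n-s)/p_n in place of (1-s/n)^(θ-1). The two
weights are so close in logarithmic mean that Υ_n(l,m) is asymptotically the l-th factorial moment
of the truncated function (`tendsto_mean_sub_Upsilon`). The second condition thus says that these
moments tend to the Poisson moments μ^l in the iterated limit.

Sufficiency (`poissonLimit_of_isErrorTerm`): Bonferroni's inequalities turn factorial moments into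
point probabilities, and h differs from its truncation only with small probability, by the first
condition and Markov's inequality.

Necessity: weak convergence alone controls no moments. The key is `PoissonLimit.sum_ne_zero_le`: the
j with a_nj ≠ 0 have bounded logarithmic mass. The Poisson characteristic function is bounded away
from 0 uniformly in t, so that of h is too. A Halász-type bound (`exists_close_of_norm_multSum_ge`)
then puts every sequence t·a_nj close, modulo 1, to a linear one. For t = s/q the slopes form an
approximate homomorphism of ℤ/q, hence are close to a true one, and a_nj ≡ kj (mod q) off a set of
bounded logarithmic mass (`exists_linear_mod`). A sieve lower bound (`exists_le_multSum`) provides a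
permutation with only good cycle lengths and bounded h; for huge q this forces a_nj = 0 at the good
j.

The sieve then shows that, with one cycle of length j removed, the remaining cycles all have
coefficient 0 with probability bounded below. Hence for bounded g ≥ 0 with g(0) = 0 the sum of
g(a_nj) with the one-cycle weights is at most a constant times E g(h), up to o(1)
(`PoissonLimit.exists_mul_sum_le`). This gives the first condition and bounds the truncated
factorial moments uniformly in m, so that they converge (`PoissonLimit.abs_mean_truncVal_sub_le`).
-/

/-! ### Weighted sums over partitions and the marking of a part. -/

/-- The weight `∏ (θ / j) ^ c_j / c_j!` of a multiset with multiplicities `c_j`. -/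
def cycleWeight (θ : ℝ) (s : Multiset ℕ) : ℝ :=
  (s.map fun j : ℕ => θ / (j : ℝ)).prod / ∏ j ∈ s.toFinset, (s.count j).factorial

/-- The sum `∑ w(λ) G(λ)` over the partitions `λ` of `n`, with the weights `cycleWeight`. -/
def partitionSum {E : Type*} [AddCommGroup E] [Module ℝ E] (θ : ℝ) (n : ℕ)
    (G : Multiset ℕ → E) : E :=
  ∑ p : n.Partition, cycleWeight θ p.parts • G p.parts

lemma prod_factorial_count_cons (j : ℕ) (s : Multiset ℕ) :
    ∏ i ∈ (j ::ₘ s).toFinset, ((j ::ₘ s).count i).factorial =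
      (s.count j + 1) * ∏ i ∈ s.toFinset, (s.count i).factorial := by
  have h1 : ∏ i ∈ s.toFinset, (s.count i).factorial =
      ∏ i ∈ insert j s.toFinset, (s.count i).factorial := by
    refine Finset.prod_subset (Finset.subset_insert _ _) fun x _ hx => ?_
    rw [Multiset.count_eq_zero.2 (by simpa using hx)]; rfl
  rw [h1, Multiset.toFinset_cons, ← Finset.mul_prod_erase _ _ (Finset.mem_insert_self j _),
    ← Finset.mul_prod_erase (insert j s.toFinset) (fun i => (s.count i).factorial)
      (Finset.mem_insert_self j _), Multiset.count_cons_self, Nat.factorial_succ, mul_assoc]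
  congr 2
  refine Finset.prod_congr rfl fun x hx => ?_
  rw [Multiset.count_cons_of_ne (Finset.ne_of_mem_erase hx)]

/-- Since c/c! = 1/(c-1)!, choosing one of the c parts equal to j and deleting it costs exactly θ/j.
Every recursion below rests on this. -/
lemma count_mul_cycleWeight_cons (θ : ℝ) (j : ℕ) (s : Multiset ℕ) :
    ((j ::ₘ s).count j : ℝ) * cycleWeight θ (j ::ₘ s) = θ / j * cycleWeight θ s := by
  have h := prod_factorial_count_cons j s
  unfold cycleWeight
  rw [h, Multiset.map_cons, Multiset.prod_cons, Multiset.count_cons_self]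
  have h2 : ((∏ i ∈ s.toFinset, (s.count i).factorial : ℕ) : ℝ) ≠ 0 := by
    exact_mod_cast (Finset.prod_pos fun i _ => Nat.factorial_pos _).ne'
  have h3 : ((s.count j : ℝ) + 1) ≠ 0 := by positivity
  push_cast at h2 ⊢
  field_simp

lemma cycleWeight_nonneg {θ : ℝ} (hθ : 0 ≤ θ) (s : Multiset ℕ) : 0 ≤ cycleWeight θ s := by
  refine div_nonneg (Multiset.prod_nonneg fun x hx => ?_) (by positivity)
  obtain ⟨j, _, rfl⟩ := Multiset.mem_map.1 hx
  positivity

/-- The partition obtained by adding a part. -/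
def consPartition {n j : ℕ} (hj : 0 < j) (hjn : j ≤ n) (p : (n - j).Partition) : n.Partition where
  parts := j ::ₘ p.parts
  parts_pos {i} hi := by
    rcases Multiset.mem_cons.1 hi with rfl | h
    · exact hj
    · exact p.parts_pos h
  parts_sum := by rw [Multiset.sum_cons, p.parts_sum]; omega

/-- The partition obtained by removing a part. -/
def erasePartition {n j : ℕ} (p : n.Partition) (hj : j ∈ p.parts) : (n - j).Partition where
  parts := p.parts.erase j
  parts_pos {i} hi := p.parts_pos (Multiset.mem_of_mem_erase hi)
  parts_sum := by
    have h := congrArg Multiset.sum (Multiset.cons_erase hj)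
    rw [Multiset.sum_cons, p.parts_sum] at h
    omega

lemma le_of_mem_parts {n j : ℕ} (p : n.Partition) (hj : j ∈ p.parts) : j ≤ n := by
  have h := congrArg Multiset.sum (Multiset.cons_erase hj)
  rw [Multiset.sum_cons, p.parts_sum] at h
  omega

section

variable {E : Type*} [AddCommGroup E] [Module ℝ E]

lemma partitionSum_part (θ : ℝ) {n j : ℕ} (hj : 0 < j) (hjn : j ≤ n) (G : Multiset ℕ → E) :
    ∑ p : n.Partition with j ∈ p.parts,
      ((p.parts.count j : ℝ) * cycleWeight θ p.parts) • G (p.parts.erase j) =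
      (θ / j) • partitionSum θ (n - j) G := by
  unfold partitionSum
  rw [Finset.smul_sum]
  refine Finset.sum_bij' (fun p hp => erasePartition p (Finset.mem_filter.1 hp).2)
    (fun p _ => consPartition hj hjn p) (fun _ _ => Finset.mem_univ _)
    (fun p _ => ?_) (fun p hp => ?_) (fun p _ => ?_) (fun p hp => ?_)
  · simp [consPartition]
  · exact Nat.Partition.ext (Multiset.cons_erase (Finset.mem_filter.1 hp).2)
  · exact Nat.Partition.ext (Multiset.erase_cons_head _ _)
  · rw [smul_smul]
    have h := count_mul_cycleWeight_cons θ j (p.parts.erase j)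
    rw [Multiset.cons_erase (Finset.mem_filter.1 hp).2] at h
    rw [h]; rfl

/-- Marking a part: the sum over all partitions with a marked part `j` of `n` is the sum over
`j` of the sums over the partitions of `n - j`. -/
lemma partitionSum_marked (θ : ℝ) (n : ℕ) (G : ℕ → Multiset ℕ → E) :
    partitionSum θ n (fun s => (s.map fun j => G j (s.erase j)).sum) =
      ∑ j ∈ Finset.Icc 1 n, (θ / j) • partitionSum θ (n - j) (G j) := by
  have h1 : ∀ p : n.Partition, (p.parts.map fun j => G j (p.parts.erase j)).sum =
      ∑ j ∈ Finset.Icc 1 n,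
        if j ∈ p.parts then (p.parts.count j : ℝ) • G j (p.parts.erase j) else 0 := by
    intro p
    rw [Finset.sum_multiset_map_count, ← Finset.sum_filter]
    refine Finset.sum_congr ?_ fun j _ => (Nat.cast_smul_eq_nsmul ℝ _ _).symm
    ext j
    simp only [Multiset.mem_toFinset, Finset.mem_filter, Finset.mem_Icc]
    exact ⟨fun h => ⟨⟨p.parts_pos h, le_of_mem_parts p h⟩, h⟩, fun h => h.2⟩
  unfold partitionSum
  simp_rw [h1, Finset.smul_sum]
  rw [Finset.sum_comm]
  refine Finset.sum_congr rfl fun j hj => ?_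
  have h2 := partitionSum_part θ (Finset.mem_Icc.1 hj).1 (Finset.mem_Icc.1 hj).2 (G j)
  rw [partitionSum] at h2
  rw [← Finset.smul_sum, ← h2, Finset.sum_filter]
  refine Finset.sum_congr rfl fun p _ => ?_
  split_ifs
  · rw [smul_smul, mul_comm]
  · simp

lemma partitionSum_smul (θ : ℝ) (n : ℕ) (c : ℝ) (G : Multiset ℕ → E) :
    partitionSum θ n (fun s => c • G s) = c • partitionSum θ n G := by
  simp [partitionSum, Finset.smul_sum, smul_comm c]

lemma partitionSum_add (θ : ℝ) (n : ℕ) (G H : Multiset ℕ → E) :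
    partitionSum θ n (fun s => G s + H s) = partitionSum θ n G + partitionSum θ n H := by
  simp [partitionSum, Finset.sum_add_distrib]

lemma partitionSum_sum (θ : ℝ) (n : ℕ) {ι : Type*} (t : Finset ι) (G : ι → Multiset ℕ → E) :
    partitionSum θ n (fun s => ∑ i ∈ t, G i s) = ∑ i ∈ t, partitionSum θ n (G i) := by
  simp only [partitionSum, Finset.smul_sum]
  exact Finset.sum_comm

lemma partitionSum_congr (θ : ℝ) (n : ℕ) {G H : Multiset ℕ → E}
    (h : ∀ p : n.Partition, G p.parts = H p.parts) : partitionSum θ n G = partitionSum θ n H :=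
  Finset.sum_congr rfl fun p _ => by rw [h p]

lemma partitionSum_zero (θ : ℝ) (G : Multiset ℕ → E) : partitionSum θ 0 G = G 0 := by
  unfold partitionSum
  rw [Fintype.sum_unique]
  have : (default : Nat.Partition 0).parts = 0 := rfl
  rw [this]
  simp [cycleWeight]

end

lemma partitionSum_mono {θ : ℝ} (hθ : 0 ≤ θ) (n : ℕ) {G H : Multiset ℕ → ℝ}
    (h : ∀ p : n.Partition, G p.parts ≤ H p.parts) : partitionSum θ n G ≤ partitionSum θ n H :=
  Finset.sum_le_sum fun p _ =>
    smul_le_smul_of_nonneg_left (h p) (cycleWeight_nonneg hθ _)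

lemma partitionSum_nonneg {θ : ℝ} (hθ : 0 ≤ θ) (n : ℕ) {G : Multiset ℕ → ℝ}
    (h : ∀ s, 0 ≤ G s) : 0 ≤ partitionSum θ n G :=
  Finset.sum_nonneg fun _ _ => smul_nonneg (cycleWeight_nonneg hθ _) (h _)

lemma norm_partitionSum_le {θ : ℝ} (hθ : 0 ≤ θ) (n : ℕ) (G : Multiset ℕ → ℂ) :
    ‖partitionSum θ n G‖ ≤ partitionSum θ n fun s => ‖G s‖ := by
  refine (norm_sum_le _ _).trans (Finset.sum_le_sum fun p _ => ?_)
  rw [norm_smul, Real.norm_of_nonneg (cycleWeight_nonneg hθ _), smul_eq_mul]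

/-! ### From permutations to partitions. -/

/-- The cycle lengths of a permutation of `Fin n` as a partition of `n`. -/
def cyclePartition {n : ℕ} (σ : Equiv.Perm (Fin n)) : n.Partition where
  parts := σ.partition.parts
  parts_pos hi := σ.partition.parts_pos hi
  parts_sum := σ.partition.parts_sum.trans (Fintype.card_fin n)

/-- `cycleType` omits the fixed points; their number is recovered because the parts sum to n. -/
lemma cyclePartition_eq_iff {n : ℕ} (σ : Equiv.Perm (Fin n)) (p : n.Partition) :
    cyclePartition σ = p ↔ σ.cycleType = p.parts.filter (2 ≤ ·) := by
  constructor
  · rintro rfl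
    exact (Equiv.Perm.filter_parts_partition_eq_cycleType (σ := σ)).symm
  · intro h
    have h1 : p.parts = p.parts.filter (2 ≤ ·) + Multiset.replicate (p.parts.count 1) 1 := by
      conv_lhs => rw [← Multiset.filter_add_not (2 ≤ ·) p.parts]
      congr 1
      rw [← Multiset.filter_eq']
      refine Multiset.filter_congr fun x hx => ?_
      have := p.parts_pos hx
      omega
    have h2 := congrArg Multiset.sum h1
    rw [p.parts_sum, Multiset.sum_add, ← h, Equiv.Perm.sum_cycleType] at h2
    simp only [Multiset.sum_replicate, smul_eq_mul, mul_one] at h2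
    refine Nat.Partition.ext ?_
    change σ.cycleType + Multiset.replicate (Fintype.card (Fin n) - σ.support.card) 1 = p.parts
    rw [h1, h, Fintype.card_fin]
    congr 2
    have : p.parts.count 1 = n - σ.support.card := by omega
    rw [this]

-- Cauchy's formula. In the count by `cycleType` the factor (n - sum)! belongs to the fixed points;
-- it is the factorial of the multiplicity of 1 that the filtered multiset lacks.
open Classical in
lemma card_cyclePartition_eq {n : ℕ} (p : n.Partition) :
    ((Finset.univ.filter fun σ : Equiv.Perm (Fin n) => cyclePartition σ = p).card : ℝ) *
      (p.parts.prod * ∏ j ∈ p.parts.toFinset, (p.parts.count j).factorial : ℕ) =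
      n.factorial := by
  have h1 : p.parts = p.parts.filter (2 ≤ ·) + Multiset.replicate (p.parts.count 1) 1 := by
    conv_lhs => rw [← Multiset.filter_add_not (2 ≤ ·) p.parts]
    congr 1
    rw [← Multiset.filter_eq']
    refine Multiset.filter_congr fun x hx => ?_
    have := p.parts_pos hx
    omega
  have h2 := Equiv.Perm.card_of_cycleType_mul_eq (Fin n) (p.parts.filter (2 ≤ ·))
  have hs : (p.parts.filter (2 ≤ ·)).sum + p.parts.count 1 = n := by
    have := congrArg Multiset.sum h1
    rw [p.parts_sum, Multiset.sum_add] at this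
    simp only [Multiset.sum_replicate, smul_eq_mul, mul_one] at this
    exact this.symm
  rw [if_pos ⟨by rw [Fintype.card_fin]; omega, fun a ha => (Multiset.mem_filter.1 ha).2⟩,
    Fintype.card_fin] at h2
  have hc : n - (p.parts.filter (2 ≤ ·)).sum = p.parts.count 1 := by omega
  have hp : (p.parts.filter (2 ≤ ·)).prod = p.parts.prod := by
    conv_rhs => rw [h1]
    simp
  have hf : (p.parts.count 1).factorial * ∏ j ∈ (p.parts.filter (2 ≤ ·)).toFinset,
      ((p.parts.filter (2 ≤ ·)).count j).factorial =
      ∏ j ∈ p.parts.toFinset, (p.parts.count j).factorial := by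
    have e1 : ∏ j ∈ p.parts.toFinset, (p.parts.count j).factorial =
        ∏ j ∈ insert 1 p.parts.toFinset, (p.parts.count j).factorial := by
      refine Finset.prod_subset (Finset.subset_insert _ _) fun x _ hx => ?_
      rw [Multiset.count_eq_zero.2 (by simpa using hx)]; rfl
    rw [e1, ← Finset.mul_prod_erase _ _ (Finset.mem_insert_self 1 _)]
    congr 1
    have e2 : (p.parts.filter (2 ≤ ·)).toFinset = (insert 1 p.parts.toFinset).erase 1 := by
      ext x
      simp only [Multiset.mem_toFinset, Multiset.mem_filter, Finset.mem_erase, Finset.mem_insert]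
      constructor
      · rintro ⟨h, h'⟩
        exact ⟨by omega, Or.inr h⟩
      · rintro ⟨h, h' | h'⟩
        · exact absurd h' h
        · exact ⟨h', by have := p.parts_pos h'; omega⟩
    rw [e2]
    refine Finset.prod_congr rfl fun x hx => ?_
    rw [← e2] at hx
    rw [Multiset.count_filter_of_pos (Multiset.mem_filter.1 (Multiset.mem_toFinset.1 hx)).2]
  rw [hc, hp, mul_right_comm, mul_assoc] at h2
  have h3 : (Finset.univ.filter fun σ : Equiv.Perm (Fin n) => cyclePartition σ = p) =
      Finset.univ.filter fun σ : Equiv.Perm (Fin n) => σ.cycleType = p.parts.filter (2 ≤ ·) := by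
    refine Finset.filter_congr fun σ _ => cyclePartition_eq_iff σ p
  rw [h3]
  rw [← mul_assoc (Nat.factorial _), hf, mul_comm (∏ j ∈ _, _)] at h2
  exact_mod_cast h2

lemma map_div_prod (θ : ℝ) (s : Multiset ℕ) :
    (s.map fun j : ℕ => θ / (j : ℝ)).prod = θ ^ s.card / (s.prod : ℕ) := by
  induction s using Multiset.induction_on with
  | empty => simp
  | cons a s ih =>
    simp only [Multiset.map_cons, Multiset.prod_cons, ih, Multiset.card_cons, Nat.cast_mul,
      pow_succ]
    rw [div_mul_div_comm, mul_comm θ]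

lemma sum_perm_eq_partitionSum {E : Type*} [AddCommGroup E] [Module ℝ E] (θ : ℝ) (n : ℕ)
    (G : Multiset ℕ → E) :
    ∑ σ : Equiv.Perm (Fin n), θ ^ numCycles σ • G σ.partition.parts =
      (n.factorial : ℝ) • partitionSum θ n G := by
  classical
  rw [partitionSum, Finset.smul_sum,
    ← Finset.sum_fiberwise_of_maps_to (s := Finset.univ) (t := Finset.univ)
      (g := fun σ : Equiv.Perm (Fin n) => cyclePartition σ) (fun _ _ => Finset.mem_univ _)]
  refine Finset.sum_congr rfl fun p _ => ?_
  have h : ∀ σ ∈ Finset.univ.filter (fun σ : Equiv.Perm (Fin n) => cyclePartition σ = p),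
      θ ^ numCycles σ • G σ.partition.parts = θ ^ p.parts.card • G p.parts := by
    intro σ hσ
    have := congrArg Nat.Partition.parts (Finset.mem_filter.1 hσ).2
    rw [← this]; rfl
  rw [Finset.sum_congr rfl h, Finset.sum_const, ← Nat.cast_smul_eq_nsmul ℝ, smul_smul, smul_smul]
  congr 1
  have hp : (p.parts.prod : ℝ) ≠ 0 := by
    exact_mod_cast (Multiset.prod_pos fun a ha => p.parts_pos ha).ne'
  have hq : ((∏ j ∈ p.parts.toFinset, (p.parts.count j).factorial : ℕ) : ℝ) ≠ 0 := by
    exact_mod_cast (Finset.prod_pos fun i _ => Nat.factorial_pos _).ne'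
  rw [← card_cyclePartition_eq p, cycleWeight, map_div_prod, Nat.cast_mul]
  field_simp

/-! ### Normalizing constants and the recursion for multiplicative functions. -/

/-- The coefficient `θ (θ + 1) ⋯ (θ + n - 1) / n!` of `z ^ n` in `(1 - z) ^ (-θ)`. -/
def binomCoeff (θ : ℝ) (n : ℕ) : ℝ := ∏ i ∈ Finset.range n, (θ + i) / (i + 1)

/-- The harmonic sum `∑_{1 ≤ j ≤ n} 1 / j`. -/
def harmonicSum (n : ℕ) : ℝ := ∑ j ∈ Finset.Icc 1 n, 1 / (j : ℝ)

lemma binomCoeff_zero (θ : ℝ) : binomCoeff θ 0 = 1 := by simp [binomCoeff]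

lemma binomCoeff_succ (θ : ℝ) (n : ℕ) :
    binomCoeff θ (n + 1) = binomCoeff θ n * ((θ + n) / (n + 1)) := Finset.prod_range_succ _ _

lemma risingFactorial_eq (θ : ℝ) (n : ℕ) :
    risingFactorial θ n = n.factorial * binomCoeff θ n := by
  induction n with
  | zero => simp [risingFactorial, binomCoeff]
  | succ n ih =>
    rw [risingFactorial, Finset.prod_range_succ, ← risingFactorial, ih, binomCoeff_succ,
      Nat.factorial_succ]
    push_cast
    have : (n : ℝ) + 1 ≠ 0 := by positivity
    field_simp

lemma sum_binomCoeff (θ : ℝ) (n : ℕ) :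
    θ * ∑ k ∈ Finset.range n, binomCoeff θ k = n * binomCoeff θ n := by
  induction n with
  | zero => simp
  | succ n ih =>
    rw [Finset.sum_range_succ, mul_add, ih, binomCoeff_succ]
    push_cast
    have : (n : ℝ) + 1 ≠ 0 := by positivity
    field_simp
    ring

lemma sum_Icc_sub {E : Type*} [AddCommMonoid E] (n : ℕ) (f : ℕ → E) :
    ∑ j ∈ Finset.Icc 1 n, f (n - j) = ∑ k ∈ Finset.range n, f k := by
  refine Finset.sum_bij' (fun j _ => n - j) (fun k _ => n - k) ?_ ?_ ?_ ?_ ?_ <;>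
    intro j hj <;> simp only [Finset.mem_Icc, Finset.mem_range] at * <;> omega

section Recursion

variable {θ : ℝ}

/-- The weighted sum of the multiplicative functions `∏ f(j)` over the partitions of `n`. -/
def multSum {R : Type*} [CommRing R] [Algebra ℝ R] (θ : ℝ) (f : ℕ → R) (n : ℕ) : R :=
  partitionSum θ n fun s => (s.map f).prod

lemma multSum_zero {R : Type*} [CommRing R] [Algebra ℝ R] (θ : ℝ) (f : ℕ → R) :
    multSum θ f 0 = 1 := by
  simp [multSum, partitionSum_zero]

/-- Mark a part and weight it by its size j: the sizes add up to n on the left, and j cancels the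
denominator of θ/j on the right. -/
lemma multSum_rec {R : Type*} [CommRing R] [Algebra ℝ R] (θ : ℝ) (f : ℕ → R) (n : ℕ) :
    (n : ℝ) • multSum θ f n = θ • ∑ j ∈ Finset.Icc 1 n, f j * multSum θ f (n - j) := by
  have h := partitionSum_marked θ n fun j s => (j : ℝ) • (f j * (s.map f).prod)
  have h1 : partitionSum θ n (fun s => (s.map fun j : ℕ =>
      (j : ℝ) • (f j * ((s.erase j).map f).prod)).sum) = (n : ℝ) • multSum θ f n := by
    rw [multSum, ← partitionSum_smul]
    refine partitionSum_congr θ n fun p => ?_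
    have h2 : p.parts.map (fun j : ℕ => (j : ℝ) • (f j * ((p.parts.erase j).map f).prod)) =
        p.parts.map (fun j => j • (p.parts.map f).prod) := by
      refine Multiset.map_congr rfl fun j hj => ?_
      rw [Multiset.prod_map_erase hj, Nat.cast_smul_eq_nsmul]
    have h3 : ∀ (s : Multiset ℕ) (x : R), (s.map fun j => j • x).sum = s.sum • x := by
      intro s x
      induction s using Multiset.induction_on with
      | empty => simp
      | cons a s ih => rw [Multiset.map_cons, Multiset.sum_cons, Multiset.sum_cons, ih, add_smul]
    rw [h2, h3, p.parts_sum, Nat.cast_smul_eq_nsmul]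
  rw [h1] at h
  rw [h, Finset.smul_sum]
  refine Finset.sum_congr rfl fun j hj => ?_
  have hj0 : (j : ℝ) ≠ 0 := by
    have := (Finset.mem_Icc.1 hj).1
    positivity
  have h4 : partitionSum θ (n - j) (fun s => (j : ℝ) • (f j * (s.map f).prod)) =
      (j : ℝ) • (f j * multSum θ f (n - j)) := by
    rw [partitionSum_smul]
    congr 1
    simp [multSum, partitionSum, Finset.mul_sum]
  rw [h4, smul_smul, div_mul_cancel₀ _ hj0]

/-- Sequences satisfying the recursion of `multSum` up to `n` agree with it up to `n`. -/
lemma eq_multSum_of_rec {R : Type*} [CommRing R] [Algebra ℝ R] (θ : ℝ) (f : ℕ → R)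
    (c : ℕ → R) (n : ℕ) (h0 : c 0 = 1)
    (hc : ∀ k, 1 ≤ k → k ≤ n → (k : ℝ) • c k = θ • ∑ j ∈ Finset.Icc 1 k, f j * c (k - j)) :
    ∀ k ≤ n, c k = multSum θ f k := by
  intro k
  induction k using Nat.strong_induction_on with
  | _ k ih =>
    intro hk
    rcases Nat.eq_zero_or_pos k with rfl | hpos
    · rw [h0, multSum_zero]
    · have hk0 : (k : ℝ) ≠ 0 := by positivity
      have h1 : (k : ℝ) • c k = (k : ℝ) • multSum θ f k := by
        rw [hc k hpos hk, multSum_rec]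
        congr 1
        refine Finset.sum_congr rfl fun j hj => ?_
        obtain ⟨hj1, hj2⟩ := Finset.mem_Icc.1 hj
        rw [ih (k - j) (by omega) (by omega)]
      have h2 := congrArg (fun x => (k : ℝ)⁻¹ • x) h1
      simpa only [smul_smul, inv_mul_cancel₀ hk0, one_smul] using h2

lemma multSum_one (θ : ℝ) (n : ℕ) : multSum θ (fun _ => (1 : ℝ)) n = binomCoeff θ n := by
  refine (eq_multSum_of_rec θ _ (binomCoeff θ) n (binomCoeff_zero θ) (fun k _ _ => ?_) n
    le_rfl).symm
  simp only [one_mul, smul_eq_mul]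
  rw [sum_Icc_sub k (binomCoeff θ), sum_binomCoeff]

lemma partitionSum_one (θ : ℝ) (n : ℕ) :
    partitionSum θ n (fun _ => (1 : ℝ)) = binomCoeff θ n := by
  rw [← multSum_one, multSum]
  simp

end Recursion

/-! ### Comparison of the normalizing constants with powers. -/

section Bounds

variable {θ : ℝ} (hθ : 1 ≤ θ)
include hθ

lemma binomCoeff_pos (n : ℕ) : 0 < binomCoeff θ n :=
  Finset.prod_pos fun i _ => by positivity

lemma binomCoeff_mono : Monotone (binomCoeff θ) := by
  refine monotone_nat_of_le_succ fun n => ?_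
  rw [binomCoeff_succ]
  refine le_mul_of_one_le_right (binomCoeff_pos hθ n).le ?_
  rw [one_le_div (by positivity)]
  linarith

lemma one_le_binomCoeff (n : ℕ) : 1 ≤ binomCoeff θ n := by
  rw [← binomCoeff_zero θ]
  exact binomCoeff_mono hθ (Nat.zero_le n)

/-- The quotients p_(k+1)/p_k = (θ+k)/(k+1) decrease in k because θ ≥ 1. This lets sums at level n
control moments at every smaller level N. -/
lemma binomCoeff_log_concave {i N n : ℕ} (hi : i ≤ N) (hn : N ≤ n) :
    binomCoeff θ (N - i) / binomCoeff θ N ≤ binomCoeff θ (n - i) / binomCoeff θ n := by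
  induction n, hn using Nat.le_induction with
  | base => exact le_rfl
  | succ n hn ih =>
    refine ih.trans ?_
    rw [show n + 1 - i = (n - i) + 1 by omega, binomCoeff_succ, binomCoeff_succ,
      div_le_div_iff₀ (binomCoeff_pos hθ n) (mul_pos (binomCoeff_pos hθ n) (by positivity))]
    have h1 := binomCoeff_pos hθ n
    have h2 := binomCoeff_pos hθ (n - i)
    have h3 : (θ + n) / (n + 1) ≤ (θ + (n - i : ℕ)) / ((n - i : ℕ) + 1) := by
      rw [div_le_div_iff₀ (by positivity) (by positivity)]
      have : ((n - i : ℕ) : ℝ) ≤ n := by exact_mod_cast Nat.sub_le n i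
      nlinarith
    nlinarith [mul_le_mul_of_nonneg_left h3 (mul_pos h1 h2).le]

/-- The inductive step is (n/(n+1))^(θ-1) ≤ (n+1)/(n+θ), which follows by passing through
exp(-(θ-1)/(n+1)) and using 1+x ≤ e^x twice. -/
lemma rpow_ratio_le {k n : ℕ} (hk : 1 ≤ k) (hn : k ≤ n) :
    ((k : ℝ) / n) ^ (θ - 1) ≤ binomCoeff θ k / binomCoeff θ n := by
  induction n, hn using Nat.le_induction with
  | base =>
    rw [div_self (by positivity), div_self (binomCoeff_pos hθ k).ne', Real.one_rpow]
  | succ n hn ih =>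
    have hn0 : (0 : ℝ) < n := by exact_mod_cast hk.trans hn
    have hp := binomCoeff_pos hθ n
    have e : (k : ℝ) / (n + 1 : ℕ) = (k / n) * (n / (n + 1)) := by
      push_cast
      field_simp
    rw [e, Real.mul_rpow (by positivity) (by positivity), binomCoeff_succ, ← div_div]
    rw [div_eq_mul_inv (_ / _) ((θ + n) / (n + 1))]
    refine mul_le_mul ih ?_ (by positivity) (div_nonneg (binomCoeff_pos hθ k).le hp.le)
    have h1 : (n : ℝ) / (n + 1) ≤ Real.exp (-(1 / ((n : ℝ) + 1))) := by
      have := Real.add_one_le_exp (-(1 / ((n : ℝ) + 1)))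
      have e2 : (n : ℝ) / (n + 1) = -(1 / ((n : ℝ) + 1)) + 1 := by
        field_simp
        ring
      rwa [e2]
    refine (Real.rpow_le_rpow (by positivity) h1 (by linarith)).trans ?_
    rw [← Real.exp_mul, le_inv_comm₀ (Real.exp_pos _) (by positivity), ← Real.exp_neg]
    have := Real.add_one_le_exp (-(-(1 / ((n : ℝ) + 1)) * (θ - 1)))
    refine le_trans (le_of_eq ?_) this
    field_simp
    ring

/-- The shift by θ reverses the previous comparison: now the step is (n+1)/(n+θ) ≤ exp(-(θ-1)/(n+θ))
≤ ((n+θ)/(n+1+θ))^(θ-1). The value k = 0 is allowed. -/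
lemma le_rpow_ratio {k n : ℕ} (hn : k ≤ n) :
    binomCoeff θ k / binomCoeff θ n ≤ (((k : ℝ) + θ) / (n + θ)) ^ (θ - 1) := by
  induction n, hn using Nat.le_induction with
  | base =>
    have hk : (k : ℝ) + θ ≠ 0 := by positivity
    rw [div_self hk, div_self (binomCoeff_pos hθ k).ne', Real.one_rpow]
  | succ n hn ih =>
    have hp := binomCoeff_pos hθ n
    have e : ((k : ℝ) + θ) / ((n + 1 : ℕ) + θ) = ((k + θ) / (n + θ)) * ((n + θ) / (n + 1 + θ)) := by
      push_cast
      field_simp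
    rw [e, Real.mul_rpow (by positivity) (by positivity), binomCoeff_succ, ← div_div]
    rw [div_eq_mul_inv (_ / _) ((θ + n) / (n + 1))]
    refine mul_le_mul ih ?_ (by positivity) (by positivity)
    have h1 : ((n : ℝ) + 1) / (θ + n) ≤ Real.exp (-((θ - 1) / (θ + n))) := by
      have := Real.add_one_le_exp (-((θ - 1) / (θ + n)))
      refine le_trans (le_of_eq ?_) this
      field_simp
      ring
    rw [inv_div]
    refine h1.trans ?_
    have h2 : Real.exp (-(1 / (n + θ))) ≤ ((n : ℝ) + θ) / (n + 1 + θ) := by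
      rw [Real.exp_neg, inv_le_comm₀ (Real.exp_pos _) (by positivity)]
      have := Real.add_one_le_exp (1 / (n + θ))
      refine le_trans (le_of_eq ?_) this
      field_simp
      ring
    refine le_trans (le_of_eq ?_)
      (Real.rpow_le_rpow (Real.exp_pos _).le h2 (by linarith))
    rw [← Real.exp_mul]
    congr 1
    rw [add_comm θ]
    ring

lemma rpow_le_binomCoeff_ratio {s n : ℕ} (hs : s < n) :
    (1 - (s : ℝ) / n) ^ (θ - 1) ≤ binomCoeff θ (n - s) / binomCoeff θ n := by
  have hn0 : (n : ℝ) ≠ 0 := by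
    have : 0 < n := by omega
    positivity
  have h := rpow_ratio_le hθ (k := n - s) (n := n) (by omega) (Nat.sub_le n s)
  rwa [Nat.cast_sub hs.le, sub_div, div_self hn0] at h

/-- The ratio lies between x^(θ-1) and y^(θ-1), where x = 1-s/n and y is its shift by θ; since y ≤
1, the gap is at most (θ-1)(y/x-1). The bound, once divided by s and summed over s < n, is of order
(log n)/n. -/
lemma binomCoeff_ratio_sub_le {s n : ℕ} (hs : s < n) :
    binomCoeff θ (n - s) / binomCoeff θ n - (1 - (s : ℝ) / n) ^ (θ - 1) ≤
      (θ - 1) * θ * (s / (n * (n - s))) := by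
  have hn0 : (0 : ℝ) < n := by
    have : 0 < n := by omega
    positivity
  have hs' : (s : ℝ) < n := by exact_mod_cast hs
  have hs0 : (0 : ℝ) ≤ s := Nat.cast_nonneg s
  have h := le_rpow_ratio hθ (Nat.sub_le n s)
  rw [Nat.cast_sub hs.le] at h
  set y : ℝ := (n - s + θ) / (n + θ) with hy
  set x : ℝ := 1 - s / n with hx
  have hx0 : 0 < x := by
    rw [hx, sub_pos, div_lt_one hn0]
    exact hs'
  have hy0 : 0 < y := div_pos (by linarith) (by linarith)
  have hy1 : y ≤ 1 := by
    rw [hy, div_le_one (by linarith)]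
    linarith
  have hα : 0 ≤ θ - 1 := by linarith
  have hxy : y - x ≤ θ * s / n * (1 / n) := by
    have : y - x = θ * s / n * (1 / (n + θ)) := by
      rw [hx, hy]
      field_simp
      ring
    rw [this]
    gcongr
    linarith
  have hd : (1 : ℝ) - (θ - 1) * (y / x - 1) ≤ (x / y) ^ (θ - 1) := by
    have h1 := Real.add_one_le_exp (Real.log (x / y) * (θ - 1))
    have h2 : Real.log (y / x) ≤ y / x - 1 := Real.log_le_sub_one_of_pos (by positivity)
    have h3 : Real.log (x / y) = -Real.log (y / x) := by rw [← Real.log_inv, inv_div]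
    rw [Real.rpow_def_of_pos (by positivity)]
    nlinarith
  have hyα : y ^ (θ - 1) ≤ 1 := Real.rpow_le_one hy0.le hy1 hα
  have hyα0 : 0 < y ^ (θ - 1) := Real.rpow_pos_of_pos hy0 _
  have hxx : x ^ (θ - 1) = y ^ (θ - 1) * (x / y) ^ (θ - 1) := by
    rw [← Real.mul_rpow hy0.le (by positivity)]
    congr 1
    field_simp
  have hyx : y / x - 1 ≤ θ * (s / (n * (n - s))) := by
    have e : y / x - 1 = (y - x) / x := by field_simp
    have e2 : θ * (s / (n * (n - s))) = (θ * s / n * (1 / n)) / x := by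
      have : (n : ℝ) - s ≠ 0 := by linarith
      have : x = (n - s) / n := by rw [hx]; field_simp
      rw [this]
      field_simp
    rw [e, e2]
    gcongr
  have hB : 0 ≤ θ * (s / ((n : ℝ) * (n - s))) :=
    mul_nonneg (by linarith) (div_nonneg hs0 (mul_nonneg hn0.le (by linarith)))
  have h4 : y ^ (θ - 1) - x ^ (θ - 1) ≤ y ^ (θ - 1) * ((θ - 1) * (y / x - 1)) := by
    rw [hxx]
    nlinarith
  have h5 : y ^ (θ - 1) * ((θ - 1) * (y / x - 1)) ≤ (θ - 1) * (θ * (s / (n * (n - s)))) :=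
    calc y ^ (θ - 1) * ((θ - 1) * (y / x - 1))
        ≤ y ^ (θ - 1) * ((θ - 1) * (θ * (s / (n * (n - s))))) := by gcongr
      _ ≤ 1 * ((θ - 1) * (θ * (s / (n * (n - s))))) := by
          gcongr
      _ = _ := one_mul _
  linarith

omit hθ in
lemma harmonicSum_le (n : ℕ) : harmonicSum n ≤ 1 + Real.log n := by
  have h := harmonic_le_one_add_log n
  have e : harmonicSum n = (harmonic n : ℝ) := by
    rw [harmonic_eq_sum_Icc, harmonicSum]
    push_cast
    simp
  rwa [e]

/-- The left side is the trivial bound of `genFun` on the unit circle when |f| ≤ 1. It has the order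
n^θ of n p_n, so any extra decay of the generating function is a saving against n p_n. -/
lemma exp_harmonicSum_le {n : ℕ} (hn : 1 ≤ n) :
    Real.exp (θ * harmonicSum n) ≤ Real.exp θ * θ ^ (θ - 1) * (n * binomCoeff θ n) := by
  have hn0 : (0 : ℝ) < n := by exact_mod_cast hn
  have h1 : Real.exp (θ * harmonicSum n) ≤ Real.exp θ * (n * n ^ (θ - 1)) := by
    have e : Real.exp θ * (n * (n : ℝ) ^ (θ - 1)) = Real.exp (θ * (1 + Real.log n)) := by
      rw [mul_add, Real.exp_add, mul_one, Real.rpow_sub_one hn0.ne', mul_div_cancel₀ _ hn0.ne',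
        Real.rpow_def_of_pos hn0, mul_comm θ (Real.log n)]
    rw [e]
    exact Real.exp_le_exp.2 (mul_le_mul_of_nonneg_left (harmonicSum_le n) (by linarith))
  have h2 : (n : ℝ) ^ (θ - 1) ≤ θ ^ (θ - 1) * binomCoeff θ n := by
    have h := le_rpow_ratio hθ (Nat.zero_le n)
    rw [binomCoeff_zero, Nat.cast_zero, zero_add,
      Real.div_rpow (by positivity) (by positivity),
      div_le_div_iff₀ (binomCoeff_pos hθ n) (by positivity), one_mul] at h
    exact (Real.rpow_le_rpow hn0.le (by linarith) (by linarith)).trans h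
  calc _ ≤ _ := h1
    _ ≤ Real.exp θ * (n * (θ ^ (θ - 1) * binomCoeff θ n)) := by gcongr
    _ = _ := by ring

end Bounds

/-! ### Generating functions of multiplicative functions. -/

/-- The `k`-th Taylor coefficient of `F` at the origin. -/
def taylorCoeff (F : ℂ → ℂ) (k : ℕ) : ℂ := iteratedDeriv k F 0 / k.factorial

lemma hasSum_taylorCoeff {F : ℂ → ℂ} (hF : Differentiable ℂ F) (z : ℂ) :
    HasSum (fun k => taylorCoeff F k * z ^ k) (F z) := by
  have e : (fun k => taylorCoeff F k * z ^ k) =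
      fun k : ℕ => (k.factorial : ℂ)⁻¹ • (z - 0) ^ k • iteratedDeriv k F 0 := by
    funext k
    simp only [taylorCoeff, sub_zero, smul_eq_mul]
    ring
  rw [e]
  exact Complex.hasSum_taylorSeries_of_entire hF 0 z

lemma taylorCoeff_mul {F G : ℂ → ℂ} (hF : Differentiable ℂ F) (hG : Differentiable ℂ G) (k : ℕ) :
    taylorCoeff (fun z => F z * G z) k =
      ∑ i ∈ Finset.range (k + 1), taylorCoeff F i * taylorCoeff G (k - i) := by
  unfold taylorCoeff
  rw [iteratedDeriv_fun_mul hF.contDiff.contDiffAt hG.contDiff.contDiffAt, Finset.sum_div]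
  refine Finset.sum_congr rfl fun i hi => ?_
  have hik : i ≤ k := Nat.lt_succ_iff.1 (Finset.mem_range.1 hi)
  have h := Nat.choose_mul_factorial_mul_factorial hik
  have h1 : (i.factorial : ℂ) ≠ 0 := by exact_mod_cast i.factorial_ne_zero
  have h2 : ((k - i).factorial : ℂ) ≠ 0 := by exact_mod_cast (k - i).factorial_ne_zero
  rw [← h]
  have h3 : (k.choose i : ℂ) ≠ 0 := by exact_mod_cast (Nat.choose_pos hik).ne'
  push_cast
  field_simp

lemma taylorCoeff_sum {ι : Type*} (s : Finset ι) (b : ι → ℂ) (m : ι → ℕ) (k : ℕ) :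
    taylorCoeff (fun z => ∑ i ∈ s, b i * z ^ m i) k = ∑ i ∈ s with m i = k, b i := by
  unfold taylorCoeff
  rw [iteratedDeriv_fun_sum fun i _ => by fun_prop, Finset.sum_div, Finset.sum_filter]
  refine Finset.sum_congr rfl fun i _ => ?_
  rw [iteratedDeriv_const_mul_field, iteratedDeriv_fun_pow_zero]
  by_cases h : k = m i
  · subst h
    have : ((m i).factorial : ℂ) ≠ 0 := by exact_mod_cast (m i).factorial_ne_zero
    simp [this]
  · simp [h, Ne.symm h]

lemma taylorCoeff_id_mul_deriv {F : ℂ → ℂ} (hF : Differentiable ℂ F) (k : ℕ) :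
    taylorCoeff (fun z => z * deriv F z) k = k * taylorCoeff F k := by
  have hid : taylorCoeff (fun z => z) = fun i => if i = 1 then 1 else 0 := by
    funext i
    unfold taylorCoeff
    rw [iteratedDeriv_fun_id_zero]
    split_ifs with h
    · simp [h]
    · simp
  rw [taylorCoeff_mul differentiable_fun_id hF.deriv, hid]
  rcases k with _ | k
  · simp
  · simp only [ite_mul, one_mul, zero_mul, Finset.sum_ite_eq', Finset.mem_range]
    rw [if_pos (by omega)]
    unfold taylorCoeff
    rw [Nat.add_sub_cancel, ← iteratedDeriv_succ', Nat.factorial_succ]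
    have : (k.factorial : ℂ) ≠ 0 := by exact_mod_cast k.factorial_ne_zero
    have h1 : ((k + 1 : ℕ) : ℂ) ≠ 0 := by exact_mod_cast k.succ_ne_zero
    push_cast at h1 ⊢
    field_simp

/-- The entire function `exp (θ ∑_{j ≤ n} f(j) z ^ j / j)`. -/
def genFun (θ : ℝ) (f : ℕ → ℂ) (n : ℕ) (z : ℂ) : ℂ :=
  Complex.exp (θ * ∑ j ∈ Finset.Icc 1 n, f j * z ^ j / j)

lemma differentiable_genFun (θ : ℝ) (f : ℕ → ℂ) (n : ℕ) : Differentiable ℂ (genFun θ f n) := by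
  unfold genFun
  fun_prop

lemma id_mul_deriv_genFun (θ : ℝ) (f : ℕ → ℂ) (n : ℕ) (z : ℂ) :
    z * deriv (genFun θ f n) z = (∑ j ∈ Finset.Icc 1 n, θ * f j * z ^ j) * genFun θ f n z := by
  have h1 : HasDerivAt (fun z : ℂ => (θ : ℂ) * ∑ j ∈ Finset.Icc 1 n, f j * z ^ j / j)
      (θ * ∑ j ∈ Finset.Icc 1 n, f j * (j * z ^ (j - 1)) / j) z := by
    refine HasDerivAt.const_mul _ (HasDerivAt.fun_sum fun j _ => ?_)
    exact ((hasDerivAt_pow j z).const_mul (f j)).div_const _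
  have h2 : HasDerivAt (genFun θ f n) _ z := h1.cexp
  have h3 : z * (θ * ∑ j ∈ Finset.Icc 1 n, f j * (j * z ^ (j - 1)) / j) =
      ∑ j ∈ Finset.Icc 1 n, θ * f j * z ^ j := by
    rw [Finset.mul_sum, Finset.mul_sum]
    refine Finset.sum_congr rfl fun j hj => ?_
    have hj1 := (Finset.mem_Icc.1 hj).1
    have : (j : ℂ) ≠ 0 := by exact_mod_cast (by omega : j ≠ 0)
    have hz : z ^ j = z * z ^ (j - 1) := by rw [← pow_succ', Nat.sub_add_cancel hj1]
    rw [hz]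
    field_simp
  rw [h2.deriv, ← h3, genFun]
  ring

/-- The equation z F' = θ (∑ f(j) z^j) F is the recursion of `multSum` read on coefficients. Cutting
the exponent at n makes F entire for any f and does not affect the coefficients up to n. -/
lemma taylorCoeff_genFun (θ : ℝ) (f : ℕ → ℂ) {n k : ℕ} (hk : k ≤ n) :
    taylorCoeff (genFun θ f n) k = multSum θ f k := by
  refine eq_multSum_of_rec θ f (taylorCoeff (genFun θ f n)) n ?_ (fun k hk1 hkn => ?_) k hk
  · simp only [taylorCoeff, iteratedDeriv_zero, genFun, Nat.factorial_zero, Nat.cast_one, div_one]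
    rw [Finset.sum_eq_zero, mul_zero, Complex.exp_zero]
    intro j hj
    have hj1 := (Finset.mem_Icc.1 hj).1
    rw [zero_pow (by omega)]
    simp
  · have h := taylorCoeff_id_mul_deriv (differentiable_genFun θ f n) k
    simp_rw [id_mul_deriv_genFun] at h
    rw [taylorCoeff_mul (by fun_prop) (differentiable_genFun θ f n)] at h
    simp_rw [taylorCoeff_sum] at h
    rw [Complex.real_smul, Complex.real_smul, Complex.ofReal_natCast, ← h, Finset.mul_sum]
    have hsub : Finset.Icc 1 k ⊆ Finset.range (k + 1) := by
      intro j hj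
      simp only [Finset.mem_Icc, Finset.mem_range] at *
      omega
    rw [← Finset.sum_subset hsub]
    · refine Finset.sum_congr rfl fun j hj => ?_
      have : (Finset.Icc 1 n).filter (fun i => i = j) = {j} := by
        ext x
        simp only [Finset.mem_filter, Finset.mem_Icc, Finset.mem_singleton] at hj ⊢
        constructor <;> omega
      rw [this, Finset.sum_singleton, mul_assoc]
    · intro j hj hj'
      have : (Finset.Icc 1 n).filter (fun i => i = j) = ∅ := by
        ext x
        simp only [Finset.mem_filter, Finset.mem_Icc, Finset.mem_range, Finset.notMem_empty,
          iff_false] at hj hj' ⊢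
        rintro ⟨⟨h1, h2⟩, h3⟩
        omega
      rw [this, Finset.sum_empty, zero_mul]

lemma genFun_add (θ : ℝ) (f g : ℕ → ℂ) (n : ℕ) (z : ℂ) :
    genFun θ (fun j => f j + g j) n z = genFun θ f n z * genFun θ g n z := by
  unfold genFun
  rw [← Complex.exp_add, ← mul_add, ← Finset.sum_add_distrib]
  congr 2
  refine Finset.sum_congr rfl fun j _ => ?_
  ring

lemma multSum_add (θ : ℝ) (f g : ℕ → ℂ) (n : ℕ) :
    multSum θ (fun j => f j + g j) n =
      ∑ i ∈ Finset.range (n + 1), multSum θ f i * multSum θ g (n - i) := by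
  rw [← taylorCoeff_genFun θ _ le_rfl]
  have : genFun θ (fun j => f j + g j) n = fun z => genFun θ f n z * genFun θ g n z :=
    funext (genFun_add θ f g n)
  rw [this, taylorCoeff_mul (differentiable_genFun θ f n) (differentiable_genFun θ g n)]
  refine Finset.sum_congr rfl fun i hi => ?_
  have := Finset.mem_range.1 hi
  rw [taylorCoeff_genFun θ _ (by omega), taylorCoeff_genFun θ _ (by omega)]

lemma multSum_ofReal (θ : ℝ) (f : ℕ → ℝ) (n : ℕ) :
    multSum θ (fun j => (f j : ℂ)) n = ((multSum θ f n : ℝ) : ℂ) := by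
  unfold multSum partitionSum
  push_cast
  refine Finset.sum_congr rfl fun p _ => ?_
  rw [Complex.real_smul, smul_eq_mul, Complex.ofReal_mul, ← Complex.ofRealHom_eq_coe,
    ← Complex.ofRealHom_eq_coe, map_multiset_prod, Multiset.map_map]
  rfl

lemma multSum_add_real (θ : ℝ) (f g : ℕ → ℝ) (n : ℕ) :
    multSum θ (fun j => f j + g j) n =
      ∑ i ∈ Finset.range (n + 1), multSum θ f i * multSum θ g (n - i) := by
  have h := multSum_add θ (fun j => (f j : ℂ)) (fun j => (g j : ℂ)) n
  simp_rw [← Complex.ofReal_add, multSum_ofReal] at h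
  exact_mod_cast h

lemma multSum_nonneg {θ : ℝ} (hθ : 0 ≤ θ) {f : ℕ → ℝ} (hf : ∀ j, 0 ≤ f j) (n : ℕ) :
    0 ≤ multSum θ f n := by
  refine partitionSum_nonneg hθ n fun s => Multiset.prod_nonneg fun x hx => ?_
  obtain ⟨j, _, rfl⟩ := Multiset.mem_map.1 hx
  exact hf j

/-- Evaluation at z = 1 of a power series with nonnegative coefficients. -/
lemma sum_multSum_le_exp {θ : ℝ} (hθ : 0 ≤ θ) {f : ℕ → ℝ} (hf : ∀ j, 0 ≤ f j) (n : ℕ) :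
    ∑ k ∈ Finset.range (n + 1), multSum θ f k ≤
      Real.exp (θ * ∑ j ∈ Finset.Icc 1 n, f j / j) := by
  have h := hasSum_taylorCoeff (differentiable_genFun θ
    (fun j => ((if j ≤ n then f j else 0 : ℝ) : ℂ)) n) 1
  -- `taylorCoeff_genFun` identifies coefficients only up to the cut. As f is now zero beyond n, the
  -- cut can be raised, so that all coefficients are known to be nonnegative.
  have hF : ∀ m, n ≤ m → genFun θ (fun j => ((if j ≤ n then f j else 0 : ℝ) : ℂ)) n =
      genFun θ (fun j => ((if j ≤ n then f j else 0 : ℝ) : ℂ)) m := by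
    intro m hm
    funext z
    unfold genFun
    congr 2
    refine Finset.sum_subset (Finset.Icc_subset_Icc_right hm) fun j hj hj' => ?_
    simp only [Finset.mem_Icc] at hj hj'
    have : ¬ j ≤ n := by omega
    simp [this]
  have hc : ∀ k, taylorCoeff (genFun θ (fun j => ((if j ≤ n then f j else 0 : ℝ) : ℂ)) n) k =
      ((multSum θ (fun j => if j ≤ n then f j else 0) k : ℝ) : ℂ) := by
    intro k
    rw [hF (max n k) (le_max_left _ _), taylorCoeff_genFun θ _ (le_max_right _ _), multSum_ofReal]
  have hv : genFun θ (fun j => ((if j ≤ n then f j else 0 : ℝ) : ℂ)) n 1 =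
      ((Real.exp (θ * ∑ j ∈ Finset.Icc 1 n, f j / j) : ℝ) : ℂ) := by
    unfold genFun
    push_cast
    congr 2
    refine Finset.sum_congr rfl fun j hj => ?_
    rw [if_pos (Finset.mem_Icc.1 hj).2, one_pow, mul_one]
  rw [hv] at h
  simp_rw [hc, one_pow, mul_one] at h
  have h' := Complex.hasSum_ofReal.1 h
  have hle := sum_le_hasSum (Finset.range (n + 1)) (fun k _ => multSum_nonneg hθ
    (fun j => by split_ifs <;> [exact hf j; exact le_rfl]) k) h'
  refine le_trans (le_of_eq ?_) hle
  refine Finset.sum_congr rfl fun k hk => ?_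
  unfold multSum
  refine partitionSum_congr θ k fun p => ?_
  congr 1
  refine Multiset.map_congr rfl fun j hj => ?_
  have := le_of_mem_parts p hj
  have := Finset.mem_range.1 hk
  rw [if_pos (by omega)]

lemma norm_multSum_le {θ : ℝ} (hθ : 0 ≤ θ) {f : ℕ → ℂ} (hf : ∀ j, ‖f j‖ ≤ 1) (n : ℕ) :
    ‖multSum θ f n‖ ≤ binomCoeff θ n := by
  rw [← partitionSum_one]
  refine (norm_partitionSum_le hθ n _).trans (partitionSum_mono hθ n fun p => ?_)
  induction p.parts using Multiset.induction_on with
  | empty => simp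
  | cons a s ih =>
    rw [Multiset.map_cons, Multiset.prod_cons, norm_mul]
    exact mul_le_one₀ (hf a) (norm_nonneg _) ih

/-! ### A Halász-type upper bound. -/

/-- Parseval's identity for the Taylor polynomials, which converge boundedly on the circle; the
inequality suffices. -/
lemma sum_sq_taylorCoeff_le {K : ℂ → ℂ} (hK : Differentiable ℂ K) (N : ℕ) :
    ∑ k ∈ Finset.range N, ‖taylorCoeff K k‖ ^ 2 ≤
      Real.circleAverage (fun z => ‖K z‖ ^ 2) 0 1 := by
  let P : ℕ → Polynomial ℂ := fun M =>
    ∑ k ∈ Finset.range M, Polynomial.monomial k (taylorCoeff K k)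
  have hcoeff : ∀ M k, (P M).coeff k = if k < M then taylorCoeff K k else 0 := by
    intro M k
    simp only [P, Polynomial.finsetSum_coeff, Polynomial.coeff_monomial, Finset.sum_ite_eq',
      Finset.mem_range]
  have heval : ∀ M z, (P M).eval z = ∑ k ∈ Finset.range M, taylorCoeff K k * z ^ k := by
    intro M z
    simp only [P, Polynomial.eval_finsetSum, Polynomial.eval_monomial]
  have hsum : Summable fun k => ‖taylorCoeff K k‖ := by
    have := (hasSum_taylorCoeff hK 1).summable.norm
    simpa using this
  have hlim : Tendsto (fun M => Real.circleAverage (fun z => ‖(P M).eval z‖ ^ 2) 0 1) atTop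
      (𝓝 (Real.circleAverage (fun z => ‖K z‖ ^ 2) 0 1)) := by
    unfold Real.circleAverage
    refine Tendsto.const_smul ?_ _
    refine intervalIntegral.tendsto_integral_filter_of_dominated_convergence
      (fun _ => (∑' k, ‖taylorCoeff K k‖) ^ 2) ?_ ?_ ?_ ?_
    · refine Eventually.of_forall fun M => Continuous.aestronglyMeasurable ?_
      have := (P M).continuous
      fun_prop
    · refine Eventually.of_forall fun M => Eventually.of_forall fun t _ => ?_
      rw [Real.norm_of_nonneg (by positivity)]
      refine pow_le_pow_left₀ (norm_nonneg _) ?_ 2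
      rw [heval]
      refine (norm_sum_le _ _).trans ?_
      refine le_trans (le_of_eq ?_) (hsum.sum_le_tsum (Finset.range M) fun _ _ => norm_nonneg _)
      refine Finset.sum_congr rfl fun k _ => ?_
      rw [norm_mul, norm_pow]
      simp
    · simp
    · refine Eventually.of_forall fun t _ => ?_
      have := (hasSum_taylorCoeff hK (circleMap 0 1 t)).tendsto_sum_nat
      simp_rw [heval]
      exact (this.norm).pow 2
  refine ge_of_tendsto hlim ?_
  filter_upwards [eventually_ge_atTop N] with M hM
  rw [← Polynomial.sum_sq_norm_coeff_eq_circleAverage]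
  have h1 : ∑ k ∈ Finset.range N, ‖taylorCoeff K k‖ ^ 2 =
      ∑ k ∈ Finset.range N, ‖(P M).coeff k‖ ^ 2 := by
    refine Finset.sum_congr rfl fun k hk => ?_
    rw [hcoeff, if_pos (by have := Finset.mem_range.1 hk; omega)]
  have h2 : ∑ k ∈ (P M).support, ‖(P M).coeff k‖ ^ 2 =
      ∑ k ∈ (P M).support ∪ Finset.range N, ‖(P M).coeff k‖ ^ 2 := by
    refine Finset.sum_subset Finset.subset_union_left fun k _ hk => ?_
    rw [Polynomial.notMem_support_iff.1 hk]
    simp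
  rw [h1, h2]
  exact Finset.sum_le_sum_of_subset_of_nonneg Finset.subset_union_right fun _ _ _ => by positivity

/-- The numbers k·`multSum θ f k` are the coefficients of z F' = θ P F with P = ∑ f(j) z^j. Bounding
F by its maximum leaves the mean square of P, at most n as |f| ≤ 1. -/
lemma sum_sq_multSum_le {θ : ℝ} (hθ : 0 ≤ θ) {f : ℕ → ℂ} (hf : ∀ j, ‖f j‖ ≤ 1) (n : ℕ) {M : ℝ}
    (hM : ∀ z : ℂ, ‖z‖ = 1 → ‖genFun θ f n z‖ ≤ M) :
    ∑ k ∈ Finset.range (n + 1), ((k : ℝ) * ‖multSum θ f k‖) ^ 2 ≤ θ ^ 2 * M ^ 2 * n := by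
  let p : Polynomial ℂ := ∑ j ∈ Finset.Icc 1 n, Polynomial.monomial j (f j)
  have heval : ∀ z, p.eval z = ∑ j ∈ Finset.Icc 1 n, f j * z ^ j := by
    intro z
    simp only [p, Polynomial.eval_finsetSum, Polynomial.eval_monomial]
  have hcoeff : ∀ k, p.coeff k = if k ∈ Finset.Icc 1 n then f k else 0 := by
    intro k
    simp only [p, Polynomial.finsetSum_coeff, Polynomial.coeff_monomial, Finset.sum_ite_eq']
  have hp : Real.circleAverage (fun z => ‖p.eval z‖ ^ 2) 0 1 ≤ n := by
    rw [← Polynomial.sum_sq_norm_coeff_eq_circleAverage]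
    have hs : p.support ⊆ Finset.Icc 1 n := by
      intro k hk
      by_contra h
      rw [Polynomial.mem_support_iff, hcoeff, if_neg h] at hk
      exact hk rfl
    calc _ ≤ ∑ k ∈ Finset.Icc 1 n, ‖p.coeff k‖ ^ 2 :=
          Finset.sum_le_sum_of_subset_of_nonneg hs fun _ _ _ => by positivity
      _ ≤ ∑ k ∈ Finset.Icc 1 n, (1 : ℝ) := by
          refine Finset.sum_le_sum fun k hk => ?_
          rw [hcoeff, if_pos hk]
          exact pow_le_one₀ (norm_nonneg _) (hf k)
      _ = n := by simp
  have hF := differentiable_genFun θ f n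
  have hK : Differentiable ℂ fun z => z * deriv (genFun θ f n) z :=
    differentiable_fun_id.mul hF.deriv
  have h1 := sum_sq_taylorCoeff_le hK (n + 1)
  have h2 : Real.circleAverage (fun z => ‖z * deriv (genFun θ f n) z‖ ^ 2) 0 1 ≤
      Real.circleAverage (fun z => (θ ^ 2 * M ^ 2) • ‖p.eval z‖ ^ 2) 0 1 := by
    refine Real.circleAverage_mono ?_ ?_ ?_
    · exact (hK.continuous.norm.pow 2).continuousOn.circleIntegrable'
    · exact ((p.continuous.norm.pow 2).const_smul (θ ^ 2 * M ^ 2)).continuousOn.circleIntegrable'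
    · intro z hz
      have hz1 : ‖z‖ = 1 := by simpa using hz
      have e : z * deriv (genFun θ f n) z = θ * p.eval z * genFun θ f n z := by
        rw [id_mul_deriv_genFun, heval, Finset.mul_sum]
        congr 1
        exact Finset.sum_congr rfl fun j _ => mul_assoc _ _ _
      simp only [e, norm_mul, Complex.norm_real, Real.norm_of_nonneg hθ, smul_eq_mul]
      have := hM z hz1
      rw [mul_pow, mul_pow]
      nlinarith [pow_le_pow_left₀ (norm_nonneg _) this 2,
        mul_nonneg (sq_nonneg θ) (sq_nonneg ‖p.eval z‖)]
  rw [Real.circleAverage_fun_smul] at h2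
  calc _ = ∑ k ∈ Finset.range (n + 1),
        ‖taylorCoeff (fun z => z * deriv (genFun θ f n) z) k‖ ^ 2 := by
        refine Finset.sum_congr rfl fun k hk => ?_
        rw [taylorCoeff_id_mul_deriv hF, taylorCoeff_genFun θ f
          (by have := Finset.mem_range.1 hk; omega), norm_mul, Complex.norm_natCast]
    _ ≤ _ := h1
    _ ≤ _ := h2
    _ ≤ _ := by
        rw [smul_eq_mul]
        exact mul_le_mul_of_nonneg_left hp (by positivity)

/-- A bound of Halász type for the mean value of a multiplicative function. -/
lemma norm_multSum_halasz {θ : ℝ} (hθ : 1 ≤ θ) {f : ℕ → ℂ} (hf : ∀ j, ‖f j‖ ≤ 1) {n x : ℕ}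
    (hx : 1 ≤ x) (hxn : x ≤ n) {M : ℝ} (hM : ∀ z : ℂ, ‖z‖ = 1 → ‖genFun θ f n z‖ ≤ M) :
    ∃ S : ℝ, S ^ 2 ≤ 2 / x * (θ ^ 2 * M ^ 2 * n) ∧
      n * ‖multSum θ f n‖ ≤ x * binomCoeff θ n + θ * S := by
  have hθ0 : 0 ≤ θ := by linarith
  -- Write q_k for the coefficients. The recursion bounds n|q_n| by θ ∑_{k<n} |q_k|. The terms k < x
  -- are estimated trivially by p_k; the rest is S, treated by Cauchy–Schwarz as ∑ (1/k)(k|q_k|).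
  refine ⟨∑ k ∈ Finset.Ico x n, ‖multSum θ f k‖, ?_, ?_⟩
  · have h1 : ∑ k ∈ Finset.Ico x n, ‖multSum θ f k‖ =
        ∑ k ∈ Finset.Ico x n, (1 / (k : ℝ)) * (k * ‖multSum θ f k‖) := by
      refine Finset.sum_congr rfl fun k hk => ?_
      have : (k : ℝ) ≠ 0 := by
        have := (Finset.mem_Ico.1 hk).1
        have : 0 < k := by omega
        positivity
      field_simp
    rw [h1]
    refine (Finset.sum_mul_sq_le_sq_mul_sq _ _ _).trans ?_
    refine mul_le_mul ?_ ?_ (Finset.sum_nonneg fun _ _ => by positivity) (by positivity)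
    · have h2 := sum_Ioc_inv_sq_le_sub (α := ℝ) (k := x) (n := n) (by omega) hxn
      have h3 : ∑ k ∈ Finset.Ico x n, (1 / (k : ℝ)) ^ 2 ≤
          1 / (x : ℝ) ^ 2 + ∑ k ∈ Finset.Ioc x n, ((k : ℝ) ^ 2)⁻¹ := by
        have : Finset.Ico x n ⊆ insert x (Finset.Ioc x n) := by
          intro k hk
          simp only [Finset.mem_Ico, Finset.mem_insert, Finset.mem_Ioc] at *
          omega
        refine (Finset.sum_le_sum_of_subset_of_nonneg this fun _ _ _ => by positivity).trans ?_
        rw [Finset.sum_insert (by simp)]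
        simp
      have hx1 : (1 : ℝ) ≤ x := by exact_mod_cast hx
      have h4 : 1 / (x : ℝ) ^ 2 ≤ 1 / x := by
        gcongr
        nlinarith
      have h5 : (0 : ℝ) ≤ (n : ℝ)⁻¹ := by positivity
      rw [← one_div (x : ℝ)] at h2
      calc _ ≤ _ := h3
        _ ≤ 1 / (x : ℝ) + 1 / x := by linarith
        _ = 2 / x := by ring
    · refine le_trans ?_ (sum_sq_multSum_le hθ0 hf n hM)
      refine Finset.sum_le_sum_of_subset_of_nonneg (fun k hk => ?_) fun _ _ _ => by positivity
      simp only [Finset.mem_Ico, Finset.mem_range] at *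
      omega
  · have h1 := congrArg norm (multSum_rec θ f n)
    rw [norm_smul, norm_smul, Real.norm_natCast, Real.norm_of_nonneg hθ0] at h1
    rw [h1]
    have h2 : ‖∑ j ∈ Finset.Icc 1 n, f j * multSum θ f (n - j)‖ ≤
        ∑ k ∈ Finset.range n, ‖multSum θ f k‖ := by
      rw [← sum_Icc_sub n fun k => ‖multSum θ f k‖]
      refine (norm_sum_le _ _).trans (Finset.sum_le_sum fun j _ => ?_)
      rw [norm_mul]
      exact mul_le_of_le_one_left (norm_nonneg _) (hf j)
    have h3 : ∑ k ∈ Finset.range n, ‖multSum θ f k‖ ≤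
        ∑ k ∈ Finset.range x, binomCoeff θ k + ∑ k ∈ Finset.Ico x n, ‖multSum θ f k‖ := by
      rw [← Finset.sum_range_add_sum_Ico _ hxn]
      gcongr with k
      exact norm_multSum_le hθ0 hf k
    have h4 : θ * ∑ k ∈ Finset.range x, binomCoeff θ k ≤ x * binomCoeff θ n := by
      rw [sum_binomCoeff]
      gcongr
      exact binomCoeff_mono hθ hxn
    nlinarith

/-- If the mean value of a multiplicative function is not small, then the function is close to
one of the functions `j ↦ z ^ (-j)`. -/
lemma exists_close_of_norm_multSum_ge {θ : ℝ} (hθ : 1 ≤ θ) {c : ℝ} (hc : 0 < c) :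
    ∃ C : ℝ, ∃ N₀ : ℕ, ∀ n ≥ N₀, ∀ f : ℕ → ℂ, (∀ j, ‖f j‖ ≤ 1) →
      c * binomCoeff θ n ≤ ‖multSum θ f n‖ →
      ∃ z : ℂ, ‖z‖ = 1 ∧ ∑ j ∈ Finset.Icc 1 n, (1 - (f j * z ^ j).re) / j ≤ C := by
  set K : ℝ := Real.exp θ * θ ^ (θ - 1) with hKdef
  have hK : 0 < K := by positivity
  -- If |q_n| ≥ c p_n, the Halász bound with x between cn/4 and cn/2 forces M² ≥ d (n p_n)². If
  -- every z fails, then M = K e^(-θC) n p_n is admissible, and C large is contradictory.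
  set d : ℝ := c ^ 3 / (32 * θ ^ 4) with hd
  have hd0 : 0 < d := by positivity
  -- the constant `C` is chosen with `(K e ^ (-θ C)) ^ 2 < d`
  obtain ⟨C, hC⟩ : ∃ C : ℝ, (K * Real.exp (-(θ * C))) ^ 2 < d := by
    have h : Tendsto (fun C : ℝ => (K * Real.exp (-(θ * C))) ^ 2) atTop (𝓝 ((K * 0) ^ 2)) := by
      refine Tendsto.pow (Tendsto.const_mul _ ?_) 2
      exact Real.tendsto_exp_neg_atTop_nhds_zero.comp
        (tendsto_id.const_mul_atTop (by linarith))
    rw [mul_zero, zero_pow two_ne_zero] at h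
    exact (h.eventually (gt_mem_nhds hd0)).exists
  refine ⟨C, max 1 ⌈2 / c⌉₊, fun n hn f hf hfn => ?_⟩
  by_contra! hcon
  have hn1 : 1 ≤ n := le_trans (le_max_left _ _) hn
  have hn0 : (0 : ℝ) < n := by exact_mod_cast hn1
  have hn2 : 2 / c ≤ n := (Nat.le_ceil _).trans (by exact_mod_cast (le_max_right 1 _).trans hn)
  have hp := binomCoeff_pos hθ n
  have hθ0 : 0 ≤ θ := by linarith
  have hc1 : c ≤ 1 := by
    have := hfn.trans (norm_multSum_le hθ0 hf n)
    by_contra h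
    nlinarith
  have hcn : 2 ≤ c * n := by
    rw [div_le_iff₀ hc] at hn2
    linarith
  -- With this x the trivial term x p_n is at most half of the assumed lower bound for n|q_n|.
  set x : ℕ := ⌊c * n / 2⌋₊ with hx
  have hx1 : 1 ≤ x := Nat.le_floor (by rw [Nat.cast_one]; linarith)
  have hxle : (x : ℝ) ≤ c * n / 2 := Nat.floor_le (by positivity)
  have hxge : c * n / 4 ≤ x := by
    have := Nat.lt_floor_add_one (c * n / 2)
    have h1 : (1 : ℝ) ≤ x := by exact_mod_cast hx1
    rw [← hx] at this
    linarith
  have hxn : x ≤ n := by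
    have : (x : ℝ) ≤ n := by nlinarith
    exact_mod_cast this
  set M : ℝ := K * Real.exp (-(θ * C)) * (n * binomCoeff θ n) with hM
  have hM0 : 0 < M := by positivity
  have hbound : ∀ z : ℂ, ‖z‖ = 1 → ‖genFun θ f n z‖ ≤ M := by
    intro z hz
    have h1 := hcon z hz
    have h2 : ((θ : ℂ) * ∑ j ∈ Finset.Icc 1 n, f j * z ^ j / j).re =
        θ * harmonicSum n - θ * ∑ j ∈ Finset.Icc 1 n, (1 - (f j * z ^ j).re) / j := by
      rw [Complex.re_ofReal_mul, Complex.re_sum, ← mul_sub, harmonicSum, ← Finset.sum_sub_distrib]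
      congr 1
      refine Finset.sum_congr rfl fun j _ => ?_
      rw [Complex.div_natCast_re]
      ring
    rw [genFun, Complex.norm_exp, h2]
    have h3 := exp_harmonicSum_le hθ hn1
    calc _ ≤ Real.exp (θ * harmonicSum n + -(θ * C)) := by
          apply Real.exp_le_exp.2
          nlinarith
      _ = Real.exp (θ * harmonicSum n) * Real.exp (-(θ * C)) := Real.exp_add _ _
      _ ≤ (K * (n * binomCoeff θ n)) * Real.exp (-(θ * C)) := by gcongr
      _ = M := by rw [hM]; ring
  obtain ⟨S, hS, hSn⟩ := norm_multSum_halasz hθ hf hx1 hxn hbound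
  have hx0 : (0 : ℝ) < x := by exact_mod_cast hx1
  have h1 : c * n * binomCoeff θ n / 2 ≤ θ * S := by
    have e1 : n * (c * binomCoeff θ n) ≤ n * ‖multSum θ f n‖ := by gcongr
    have e2 : x * binomCoeff θ n ≤ c * n / 2 * binomCoeff θ n := by gcongr
    linarith
  have h2 : S ^ 2 ≤ 8 / c * (θ ^ 2 * M ^ 2) := by
    refine hS.trans ?_
    have : 2 / (x : ℝ) * (θ ^ 2 * M ^ 2 * n) = (2 * n / x) * (θ ^ 2 * M ^ 2) := by ring
    rw [this]
    gcongr ?_ * _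
    rw [div_le_div_iff₀ hx0 hc]
    linarith
  have h3 : (c * n * binomCoeff θ n / 2) ^ 2 ≤ θ ^ 2 * (8 / c * (θ ^ 2 * M ^ 2)) :=
    calc _ ≤ (θ * S) ^ 2 := by gcongr
      _ = θ ^ 2 * S ^ 2 := by ring
      _ ≤ _ := by gcongr
  have h4 : M ^ 2 = (K * Real.exp (-(θ * C))) ^ 2 * (n * binomCoeff θ n) ^ 2 := by
    rw [hM]
    ring
  have h5 : d * (n * binomCoeff θ n) ^ 2 ≤ M ^ 2 := by
    have e : θ ^ 2 * (8 / c * (θ ^ 2 * M ^ 2)) = 8 * θ ^ 4 / c * M ^ 2 := by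
      field_simp
    rw [e, div_mul_eq_mul_div, le_div_iff₀ hc] at h3
    rw [hd, div_mul_eq_mul_div, div_le_iff₀ (by positivity)]
    nlinarith
  rw [h4] at h5
  have h6 : 0 < (n * binomCoeff θ n) ^ 2 := by positivity
  nlinarith [le_of_mul_le_mul_right h5 h6]

/-! ### A sieve lower bound for nonnegative multiplicative functions. -/

section Sieve

variable {θ : ℝ} {f : ℕ → ℝ}

lemma multSum_le_binomCoeff (hθ : 0 ≤ θ) (hf : ∀ j, 0 ≤ f j ∧ f j ≤ 1) (n : ℕ) :
    multSum θ f n ≤ binomCoeff θ n := by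
  have h := norm_multSum_le hθ (f := fun j => (f j : ℂ)) (fun j => by
    rw [Complex.norm_real, Real.norm_of_nonneg (hf j).1]
    exact (hf j).2) n
  rw [multSum_ofReal, Complex.norm_real] at h
  exact (le_abs_self _).trans h

/-- From 1 = f + (1-f), the p_k are the convolution of the coefficients of f and of 1-f. The sum
over a triangle is at most the product of the two sums, and the one for 1-f is at most e^(θC). This
bounds q_k from below only on average. -/
lemma le_sum_multSum (hθ : 1 ≤ θ) (hf : ∀ j, 0 ≤ f j ∧ f j ≤ 1) {N x : ℕ} {C : ℝ}
    (hC : ∑ j ∈ Finset.Icc 1 N, (1 - f j) / j ≤ C) (hx : x ≤ N) :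
    Real.exp (-(θ * C)) * (x * binomCoeff θ x) ≤ θ * ∑ k ∈ Finset.range x, multSum θ f k := by
  have hθ0 : 0 ≤ θ := by linarith
  rcases Nat.eq_zero_or_pos x with rfl | hx0
  · simp
  have hg : ∀ j, 0 ≤ 1 - f j := fun j => by linarith [(hf j).2]
  set b : ℕ → ℝ := multSum θ (fun j => 1 - f j) with hb
  have hb0 : ∀ k, 0 ≤ b k := multSum_nonneg hθ0 hg
  have hq0 : ∀ k, 0 ≤ multSum θ f k := multSum_nonneg hθ0 fun j => (hf j).1
  have hbsum : ∑ k ∈ Finset.range x, b k ≤ Real.exp (θ * C) := by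
    have h := sum_multSum_le_exp hθ0 hg (x - 1)
    rw [Nat.sub_add_cancel hx0] at h
    refine h.trans (Real.exp_le_exp.2 (mul_le_mul_of_nonneg_left (le_trans ?_ hC) hθ0))
    refine Finset.sum_le_sum_of_subset_of_nonneg (Finset.Icc_subset_Icc_right (by omega))
      fun j _ _ => div_nonneg (hg j) (Nat.cast_nonneg j)
  have hconv : ∑ k ∈ Finset.range x, binomCoeff θ k ≤
      (∑ k ∈ Finset.range x, multSum θ f k) * ∑ k ∈ Finset.range x, b k := by
    have h1 : ∀ k, binomCoeff θ k =
        ∑ i ∈ Finset.range (k + 1), multSum θ f i * b (k - i) := by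
      intro k
      rw [← multSum_one, hb, ← multSum_add_real]
      simp
    simp_rw [h1]
    rw [Finset.sum_mul_sum, ← Finset.sum_product', Finset.sum_sigma']
    have hinj : Set.InjOn (fun p : (_ : ℕ) × ℕ => (p.2, p.1 - p.2))
        ((Finset.range x).sigma fun k => Finset.range (k + 1)) := by
      rintro ⟨k, i⟩ h ⟨k', i'⟩ h' e
      simp only [Finset.coe_sigma, Set.mem_sigma_iff, Finset.mem_coe, Finset.mem_range,
        Prod.mk.injEq] at h h' e
      obtain ⟨rfl, e⟩ := e
      have : k = k' := by omega
      subst this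
      rfl
    rw [← Finset.sum_image (f := fun q : ℕ × ℕ => multSum θ f q.1 * b q.2) hinj]
    refine Finset.sum_le_sum_of_subset_of_nonneg ?_ fun q _ _ => mul_nonneg (hq0 _) (hb0 _)
    intro q hq
    obtain ⟨⟨k, i⟩, h, rfl⟩ := Finset.mem_image.1 hq
    simp only [Finset.mem_sigma, Finset.mem_range, Finset.mem_product] at *
    omega
  have hQ0 : 0 ≤ ∑ k ∈ Finset.range x, multSum θ f k := Finset.sum_nonneg fun k _ => hq0 k
  rw [← sum_binomCoeff, Real.exp_neg, ← div_eq_inv_mul, div_le_iff₀ (Real.exp_pos _)]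
  calc _ ≤ θ * ((∑ k ∈ Finset.range x, multSum θ f k) * ∑ k ∈ Finset.range x, b k) := by gcongr
    _ ≤ θ * ((∑ k ∈ Finset.range x, multSum θ f k) * Real.exp (θ * C)) := by gcongr
    _ = _ := by ring

lemma sum_subset_le_multSum (hθ : 0 ≤ θ) (hf : ∀ j, 0 ≤ f j) {n : ℕ} {s : Finset ℕ}
    (hs : s ⊆ Finset.Icc 1 n) :
    θ * ∑ i ∈ s, f i * multSum θ f (n - i) ≤ n * multSum θ f n := by
  have h := multSum_rec θ f n
  rw [smul_eq_mul, smul_eq_mul] at h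
  rw [h]
  refine mul_le_mul_of_nonneg_left (Finset.sum_le_sum_of_subset_of_nonneg hs fun j _ _ =>
    mul_nonneg (hf j) (multSum_nonneg hθ hf _)) hθ

/-- A lower bound on a scale `(2y, 4y]` on which `1 - f` has small logarithmic mass. -/
lemma le_multSum_of_scale (hθ : 1 ≤ θ) (hf : ∀ j, 0 ≤ f j ∧ f j ≤ 1) {N y : ℕ} {C : ℝ}
    (hC : ∑ j ∈ Finset.Icc 1 N, (1 - f j) / j ≤ C) (hy : 1 ≤ y) (hyN : 4 * y ≤ N)
    (hη : ∑ j ∈ Finset.Ioc y (4 * y), (1 - f j) / j ≤ Real.exp (-(θ * C)) / (8 * θ))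
    {m : ℕ} (hm : 2 * y < m) (hm4 : m ≤ 4 * y) :
    Real.exp (-(θ * C)) / 8 * binomCoeff θ y ≤ multSum θ f m := by
  have hθ0 : 0 < θ := by linarith
  set E := Real.exp (-(θ * C)) with hE
  have hE0 : 0 < E := Real.exp_pos _
  have hy0 : (0 : ℝ) < y := by exact_mod_cast hy
  have hp := binomCoeff_pos hθ y
  have hq0 : ∀ k, 0 ≤ multSum θ f k := multSum_nonneg hθ0.le fun j => (hf j).1
  have h1 := le_sum_multSum hθ hf hC (x := y) (by omega)
  -- To pass from averages to a single m, only the parts i in (m-y, m] are kept. Then m-i runs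
  -- through all of [0, y), and i lies in (y, 4y], where replacing f(i) by 1 costs at most half of
  -- the main term.
  have h2 := sum_subset_le_multSum hθ0.le (fun j => (hf j).1) (n := m)
    (s := Finset.Ioc (m - y) m) (fun k hk => by
      simp only [Finset.mem_Ioc, Finset.mem_Icc] at *
      omega)
  have hreindex : ∀ F : ℕ → ℝ, ∑ i ∈ Finset.Ioc (m - y) m, F (m - i) =
      ∑ k ∈ Finset.range y, F k := by
    intro F
    refine Finset.sum_bij' (fun j _ => m - j) (fun k _ => m - k) ?_ ?_ ?_ ?_ ?_ <;>
      intro j hj <;> simp only [Finset.mem_Ioc, Finset.mem_range] at * <;> omega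
  have h3 : ∑ i ∈ Finset.Ioc (m - y) m, f i * multSum θ f (m - i) =
      ∑ k ∈ Finset.range y, multSum θ f k -
        ∑ i ∈ Finset.Ioc (m - y) m, (1 - f i) * multSum θ f (m - i) := by
    rw [← hreindex, ← Finset.sum_sub_distrib]
    refine Finset.sum_congr rfl fun i _ => ?_
    ring
  have h4 : ∑ i ∈ Finset.Ioc (m - y) m, (1 - f i) * multSum θ f (m - i) ≤
      4 * y * binomCoeff θ y * (E / (8 * θ)) := by
    calc _ ≤ ∑ i ∈ Finset.Ioc (m - y) m, 4 * y * binomCoeff θ y * ((1 - f i) / i) := by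
          refine Finset.sum_le_sum fun i hi => ?_
          rw [Finset.mem_Ioc] at hi
          have hi0 : (0 : ℝ) < i := by
            have : 0 < i := by omega
            exact_mod_cast this
          have hi4 : (i : ℝ) ≤ 4 * y := by exact_mod_cast hi.2.trans hm4
          have hg : 0 ≤ 1 - f i := by linarith [(hf i).2]
          have hq : multSum θ f (m - i) ≤ binomCoeff θ y :=
            (multSum_le_binomCoeff hθ0.le hf _).trans (binomCoeff_mono hθ (by omega))
          have e : (1 - f i) * binomCoeff θ y ≤ 4 * y * binomCoeff θ y * ((1 - f i) / i) := by
            rw [mul_div_assoc', le_div_iff₀ hi0]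
            nlinarith [mul_le_mul_of_nonneg_left hi4 (mul_nonneg hg hp.le)]
          exact (mul_le_mul_of_nonneg_left hq hg).trans e
      _ ≤ ∑ i ∈ Finset.Ioc y (4 * y), 4 * y * binomCoeff θ y * ((1 - f i) / i) := by
          refine Finset.sum_le_sum_of_subset_of_nonneg (fun k hk => ?_) fun i _ _ => ?_
          · simp only [Finset.mem_Ioc] at *
            omega
          · have : 0 ≤ 1 - f i := by linarith [(hf i).2]
            positivity
      _ ≤ _ := by
          rw [← Finset.mul_sum]
          gcongr
  rw [h3] at h2
  have h5 : θ * (4 * y * binomCoeff θ y * (E / (8 * θ))) = y * binomCoeff θ y * E / 2 := by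
    field_simp
    ring
  have h6 : y * binomCoeff θ y * E / 2 ≤ m * multSum θ f m := by
    have := mul_le_mul_of_nonneg_left h4 hθ0.le
    rw [h5] at this
    linarith
  have h7 : (m : ℝ) * multSum θ f m ≤ 4 * y * multSum θ f m := by
    have : (m : ℝ) ≤ 4 * y := by exact_mod_cast hm4
    exact mul_le_mul_of_nonneg_right this (hq0 m)
  have h8 : y * (E / 8 * binomCoeff θ y) ≤ y * multSum θ f m := by linarith
  exact le_of_mul_le_mul_left h8 hy0

/-- Propagation of a lower bound by parts from `(y, 2y]`. -/
lemma le_multSum_of_step (hθ : 1 ≤ θ) (hf : ∀ j, 0 ≤ f j ∧ f j ≤ 1) {N y : ℕ} {τ κ : ℝ}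
    (hκ : 0 ≤ κ) (hy : 1 ≤ y) (hτ : 0 ≤ τ) (hτN : 2 * τ * N ≤ y)
    (hη : ∑ j ∈ Finset.Ioc y (4 * y), (1 - f j) / j ≤ 1 / 4)
    (h0 : ∀ m, 2 * y < m → m ≤ 4 * y → κ ≤ multSum θ f m) (hyN : y ≤ N) :
    ∀ r m, 2 * y < m → m ≤ 4 * y + r * y → m ≤ N → κ * τ ^ r ≤ multSum θ f m := by
  have hy0 : (0 : ℝ) < y := by exact_mod_cast hy
  have hτ1 : τ ≤ 1 := by
    have : (y : ℝ) ≤ N := by exact_mod_cast hyN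
    by_contra h
    nlinarith
  have hfsum : (y : ℝ) / 2 ≤ ∑ i ∈ Finset.Ioc y (2 * y), f i := by
    have h1 : ∑ i ∈ Finset.Ioc y (2 * y), (1 - f i) ≤ 2 * y * (1 / 4) := by
      calc _ ≤ ∑ i ∈ Finset.Ioc y (2 * y), 2 * y * ((1 - f i) / i) := by
            refine Finset.sum_le_sum fun i hi => ?_
            rw [Finset.mem_Ioc] at hi
            have hi0 : (0 : ℝ) < i := by
              have : 0 < i := by omega
              exact_mod_cast this
            have hi4 : (i : ℝ) ≤ 2 * y := by exact_mod_cast hi.2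
            have hg : 0 ≤ 1 - f i := by linarith [(hf i).2]
            rw [mul_div_assoc', le_div_iff₀ hi0]
            nlinarith
        _ ≤ ∑ i ∈ Finset.Ioc y (4 * y), 2 * y * ((1 - f i) / i) := by
            refine Finset.sum_le_sum_of_subset_of_nonneg (fun k hk => ?_) fun i _ _ => ?_
            · simp only [Finset.mem_Ioc] at *
              omega
            · have : 0 ≤ 1 - f i := by linarith [(hf i).2]
              positivity
        _ ≤ _ := by
            rw [← Finset.mul_sum]
            gcongr
    rw [Finset.sum_sub_distrib] at h1
    simp only [Finset.sum_const, Nat.card_Ioc, nsmul_eq_mul, mul_one] at h1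
    have e : ((2 * y - y : ℕ) : ℝ) = y := by
      congr 1
      omega
    rw [e] at h1
    linarith
  intro r
  induction r with
  | zero =>
    intro m hm hm4 _
    rw [pow_zero, mul_one]
    exact h0 m hm (by omega)
  | succ r ih =>
    intro m hm hm4 hmN
    by_cases hmr : m ≤ 4 * y + r * y
    · refine le_trans ?_ (ih m hm hmr hmN)
      rw [pow_succ, ← mul_assoc]
      exact mul_le_of_le_one_right (by positivity) hτ1
    · have hm4' : m ≤ 4 * y + r * y + y := by
        rw [add_mul, one_mul] at hm4
        omega
      have hθ0 : 0 ≤ θ := by linarith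
      -- A part i in (y, 2y] leads from m back to the range already treated. There f has total mass
      -- at least y/2, and division by m ≤ N loses at most the factor τ ≤ y/(2N).
      have h2 := sum_subset_le_multSum hθ0 (fun j => (hf j).1) (n := m)
        (s := Finset.Ioc y (2 * y)) (fun k hk => by
          simp only [Finset.mem_Ioc, Finset.mem_Icc] at *
          omega)
      have h3 : κ * τ ^ r * (y / 2) ≤ ∑ i ∈ Finset.Ioc y (2 * y), f i * multSum θ f (m - i) := by
        calc _ ≤ κ * τ ^ r * ∑ i ∈ Finset.Ioc y (2 * y), f i := by gcongr
          _ = ∑ i ∈ Finset.Ioc y (2 * y), f i * (κ * τ ^ r) := by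
              rw [Finset.mul_sum]
              exact Finset.sum_congr rfl fun i _ => mul_comm _ _
          _ ≤ _ := by
              refine Finset.sum_le_sum fun i hi => ?_
              rw [Finset.mem_Ioc] at hi
              exact mul_le_mul_of_nonneg_left (ih (m - i) (by omega) (by omega) (by omega))
                (hf i).1
      have hm0 : (0 : ℝ) < m := by
        have : 0 < m := by omega
        exact_mod_cast this
      have hmN' : (m : ℝ) ≤ N := by exact_mod_cast hmN
      have h4 : m * (κ * τ ^ (r + 1)) ≤ m * multSum θ f m := by
        have e1 : 2 * τ * m ≤ y := (mul_le_mul_of_nonneg_left hmN' (by positivity)).trans hτN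
        have e0 : 0 ≤ κ * τ ^ r := by positivity
        calc m * (κ * τ ^ (r + 1)) = κ * τ ^ r * ((2 * τ * m) / 2) := by ring
          _ ≤ κ * τ ^ r * (y / 2) := by gcongr
          _ ≤ 1 * ∑ i ∈ Finset.Ioc y (2 * y), f i * multSum θ f (m - i) := by rwa [one_mul]
          _ ≤ θ * ∑ i ∈ Finset.Ioc y (2 * y), f i * multSum θ f (m - i) := by
              gcongr
              exact le_trans (by positivity) h3
          _ ≤ _ := h2
      exact le_of_mul_le_mul_left h4 hm0

/-- Pigeonhole: the K disjoint blocks (4^s, 4^(s+1)] with t-K ≤ s < t share a total mass of at most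
C. -/
lemma exists_scale (hf : ∀ j, f j ≤ 1) {N K t : ℕ} (hK : 1 ≤ K) {C : ℝ} (hKt : K ≤ t)
    (ht : 4 ^ t ≤ N) (hC : ∑ j ∈ Finset.Icc 1 N, (1 - f j) / j ≤ C) :
    ∃ s, t ≤ s + K ∧ s < t ∧
      ∑ j ∈ Finset.Ioc (4 ^ s) (4 * 4 ^ s), (1 - f j) / (j : ℝ) ≤ C / K := by
  by_contra! hcon
  have hg : ∀ j : ℕ, 0 ≤ (1 - f j) / j := fun j =>
    div_nonneg (by linarith [hf j]) (Nat.cast_nonneg j)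
  have hK0 : (0 : ℝ) < K := by exact_mod_cast hK
  have h1 : ∑ s ∈ Finset.Ico (t - K) t, C / K <
      ∑ s ∈ Finset.Ico (t - K) t, ∑ j ∈ Finset.Ioc (4 ^ s) (4 * 4 ^ s), (1 - f j) / (j : ℝ) := by
    refine Finset.sum_lt_sum_of_nonempty (Finset.nonempty_Ico.2 (by omega)) fun s hs => ?_
    rw [Finset.mem_Ico] at hs
    exact hcon s (by omega) hs.2
  have h2 : ∀ a b : ℕ, a ≤ b → ∑ s ∈ Finset.Ico a b,
      ∑ j ∈ Finset.Ioc (4 ^ s) (4 * 4 ^ s), (1 - f j) / (j : ℝ) =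
      ∑ j ∈ Finset.Ioc (4 ^ a) (4 ^ b), (1 - f j) / (j : ℝ) := by
    intro a b hab
    induction b, hab using Nat.le_induction with
    | base => simp
    | succ b hab ih =>
      rw [Finset.sum_Ico_succ_top hab, ih, pow_succ, mul_comm (4 ^ b) 4]
      exact Finset.sum_Ioc_consecutive _ (Nat.pow_le_pow_right (by norm_num) hab) (by omega)
  rw [h2 _ _ (by omega), Finset.sum_const, Nat.card_Ico, nsmul_eq_mul,
    show t - (t - K) = K by omega, mul_div_cancel₀ _ hK0.ne'] at h1
  refine absurd (h1.trans_le ?_) (not_lt.2 hC)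
  refine Finset.sum_le_sum_of_subset_of_nonneg (fun j hj => ?_) fun j _ _ => hg j
  simp only [Finset.mem_Ioc, Finset.mem_Icc] at *
  exact ⟨(Nat.zero_le _).trans_lt hj.1, hj.2.trans ht⟩

/-- The sieve lower bound: if `1 - f` has bounded logarithmic mass, then the mean value of the
multiplicative function of `f` is bounded from below. -/
lemma exists_le_multSum (hθ : 1 ≤ θ) (C : ℝ) :
    ∃ c : ℝ, 0 < c ∧ ∃ N₀ : ℕ, ∀ N ≥ N₀, ∀ f : ℕ → ℝ, (∀ j, 0 ≤ f j ∧ f j ≤ 1) →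
      ∑ j ∈ Finset.Icc 1 N, (1 - f j) / j ≤ C → c * binomCoeff θ N ≤ multSum θ f N := by
  set E := Real.exp (-(θ * C)) with hE
  have hE0 : 0 < E := Real.exp_pos _
  have hθ0 : 0 < θ := by linarith
  set η := E / (8 * θ) with hη
  have hη0 : 0 < η := by positivity
  set K : ℕ := ⌈C / η⌉₊ + 1 with hK
  have hKC : C / K ≤ η := by
    have h1 : C / η ≤ K := by
      rw [hK]
      push_cast
      linarith [Nat.le_ceil (C / η)]
    rw [div_le_iff₀ hη0] at h1
    rw [div_le_iff₀ (by positivity)]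
    linarith
  -- The good scale y satisfies N ≤ 4^(K+1) y. Hence 2τN ≤ y, at most 4^(K+1) steps of length y
  -- reach N, and p_y is at least 4^(-(K+1)(θ-1)) p_N.
  set τ : ℝ := 1 / (2 * 4 ^ (K + 1)) with hτ
  have hτ0 : 0 < τ := by positivity
  refine ⟨E / 8 * τ ^ (4 ^ (K + 1)) * ((1 : ℝ) / 4 ^ (K + 1)) ^ (θ - 1), by positivity, 4 ^ K,
    fun N hN f hf hC => ?_⟩
  have hNpos : N ≠ 0 := by
    have : 0 < 4 ^ K := by positivity
    omega
  set t := Nat.log 4 N with ht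
  have ht1 : 4 ^ t ≤ N := Nat.pow_log_le_self 4 hNpos
  have ht2 : N < 4 ^ (t + 1) := Nat.lt_pow_succ_log_self (by norm_num) N
  have hKt : K ≤ t := Nat.le_log_of_pow_le (by norm_num) hN
  obtain ⟨s, hs1, hs2, hs3⟩ := exists_scale (fun j => (hf j).2) (by omega) hKt ht1 hC
  have hC0 : 0 ≤ C := le_trans (Finset.sum_nonneg fun j _ =>
    div_nonneg (by linarith [(hf j).2]) (Nat.cast_nonneg j)) hC
  set y := 4 ^ s with hy
  have hy1 : 1 ≤ y := Nat.one_le_pow _ _ (by norm_num)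
  have hyN : 4 * y ≤ N := by
    refine le_trans ?_ ht1
    rw [hy, ← pow_succ']
    exact Nat.pow_le_pow_right (by norm_num) hs2
  have hNy : N ≤ 4 ^ (K + 1) * y := by
    refine ht2.le.trans ?_
    rw [hy, ← pow_add]
    exact Nat.pow_le_pow_right (by norm_num) (by omega)
  have hNy' : (N : ℝ) ≤ 4 ^ (K + 1) * y := by exact_mod_cast hNy
  have hE1 : E ≤ 1 := Real.exp_le_one_iff.2 (by nlinarith)
  have hη1 : η ≤ 1 / 4 := by
    rw [hη, div_le_iff₀ (by positivity)]
    nlinarith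
  have hp := binomCoeff_pos hθ y
  have hpN := binomCoeff_pos hθ N
  have h1 := le_multSum_of_step hθ hf (N := N) (y := y) (τ := τ) (κ := E / 8 * binomCoeff θ y)
    (by positivity) hy1 hτ0.le (by
      rw [hτ]
      field_simp
      linarith) (hs3.trans (hKC.trans hη1))
    (fun m hm hm4 => le_multSum_of_scale hθ hf hC hy1 hyN (hs3.trans hKC) hm hm4) (by omega)
    (4 ^ (K + 1)) N (by omega) (by omega) le_rfl
  refine le_trans ?_ h1
  have h2 := rpow_ratio_le hθ hy1 (n := N) (by omega)
  have h3 : ((1 : ℝ) / 4 ^ (K + 1)) ^ (θ - 1) ≤ ((y : ℝ) / N) ^ (θ - 1) := by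
    refine Real.rpow_le_rpow (by positivity) ?_ (by linarith)
    rw [div_le_div_iff₀ (by positivity) (by exact_mod_cast Nat.pos_of_ne_zero hNpos)]
    linarith
  have h4 : ((1 : ℝ) / 4 ^ (K + 1)) ^ (θ - 1) * binomCoeff θ N ≤ binomCoeff θ y := by
    rw [← le_div_iff₀ hpN]
    exact h3.trans h2
  calc _ = E / 8 * τ ^ (4 ^ (K + 1)) * (((1 : ℝ) / 4 ^ (K + 1)) ^ (θ - 1) * binomCoeff θ N) := by
        ring
    _ ≤ E / 8 * τ ^ (4 ^ (K + 1)) * binomCoeff θ y := by gcongr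
    _ = _ := by ring

end Sieve

/-! ### Sequences close to linear ones modulo 1. -/

/-- The logarithmically weighted square distance of the sequence `u` to the integers. -/
def logDist (n : ℕ) (u : ℕ → ℝ) : ℝ :=
  ∑ j ∈ Finset.Icc 1 n, (1 - Real.cos (2 * Real.pi * u j)) / j

/-- Because 1 - cos x = |1-e^(ix)|²/2, the square root of the summand is subadditive, and (u+v)² ≤
2u² + 2v². -/
lemma logDist_add_le (n : ℕ) (u v : ℕ → ℝ) :
    logDist n (fun j => u j + v j) ≤ 2 * logDist n u + 2 * logDist n v := by
  unfold logDist
  rw [Finset.mul_sum, Finset.mul_sum, ← Finset.sum_add_distrib]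
  refine Finset.sum_le_sum fun j _ => ?_
  rw [mul_div_assoc', mul_div_assoc', ← add_div]
  refine div_le_div_of_nonneg_right ?_ (Nat.cast_nonneg j)
  rw [mul_add, Real.cos_add]
  set x := 2 * Real.pi * u j
  set y := 2 * Real.pi * v j
  nlinarith [Real.sin_sq_add_cos_sq x, Real.sin_sq_add_cos_sq y,
    sq_nonneg (1 - Real.cos x + (1 - Real.cos y) - (1 - Real.cos x * Real.cos y)),
    sq_nonneg (Real.sin x - Real.sin y), sq_nonneg (2 - Real.cos x - Real.cos y),
    sq_nonneg (Real.cos x - Real.cos y), Real.cos_le_one x, Real.cos_le_one y,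
    sq_nonneg (Real.sin x + Real.sin y)]

lemma logDist_congr (n : ℕ) {u v : ℕ → ℝ} (h : ∀ j, ∃ m : ℤ, u j = v j + m) :
    logDist n u = logDist n v := by
  unfold logDist
  refine Finset.sum_congr rfl fun j _ => ?_
  obtain ⟨m, hm⟩ := h j
  rw [hm, mul_add, mul_comm (2 * Real.pi) (m : ℝ), Real.cos_add_int_mul_two_pi]

lemma logDist_neg (n : ℕ) (u : ℕ → ℝ) : logDist n (fun j => -u j) = logDist n u := by
  unfold logDist
  simp only [mul_neg, Real.cos_neg]

lemma logDist_linear_le (n : ℕ) {δ K : ℝ} (hδ : |δ| * n ≤ K) :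
    logDist n (fun j => δ * j) ≤ 2 * Real.pi ^ 2 * K ^ 2 := by
  have hK : 0 ≤ K := le_trans (by positivity) hδ
  unfold logDist
  rcases Nat.eq_zero_or_pos n with rfl | hn
  · simp
    positivity
  have hn0 : (0 : ℝ) < n := by exact_mod_cast hn
  calc _ ≤ ∑ j ∈ Finset.Icc 1 n, 2 * Real.pi ^ 2 * K ^ 2 / n := by
        refine Finset.sum_le_sum fun j hj => ?_
        obtain ⟨hj1, hj2⟩ := Finset.mem_Icc.1 hj
        have hj0 : (0 : ℝ) < j := by exact_mod_cast hj1
        have hjn : (j : ℝ) ≤ n := by exact_mod_cast hj2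
        have h1 := Real.one_sub_sq_div_two_le_cos (x := 2 * Real.pi * (δ * j))
        have h2 : (|δ| * n) ^ 2 ≤ K ^ 2 := by gcongr
        rw [mul_pow, sq_abs] at h2
        rw [div_le_div_iff₀ hj0 hn0]
        have h3 : (1 - Real.cos (2 * Real.pi * (δ * j))) * n ≤
            (2 * Real.pi ^ 2 * (δ ^ 2 * j ^ 2)) * n := by
          refine mul_le_mul_of_nonneg_right ?_ hn0.le
          nlinarith
        refine h3.trans ?_
        have h4 : δ ^ 2 * (j : ℝ) * n ≤ δ ^ 2 * n ^ 2 := by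
          rw [mul_assoc, pow_two (n : ℝ)]
          gcongr
        calc _ = 2 * Real.pi ^ 2 * (δ ^ 2 * j * n) * j := by ring
          _ ≤ 2 * Real.pi ^ 2 * K ^ 2 * j := by
            gcongr
            exact h4.trans h2
    _ = _ := by
        rw [Finset.sum_const, Nat.card_Icc, nsmul_eq_mul, Nat.add_sub_cancel]
        field_simp

lemma sum_cos_mul_sin (w : ℝ) (a m : ℕ) :
    (∑ j ∈ Finset.Ioc a (a + m), Real.cos (2 * Real.pi * (w * j))) * (2 * Real.sin (Real.pi * w)) =
      Real.sin (2 * Real.pi * w * (a + m) + Real.pi * w) -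
        Real.sin (2 * Real.pi * w * a + Real.pi * w) := by
  induction m with
  | zero => simp
  | succ m ih =>
    rw [← add_assoc, ← Finset.insert_Ioc_right_eq_Ioc_add_one (by omega),
      Finset.sum_insert (by simp), add_mul, ih]
    push_cast
    have e1 : 2 * Real.pi * w * (a + (m + 1)) + Real.pi * w =
        2 * Real.pi * (w * (a + m + 1)) + Real.pi * w := by ring
    have e2 : 2 * Real.pi * w * (a + m) + Real.pi * w =
        2 * Real.pi * (w * (a + m + 1)) - Real.pi * w := by ring
    rw [e1, e2, Real.sin_add (2 * Real.pi * (w * (a + m + 1))),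
      Real.sin_sub (2 * Real.pi * (w * (a + m + 1)))]
    ring

/-- The closed form bounds the cosine sum by 1/sin(πw), which is at most 1/(2w) ≤ m/2 by the
concavity bound of the sine. -/
lemma half_le_sum_one_sub_cos {w : ℝ} (hw : 0 < w) (hw2 : w ≤ 1 / 2) (a : ℕ) {m : ℕ}
    (hm : 1 ≤ w * m) :
    (m : ℝ) / 2 ≤ ∑ j ∈ Finset.Ioc a (a + m), (1 - Real.cos (2 * Real.pi * (w * j))) := by
  have h1 := sum_cos_mul_sin w a m
  have h2 : 2 * w ≤ Real.sin (Real.pi * w) := by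
    have := Real.mul_le_sin (x := Real.pi * w) (by positivity) (by nlinarith [Real.pi_pos])
    refine le_trans (le_of_eq ?_) this
    field_simp
  have h3 := Real.sin_le_one (2 * Real.pi * w * (a + m) + Real.pi * w)
  have h4 := Real.neg_one_le_sin (2 * Real.pi * w * a + Real.pi * w)
  rw [Finset.sum_sub_distrib]
  simp only [Finset.sum_const, Nat.card_Ioc, nsmul_eq_mul, mul_one, Nat.add_sub_cancel_left]
  by_contra! hcon
  set S := ∑ j ∈ Finset.Ioc a (a + m), Real.cos (2 * Real.pi * (w * j))
  have h5 : (m : ℝ) / 2 < S := by linarith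
  have h6 : (m : ℝ) / 2 * (2 * (2 * w)) < S * (2 * Real.sin (Real.pi * w)) := by
    refine mul_lt_mul h5 (by linarith) (by positivity) ?_
    exact le_trans (by positivity) h5.le
  nlinarith

/-- If `j ↦ τ j` is close to the integers, then `τ` is small. -/
lemma abs_mul_le_of_logDist_linear_le {n : ℕ} {τ C : ℝ} (hτ : |τ| ≤ 1 / 2)
    (h : logDist n (fun j => τ * j) ≤ C) : |τ| * n ≤ 2 ^ (⌊4 * C⌋₊ + 2) := by
  rcases eq_or_ne τ 0 with rfl | hτ0
  · simp
  have hsymm : logDist n (fun j => |τ| * j) ≤ C := by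
    rcases abs_choice τ with e | e
    · rwa [e]
    · rw [e]
      have := logDist_neg n fun j => τ * j
      simp only [neg_mul]
      rwa [this]
  set w := |τ| with hw
  have hw0 : 0 < w := abs_pos.2 hτ0
  -- Beyond 1/w the multiples of w keep winding around the circle: each block (W 2^i, W 2^(i+1)]
  -- adds at least 1/4 to the distance. Hence n lies below W 2^I as soon as I > 4C.
  set W := ⌈1 / w⌉₊ with hW
  have hW1 : 1 / w ≤ W := Nat.le_ceil _
  have hW2 : (W : ℝ) < 1 / w + 1 := Nat.ceil_lt_add_one (by positivity)
  have hWw : 1 ≤ w * W := by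
    rw [div_le_iff₀ hw0] at hW1
    linarith
  have hW0 : (0 : ℝ) < W := lt_of_lt_of_le (by positivity) hW1
  have key : ∀ i : ℕ, W * 2 ^ i ≤ n → (i : ℝ) / 4 ≤
      ∑ j ∈ Finset.Icc 1 (W * 2 ^ i), (1 - Real.cos (2 * Real.pi * (w * j))) / j := by
    have hterm : ∀ j : ℕ, 0 ≤ (1 - Real.cos (2 * Real.pi * (w * j))) / j := fun j =>
      div_nonneg (by linarith [Real.cos_le_one (2 * Real.pi * (w * j))]) (Nat.cast_nonneg j)
    intro i
    induction i with
    | zero =>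
      intro _
      simpa using Finset.sum_nonneg fun j _ => hterm j
    | succ i ih =>
      intro hi
      have e : W * 2 ^ (i + 1) = W * 2 ^ i + W * 2 ^ i := by ring
      have hsplit : ∑ j ∈ Finset.Icc 1 (W * 2 ^ (i + 1)),
          (1 - Real.cos (2 * Real.pi * (w * j))) / j =
          ∑ j ∈ Finset.Icc 1 (W * 2 ^ i), (1 - Real.cos (2 * Real.pi * (w * j))) / (j : ℝ) +
          ∑ j ∈ Finset.Ioc (W * 2 ^ i) (W * 2 ^ (i + 1)),
            (1 - Real.cos (2 * Real.pi * (w * j))) / (j : ℝ) := by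
        have := Finset.sum_Ioc_consecutive
          (fun j : ℕ => (1 - Real.cos (2 * Real.pi * (w * j))) / (j : ℝ))
          (Nat.zero_le (W * 2 ^ i)) (show W * 2 ^ i ≤ W * 2 ^ (i + 1) by omega)
        exact this.symm
      have h1 := ih (by omega)
      have h2 : (1 : ℝ) / 4 ≤ ∑ j ∈ Finset.Ioc (W * 2 ^ i) (W * 2 ^ (i + 1)),
            (1 - Real.cos (2 * Real.pi * (w * j))) / (j : ℝ) := by
        have hm : 1 ≤ w * ((W * 2 ^ i : ℕ) : ℝ) := by
          push_cast
          rw [← mul_assoc]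
          exact one_le_mul_of_one_le_of_one_le hWw (one_le_pow₀ (by norm_num))
        have h3 := half_le_sum_one_sub_cos hw0 hτ (W * 2 ^ i) hm
        rw [← e] at h3
        have hpos : (0 : ℝ) < ((W * 2 ^ (i + 1) : ℕ) : ℝ) := by
          push_cast
          positivity
        calc (1 : ℝ) / 4 = (((W * 2 ^ i : ℕ) : ℝ) / 2) / ((W * 2 ^ (i + 1) : ℕ) : ℝ) := by
              push_cast
              rw [pow_succ]
              field_simp
              norm_num
          _ ≤ (∑ j ∈ Finset.Ioc (W * 2 ^ i) (W * 2 ^ (i + 1)),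
              (1 - Real.cos (2 * Real.pi * (w * j)))) / ((W * 2 ^ (i + 1) : ℕ) : ℝ) := by
              gcongr
          _ ≤ _ := by
              rw [Finset.sum_div]
              refine Finset.sum_le_sum fun j hj => ?_
              rw [Finset.mem_Ioc] at hj
              have hj0 : (0 : ℝ) < j := by
                have : 0 < j := by omega
                exact_mod_cast this
              have hj2 : (j : ℝ) ≤ ((W * 2 ^ (i + 1) : ℕ) : ℝ) := by exact_mod_cast hj.2
              refine div_le_div_of_nonneg_left ?_ hj0 hj2
              linarith [Real.cos_le_one (2 * Real.pi * (w * j))]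
      rw [hsplit]
      push_cast
      linarith
  set I := ⌊4 * C⌋₊ + 1 with hI
  have hn : n < W * 2 ^ I := by
    by_contra! hcon
    have h1 := key I hcon
    have h2 : ∑ j ∈ Finset.Icc 1 (W * 2 ^ I), (1 - Real.cos (2 * Real.pi * (w * j))) / (j : ℝ) ≤
        logDist n (fun j => w * j) := by
      unfold logDist
      refine Finset.sum_le_sum_of_subset_of_nonneg (Finset.Icc_subset_Icc_right hcon) fun j _ _ => ?_
      exact div_nonneg (by linarith [Real.cos_le_one (2 * Real.pi * (w * j))]) (Nat.cast_nonneg j)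
    have h3 : 4 * C < I := by
      rw [hI]
      push_cast
      exact Nat.lt_floor_add_one _
    linarith
  have hn' : (n : ℝ) ≤ W * 2 ^ I := by exact_mod_cast hn.le
  have hWw2 : w * W ≤ 2 := by
    have : w * W ≤ w * (1 / w + 1) := by gcongr
    rw [mul_add, mul_one_div_cancel hw0.ne'] at this
    linarith
  calc w * n ≤ w * (W * 2 ^ I) := by gcongr
    _ = (w * W) * 2 ^ I := by ring
    _ ≤ 2 * 2 ^ I := by gcongr
    _ = _ := by rw [← pow_succ']

/-- An approximate homomorphism from `ZMod q` to `ℝ / ℤ` is close to a homomorphism. -/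
lemma exists_hom_of_approx_hom {q : ℕ} [NeZero q] (g : ZMod q → ℝ) {ε : ℝ} (hε : 4 * ε < 1)
    (h : ∀ s t, ∃ m : ℤ, |g (s + t) - g s - g t - m| ≤ ε) :
    ∃ χ : ZMod q → ℝ, (∀ s t, ∃ m : ℤ, χ (s + t) = χ s + χ t + m) ∧ ∀ s, |χ s - g s| ≤ ε := by
  choose m hm using h
  set δ : ZMod q → ZMod q → ℝ := fun s x => g (s + x) - g s - g x - m s x with hδ
  have hq : (0 : ℝ) < q := by exact_mod_cast Nat.pos_of_ne_zero (NeZero.ne q)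
  -- The defect δ satisfies the cocycle identity modulo 1. The integer by which it could fail has
  -- modulus at most 4ε < 1, so the identity is exact; averaging it over x makes δ a coboundary, and
  -- g corrected by the mean defect is additive modulo 1.
  refine ⟨fun s => g s + (∑ x, δ s x) / q, fun s t => ?_, fun s => ?_⟩
  · refine ⟨m s t, ?_⟩
    have h1 : ∀ x, δ s (t + x) + δ t x - δ (s + t) x = δ s t := by
      intro x
      have e : δ s (t + x) + δ t x - δ (s + t) x - δ s t =
          ((m (s + t) x + m s t - m s (t + x) - m t x : ℤ) : ℝ) := by
        simp only [hδ]
        push_cast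
        rw [add_assoc s t x]
        ring
      have h2 : |((m (s + t) x + m s t - m s (t + x) - m t x : ℤ) : ℝ)| < 1 := by
        rw [← e]
        have a1 := abs_le.1 (hm s (t + x))
        have a2 := abs_le.1 (hm t x)
        have a3 := abs_le.1 (hm (s + t) x)
        have a4 := abs_le.1 (hm s t)
        rw [abs_lt]
        simp only [hδ]
        constructor <;> linarith [a1.1, a1.2, a2.1, a2.2, a3.1, a3.2, a4.1, a4.2]
      have h3 : m (s + t) x + m s t - m s (t + x) - m t x = 0 := by
        rw [← Int.abs_lt_one_iff]
        exact_mod_cast h2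
      rw [h3, Int.cast_zero] at e
      linarith
    have h4 : ∑ x, δ s (t + x) = ∑ x, δ s x := Equiv.sum_comp (Equiv.addLeft t) (δ s)
    have h5 : ∑ x, δ s x + ∑ x, δ t x - ∑ x, δ (s + t) x = q * δ s t := by
      rw [← h4, ← Finset.sum_add_distrib, ← Finset.sum_sub_distrib, Finset.sum_congr rfl
        fun x _ => h1 x]
      simp [ZMod.card]
    have h6 : δ s t = g (s + t) - g s - g t - m s t := rfl
    have h7 : (∑ x, δ s x) / q + (∑ x, δ t x) / q - (∑ x, δ (s + t) x) / q = δ s t := by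
      rw [← add_div, ← sub_div, h5]
      field_simp
    linarith
  · rw [add_sub_cancel_left, abs_div, abs_of_pos hq, div_le_iff₀ hq]
    refine (Finset.abs_sum_le_sum_abs _ _).trans ?_
    calc ∑ x, |δ s x| ≤ ∑ _x : ZMod q, ε := Finset.sum_le_sum fun x _ => hm s x
      _ = _ := by simp [ZMod.card, mul_comm]

/-- Orthogonality: the nontrivial character s ↦ e(sb/q) has sum zero over the residues modulo q. -/
lemma sum_one_sub_cos_of_not_dvd {q : ℕ} (hq : 1 ≤ q) {b : ℤ} (hb : ¬ (q : ℤ) ∣ b) :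
    ∑ s ∈ Finset.range q, (1 - Real.cos (2 * Real.pi * (s * b / q))) = q := by
  have hq0 : (q : ℂ) ≠ 0 := by exact_mod_cast (by omega : q ≠ 0)
  set ζ : ℂ := Complex.exp (2 * Real.pi * (b / q) * Complex.I) with hζ
  have h1 : ζ ≠ 1 := by
    rw [hζ, Ne, Complex.exp_eq_one_iff]
    rintro ⟨k, hk⟩
    have h2 : (b : ℂ) = k * q := by
      have h3 : (b : ℂ) / q = k := by
        have : (2 * Real.pi * Complex.I : ℂ) ≠ 0 := Complex.two_pi_I_ne_zero
        apply mul_right_cancel₀ this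
        linear_combination hk
      rw [← h3]
      field_simp
    have h3 : b = k * q := by exact_mod_cast h2
    exact hb ⟨k, by rw [h3, mul_comm]⟩
  have h2 : ζ ^ q = 1 := by
    rw [hζ, ← Complex.exp_nat_mul, Complex.exp_eq_one_iff]
    refine ⟨b, ?_⟩
    field_simp
  have h3 : ∑ s ∈ Finset.range q, ζ ^ s = 0 := by
    rw [geom_sum_eq h1, h2, sub_self, zero_div]
  have h4 : ∀ s : ℕ, Real.cos (2 * Real.pi * (s * b / q)) = (ζ ^ s).re := by
    intro s
    rw [hζ, ← Complex.exp_nat_mul]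
    have : (s : ℂ) * (2 * Real.pi * (b / q) * Complex.I) =
        ((2 * Real.pi * (s * b / q) : ℝ) : ℂ) * Complex.I := by
      push_cast
      ring
    rw [this, Complex.exp_ofReal_mul_I_re]
  simp_rw [h4]
  rw [Finset.sum_sub_distrib, ← Complex.re_sum, h3]
  simp

open Classical in
/-- If every multiple of `a / q` is close to a linear sequence modulo one, then `a` is almost
everywhere congruent to a linear sequence modulo `q`. -/
lemma exists_linear_mod (C : ℝ) :
    ∃ C' : ℝ, ∃ N₀ : ℕ, ∀ n ≥ N₀, ∀ q : ℕ, 1 ≤ q → ∀ a : ℕ → ℤ,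
      (∀ s : ℕ, ∃ τ : ℝ, logDist n (fun j => s * a j / q - τ * j) ≤ C) →
      ∃ k : ℤ, ∑ j ∈ Finset.Icc 1 n with ¬ (q : ℤ) ∣ a j - k * j, 1 / (j : ℝ) ≤ C' := by
  -- The defect of the slopes g is a sum of three sequences at distance C, so two quasi-triangle
  -- inequalities give 2(2C+2C)+2C = 10C. The threshold n > 5K makes 4K/n < 1. None of the constants
  -- depends on q, which may therefore be chosen after n.
  set K : ℝ := 2 ^ (⌊4 * (10 * C)⌋₊ + 2) with hK
  refine ⟨2 * C + 2 * (2 * Real.pi ^ 2 * K ^ 2), ⌈5 * K⌉₊ + 1, fun n hn q hq a h => ?_⟩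
  have : NeZero q := ⟨by omega⟩
  have hq0 : (0 : ℝ) < q := by exact_mod_cast hq
  have hn0 : (0 : ℝ) < n := by
    have : 0 < n := by omega
    exact_mod_cast this
  have hnK : 5 * K ≤ n := (Nat.le_ceil _).trans (by exact_mod_cast (by omega : ⌈5 * K⌉₊ ≤ n))
  have hK0 : 0 < K := by positivity
  choose g hg using h
  have happrox : ∀ s t : ZMod q, ∃ m : ℤ,
      |g (s + t).val - g s.val - g t.val - m| ≤ K / n := by
    intro s t
    set τ := g (s + t).val - g s.val - g t.val with hτ
    have h1 : logDist n (fun j => (τ - round τ) * j) ≤ 10 * C := by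
      have e : logDist n (fun j => (τ - round τ) * j) =
          logDist n (fun j => (((s.val : ℕ) * a j / q - g s.val * j) +
            ((t.val : ℕ) * a j / q - g t.val * j)) +
            -(((s + t).val : ℕ) * a j / q - g (s + t).val * j)) := by
        refine logDist_congr n fun j => ?_
        set d : ℕ := (s.val + t.val) / q with hd
        refine ⟨-round τ * j - d * a j, ?_⟩
        have hv : ((s + t).val : ℝ) = s.val + t.val - q * d := by
          rw [ZMod.val_add]
          have := Nat.div_add_mod (s.val + t.val) q
          rw [← hd] at this
          have h' : (((q * d + (s.val + t.val) % q : ℕ)) : ℝ) =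
              ((s.val + t.val : ℕ) : ℝ) := by rw [this]
          push_cast at h' ⊢
          linarith
        rw [hv, hτ]
        push_cast
        field_simp
        ring
      rw [e]
      have h2 := logDist_add_le n (fun j => ((s.val : ℕ) * a j / q - g s.val * j) +
            ((t.val : ℕ) * a j / q - g t.val * j))
            (fun j => -(((s + t).val : ℕ) * a j / q - g (s + t).val * j))
      have h3 := logDist_add_le n (fun j => (s.val : ℕ) * a j / q - g s.val * j)
        (fun j => (t.val : ℕ) * a j / q - g t.val * j)
      have h4 := logDist_neg n (fun j => ((s + t).val : ℕ) * a j / q - g (s + t).val * j)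
      have := hg s.val
      have := hg t.val
      have := hg (s + t).val
      linarith
    refine ⟨round τ, ?_⟩
    rw [le_div_iff₀ hn0]
    exact abs_mul_le_of_logDist_linear_le (abs_sub_round τ) h1
  obtain ⟨χ, hχ, hχg⟩ := exists_hom_of_approx_hom (fun s : ZMod q => g s.val)
    (ε := K / n) (by
      rw [← mul_div_assoc, div_lt_one hn0]
      linarith) happrox
  have hχ0 : ∃ m : ℤ, χ 0 = m := by
    obtain ⟨m, hm⟩ := hχ 0 0
    rw [add_zero] at hm
    exact ⟨-m, by push_cast; linarith⟩
  have hχs : ∀ s : ℕ, ∃ m : ℤ, χ s = s * χ 1 + m := by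
    intro s
    induction s with
    | zero =>
      obtain ⟨m, hm⟩ := hχ0
      exact ⟨m, by simpa using hm⟩
    | succ s ih =>
      obtain ⟨m, hm⟩ := ih
      obtain ⟨m', hm'⟩ := hχ s 1
      refine ⟨m + m', ?_⟩
      push_cast
      rw [hm', hm]
      ring
  obtain ⟨k, hk⟩ : ∃ k : ℤ, q * χ 1 = k := by
    obtain ⟨m, hm⟩ := hχs q
    obtain ⟨m', hm'⟩ := hχ0
    rw [ZMod.natCast_self, hm'] at hm
    exact ⟨m' - m, by push_cast; linarith⟩
  have hk' : χ 1 = k / q := by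
    rw [← hk]
    field_simp
  refine ⟨k, ?_⟩
  have hbound : ∀ s ∈ Finset.range q, logDist n (fun j => s * ((a j - k * j : ℤ) : ℝ) / q) ≤
      2 * C + 2 * (2 * Real.pi ^ 2 * K ^ 2) := by
    intro s hs
    have hsv : (s : ZMod q).val = s := ZMod.val_cast_of_lt (Finset.mem_range.1 hs)
    obtain ⟨m, hm⟩ := hχs s
    have e : logDist n (fun j => s * ((a j - k * j : ℤ) : ℝ) / q) =
        logDist n (fun j => (s * a j / q - g s * j) + (g s - χ s) * j) := by
      refine logDist_congr n fun j => ⟨m * j, ?_⟩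
      rw [hm, hk']
      push_cast
      ring
    rw [e]
    refine (logDist_add_le n _ _).trans ?_
    have h1 := hg s
    have h2 : logDist n (fun j => (g s - χ s) * j) ≤ 2 * Real.pi ^ 2 * K ^ 2 := by
      refine logDist_linear_le n ?_
      have := hχg s
      rw [hsv, abs_sub_comm, le_div_iff₀ hn0] at this
      exact this
    linarith
  -- By orthogonality the average over s of the distances detects exactly the j with q ∤ a_j - kj.
  have hsum : ∑ s ∈ Finset.range q, logDist n (fun j => s * ((a j - k * j : ℤ) : ℝ) / q) =
      q * ∑ j ∈ Finset.Icc 1 n with ¬ (q : ℤ) ∣ a j - k * j, 1 / (j : ℝ) := by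
    unfold logDist
    rw [Finset.sum_comm, Finset.sum_filter, Finset.mul_sum]
    refine Finset.sum_congr rfl fun j _ => ?_
    rw [← Finset.sum_div]
    by_cases hd : (q : ℤ) ∣ a j - k * j
    · rw [if_neg (not_not.2 hd)]
      obtain ⟨b, hb⟩ := hd
      rw [mul_zero, div_eq_zero_iff]
      left
      refine Finset.sum_eq_zero fun s _ => ?_
      have : 2 * Real.pi * (s * ((a j - k * j : ℤ) : ℝ) / q) =
          ((s * b : ℤ) : ℝ) * (2 * Real.pi) := by
        rw [hb]
        push_cast
        field_simp
      rw [this, Real.cos_int_mul_two_pi, sub_self]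
    · rw [if_pos hd, sum_one_sub_cos_of_not_dvd hq hd]
      ring
  have hle := Finset.sum_le_sum hbound
  rw [hsum, Finset.sum_const, Finset.card_range, nsmul_eq_mul] at hle
  exact le_of_mul_le_mul_left hle hq0

/-! ### Ewens means and weak convergence to the Poisson law. -/

/-- The mean of `G` under the Ewens distribution on the partitions of `n`. -/
def mean (θ : ℝ) (n : ℕ) (G : Multiset ℕ → ℝ) : ℝ := partitionSum θ n G / binomCoeff θ n

open Classical in
/-- The probability of `P` under the Ewens distribution on the partitions of `n`. -/
def prob (θ : ℝ) (n : ℕ) (P : Multiset ℕ → Prop) : ℝ := mean θ n fun s => if P s then 1 else 0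

/-- The value of the additive function with coefficients `a` on a multiset of cycle lengths. -/
def addVal (a : ℕ → ℤ) (s : Multiset ℕ) : ℤ := (s.map a).sum

/-- The probability `P(Y = k)` of a Poisson variable. -/
def poissonMass (μ : NNReal) (k : ℕ) : ℝ := Real.exp (-μ) * μ ^ k / k.factorial

section Mean

variable {θ : ℝ} (hθ : 1 ≤ θ) {n : ℕ}
include hθ

lemma mean_mono {G H : Multiset ℕ → ℝ} (h : ∀ p : n.Partition, G p.parts ≤ H p.parts) :
    mean θ n G ≤ mean θ n H :=
  div_le_div_of_nonneg_right (partitionSum_mono (by linarith) n h) (binomCoeff_pos hθ n).le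

lemma mean_nonneg {G : Multiset ℕ → ℝ} (h : ∀ s, 0 ≤ G s) : 0 ≤ mean θ n G :=
  div_nonneg (partitionSum_nonneg (by linarith) n h) (binomCoeff_pos hθ n).le

lemma mean_const (c : ℝ) : mean θ n (fun _ => c) = c := by
  have h := partitionSum_smul θ n c fun _ => (1 : ℝ)
  simp only [smul_eq_mul, mul_one] at h
  rw [mean, h, partitionSum_one, mul_div_cancel_right₀ _ (binomCoeff_pos hθ n).ne']

lemma prob_nonneg (P : Multiset ℕ → Prop) : 0 ≤ prob θ n P :=
  mean_nonneg hθ fun s => by split_ifs <;> norm_num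

lemma prob_mono {P Q : Multiset ℕ → Prop} (h : ∀ p : n.Partition, P p.parts → Q p.parts) :
    prob θ n P ≤ prob θ n Q :=
  mean_mono hθ fun p => by
    by_cases h1 : P p.parts
    · rw [if_pos h1, if_pos (h p h1)]
    · rw [if_neg h1]
      split_ifs <;> norm_num

omit hθ in
lemma mean_add (G H : Multiset ℕ → ℝ) :
    mean θ n (fun s => G s + H s) = mean θ n G + mean θ n H := by
  rw [mean, partitionSum_add, add_div, mean, mean]

omit hθ in
lemma mean_mul_left (c : ℝ) (G : Multiset ℕ → ℝ) :
    mean θ n (fun s => c * G s) = c * mean θ n G := by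
  rw [mean, mean, mul_div_assoc']
  congr 1
  exact partitionSum_smul θ n c G

omit hθ in
lemma mean_sub (G H : Multiset ℕ → ℝ) :
    mean θ n (fun s => G s - H s) = mean θ n G - mean θ n H := by
  have h := mean_add (θ := θ) (n := n) G fun s => (-1) * H s
  rw [mean_mul_left] at h
  rw [sub_eq_add_neg, ← neg_one_mul, ← h]
  congr 1
  funext s
  ring

omit hθ in
lemma mean_sum {ι : Type*} (t : Finset ι) (G : ι → Multiset ℕ → ℝ) :
    mean θ n (fun s => ∑ i ∈ t, G i s) = ∑ i ∈ t, mean θ n (G i) := by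
  unfold mean
  rw [partitionSum_sum, Finset.sum_div]

omit hθ in
lemma mean_congr {G H : Multiset ℕ → ℝ} (h : ∀ p : n.Partition, G p.parts = H p.parts) :
    mean θ n G = mean θ n H := by
  rw [mean, partitionSum_congr θ n h, mean]

lemma abs_mean_le (G : Multiset ℕ → ℝ) : |mean θ n G| ≤ mean θ n fun s => |G s| := by
  rw [abs_le]
  constructor
  · rw [← neg_one_mul, ← mean_mul_left]
    exact mean_mono hθ fun p => by linarith [neg_abs_le (G p.parts)]
  · exact mean_mono hθ fun p => le_abs_self _

lemma prob_or_le (P Q : Multiset ℕ → Prop) :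
    prob θ n (fun s => P s ∨ Q s) ≤ prob θ n P + prob θ n Q := by
  unfold prob
  rw [← mean_add]
  refine mean_mono hθ fun p => ?_
  by_cases h1 : P p.parts <;> by_cases h2 : Q p.parts <;> simp [h1, h2]

end Mean

lemma additiveFun_eq {n : ℕ} (a : ℕ → ℤ) (σ : Equiv.Perm (Fin n)) :
    additiveFun a σ = addVal a σ.partition.parts := by
  unfold additiveFun addVal cycleCount
  rw [Finset.sum_multiset_map_count]
  have hsub : σ.partition.parts.toFinset ⊆ Finset.Icc 1 n := by
    intro j hj
    have hj' : j ∈ (cyclePartition σ).parts := Multiset.mem_toFinset.1 hj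
    exact Finset.mem_Icc.2 ⟨(cyclePartition σ).parts_pos hj', le_of_mem_parts _ hj'⟩
  rw [← Finset.sum_subset hsub]
  · refine Finset.sum_congr rfl fun j _ => ?_
    rw [nsmul_eq_mul, mul_comm]
  · intro j _ hj
    rw [Multiset.mem_toFinset] at hj
    rw [Multiset.count_eq_zero.2 hj]
    simp

lemma T_eq_prob {θ : ℝ} (a : ℕ → ℕ → ℤ) (n : ℕ) (x : ℝ) :
    T θ a n x = prob θ n fun s => (addVal (a n) s : ℝ) < x := by
  classical
  have h := sum_perm_eq_partitionSum θ n
    (fun s => if (addVal (a n) s : ℝ) < x then (1 : ℝ) else 0)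
  unfold T ewens prob mean
  rw [Finset.sum_filter, risingFactorial_eq]
  have hf : (n.factorial : ℝ) ≠ 0 := by positivity
  have e : ∑ σ : Equiv.Perm (Fin n), (if σ ∈ {σ | (additiveFun (a n) σ : ℝ) < x} then
      θ ^ numCycles σ else 0) = ∑ σ : Equiv.Perm (Fin n),
      θ ^ numCycles σ • (if (addVal (a n) σ.partition.parts : ℝ) < x then (1 : ℝ) else 0) := by
    refine Finset.sum_congr rfl fun σ _ => ?_
    simp only [Set.mem_ofPred_eq, additiveFun_eq, smul_eq_mul, mul_ite, mul_one, mul_zero]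
  rw [e, h, smul_eq_mul, one_div, mul_inv]
  rw [show (n.factorial : ℝ)⁻¹ * (binomCoeff θ n)⁻¹ * (n.factorial * partitionSum θ n fun s =>
    if (addVal (a n) s : ℝ) < x then (1 : ℝ) else 0) = ((n.factorial : ℝ)⁻¹ * n.factorial) *
    ((partitionSum θ n fun s => if (addVal (a n) s : ℝ) < x then (1 : ℝ) else 0) *
    (binomCoeff θ n)⁻¹) by ring, inv_mul_cancel₀ hf, one_mul, div_eq_mul_inv]

lemma prob_lt_eq {θ : ℝ} (a : ℕ → ℤ) (n : ℕ) (x : ℝ) (hx : -1 < x) :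
    prob θ n (fun s => (addVal a s : ℝ) < x) =
      prob θ n (fun s => addVal a s < 0) +
        ∑ k ∈ Finset.range ⌈x⌉₊, prob θ n fun s => addVal a s = k := by
  unfold prob
  rw [← mean_sum, ← mean_add]
  refine mean_congr fun p => ?_
  beta_reduce
  generalize addVal a p.parts = h
  rcases lt_or_ge h 0 with h0 | h0
  · have h1 : (h : ℝ) < x := by
      have : (h : ℝ) ≤ -1 := by exact_mod_cast (by omega : h ≤ -1)
      linarith
    rw [if_pos h1, if_pos h0, Finset.sum_eq_zero, add_zero]
    intro k _
    rw [if_neg (by omega)]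
  · lift h to ℕ using h0 with m
    rw [if_neg (by omega : ¬ ((m : ℤ) < 0)), zero_add]
    simp only [Nat.cast_inj, Int.cast_natCast]
    rw [Finset.sum_ite_eq]
    simp only [Finset.mem_range, Nat.lt_ceil]

lemma hasSum_poissonMass (μ : NNReal) : HasSum (poissonMass μ) 1 :=
  ProbabilityTheory.hasSum_one_poissonMeasure μ

lemma poissonMass_nonneg (μ : NNReal) (k : ℕ) : 0 ≤ poissonMass μ k := by
  unfold poissonMass
  positivity

lemma poissonDF_eq (μ : NNReal) (x : ℝ) :
    poissonDF μ x = ∑ k ∈ Finset.range ⌈x⌉₊, poissonMass μ k := by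
  unfold poissonDF
  have : {k : ℕ | (k : ℝ) < x} = ((Finset.range ⌈x⌉₊ : Finset ℕ) : Set ℕ) := by
    ext k
    simp [Nat.lt_ceil]
  rw [this, ← MeasureTheory.sum_measureReal_singleton]
  refine Finset.sum_congr rfl fun k _ => ?_
  rw [ProbabilityTheory.poissonMeasure_real_singleton]
  rfl

/-- Convergence in law to the Poisson distribution, for the point probabilities. -/
def PoissonLimit (θ : ℝ) (a : ℕ → ℕ → ℤ) (μ : NNReal) : Prop :=
  Tendsto (fun n => prob θ n fun s => addVal (a n) s < 0) atTop (𝓝 0) ∧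
    ∀ k : ℕ, Tendsto (fun n => prob θ n fun s => addVal (a n) s = k) atTop (𝓝 (poissonMass μ k))

/-- The Poisson distribution function is constant near k - 1/2, so convergence there yields the
point masses by differences, and k = 0 yields the mass of the negative values. Conversely, for x >
-1, T_n(x) is that mass plus finitely many point masses; for x ≤ -1 it is at most that mass. -/
lemma weaklyConverges_iff {θ : ℝ} (hθ : 1 ≤ θ) (a : ℕ → ℕ → ℤ) (μ : NNReal) :
    WeaklyConverges (T θ a) (poissonDF μ) ↔ PoissonLimit θ a μ := by
  constructor
  · intro h
    have hhalf : ∀ k : ℕ, ⌈(k : ℝ) - 1 / 2⌉₊ = k := by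
      intro k
      rcases k with _ | k
      · simp
      · rw [Nat.ceil_eq_iff (by omega)]
        push_cast
        constructor <;> linarith
    have h1 : ∀ k : ℕ, Tendsto (fun n => prob θ n (fun s => addVal (a n) s < 0) +
        ∑ i ∈ Finset.range k, prob θ n fun s => addVal (a n) s = i) atTop
        (𝓝 (∑ i ∈ Finset.range k, poissonMass μ i)) := by
      intro k
      have hc : ContinuousAt (poissonDF μ) ((k : ℝ) - 1 / 2) := by
        have : poissonDF μ =ᶠ[𝓝 ((k : ℝ) - 1 / 2)]
            fun _ => ∑ i ∈ Finset.range k, poissonMass μ i := by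
          filter_upwards [Ioo_mem_nhds (show (k : ℝ) - 1 < k - 1 / 2 by linarith)
            (show (k : ℝ) - 1 / 2 < k by linarith)] with x hx
          rw [poissonDF_eq]
          congr 2
          rcases k with _ | k
          · rw [Nat.ceil_eq_zero]
            have := hx.2
            push_cast at this
            exact this.le
          · rw [Nat.ceil_eq_iff (by omega)]
            have := hx.1
            have := hx.2
            push_cast at *
            constructor <;> linarith
        exact continuousAt_const.congr this.symm
      have h2 := h _ hc
      rw [poissonDF_eq, hhalf] at h2
      refine h2.congr fun n => ?_
      have hk : (0 : ℝ) ≤ k := Nat.cast_nonneg k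
      rw [T_eq_prob, prob_lt_eq _ _ _ (by linarith), hhalf]
    have h0 := h1 0
    simp only [Finset.range_zero, Finset.sum_empty, add_zero] at h0
    refine ⟨h0, fun k => ?_⟩
    have h2 := (h1 (k + 1)).sub (h1 k)
    simp only [Finset.sum_range_succ, add_sub_cancel_left] at h2
    refine h2.congr fun n => ?_
    ring
  · rintro ⟨h0, h1⟩ x _
    rw [poissonDF_eq]
    rcases lt_or_ge (-1) x with hx | hx
    · have h2 := h0.add (tendsto_finsetSum (Finset.range ⌈x⌉₊) fun k _ => h1 k)
      rw [zero_add] at h2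
      refine h2.congr fun n => ?_
      rw [T_eq_prob, prob_lt_eq _ _ _ hx]
    · rw [Nat.ceil_eq_zero.2 (by linarith), Finset.range_zero, Finset.sum_empty]
      refine squeeze_zero (fun n => ?_) (fun n => ?_) h0
      · rw [T_eq_prob]
        exact prob_nonneg hθ _
      · rw [T_eq_prob]
        refine prob_mono hθ fun p hp => ?_
        have : (addVal (a n) p.parts : ℝ) < 0 := by linarith
        exact_mod_cast this

lemma prob_outside {θ : ℝ} (hθ : 1 ≤ θ) (a : ℕ → ℤ) (n K : ℕ) :
    prob θ n (fun s => ¬ (0 ≤ addVal a s ∧ addVal a s < K)) =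
      1 - ∑ k ∈ Finset.range K, prob θ n fun s => addVal a s = k := by
  rw [← mean_const hθ (n := n) 1]
  unfold prob
  rw [← mean_sum, ← mean_sub]
  refine mean_congr fun p => ?_
  beta_reduce
  generalize addVal a p.parts = h
  rcases lt_or_ge h 0 with h0 | h0
  · rw [if_pos (by omega), Finset.sum_eq_zero, sub_zero]
    intro k _
    rw [if_neg (by omega)]
  · lift h to ℕ using h0 with m
    simp only [Nat.cast_inj]
    rw [Finset.sum_ite_eq]
    by_cases hmK : m < K
    · simp [hmK]
    · simp [hmK]

/-- Tightness and uniform approximation of the point probabilities. -/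
lemma PoissonLimit.uniform {θ : ℝ} (hθ : 1 ≤ θ) {a : ℕ → ℕ → ℤ} {μ : NNReal}
    (h : PoissonLimit θ a μ) {ε : ℝ} (hε : 0 < ε) :
    ∃ K₀ : ℕ, ∀ K ≥ K₀, 1 - ∑ k ∈ Finset.range K, poissonMass μ k ≤ ε ∧ ∀ᶠ n in atTop,
      prob θ n (fun s => ¬ (0 ≤ addVal (a n) s ∧ addVal (a n) s < K)) ≤ ε ∧
      ∑ k ∈ Finset.range K, |prob θ n (fun s => addVal (a n) s = k) - poissonMass μ k| ≤ ε := by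
  have h1 := (hasSum_poissonMass μ).tendsto_sum_nat
  obtain ⟨K₀, hK₀⟩ := eventually_atTop.1 (h1.eventually
    (lt_mem_nhds (show (1 : ℝ) - ε < 1 by linarith)))
  refine ⟨K₀, fun K hK => ?_⟩
  have hK' := hK₀ K hK
  refine ⟨by linarith, ?_⟩
  have h2 : Tendsto (fun n => ∑ k ∈ Finset.range K, prob θ n fun s => addVal (a n) s = k) atTop
      (𝓝 (∑ k ∈ Finset.range K, poissonMass μ k)) := tendsto_finsetSum _ fun k _ => h.2 k
  have h3 : Tendsto (fun n => ∑ k ∈ Finset.range K,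
      |prob θ n (fun s => addVal (a n) s = k) - poissonMass μ k|) atTop (𝓝 0) := by
    have := tendsto_finsetSum (Finset.range K) fun k _ =>
      ((h.2 k).sub_const (poissonMass μ k)).abs
    simpa using this
  filter_upwards [h2.eventually (lt_mem_nhds hK'), h3.eventually (gt_mem_nhds hε)] with n hn hn'
  refine ⟨?_, hn'.le⟩
  rw [prob_outside hθ]
  linarith

/-! ### Characteristic functions. -/

/-- The exponential `exp (2 π i t x)`. -/
def expPhase (t : ℝ) (x : ℤ) : ℂ := Complex.exp ((2 * Real.pi * (t * x) : ℝ) * Complex.I)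

lemma norm_expPhase (t : ℝ) (x : ℤ) : ‖expPhase t x‖ = 1 := Complex.norm_exp_ofReal_mul_I _

lemma prod_expPhase (t : ℝ) (a : ℕ → ℤ) (s : Multiset ℕ) :
    (s.map fun j => expPhase t (a j)).prod = expPhase t (addVal a s) := by
  induction s using Multiset.induction_on with
  | empty => simp [addVal, expPhase]
  | cons j s ih =>
    have e : addVal a (j ::ₘ s) = a j + addVal a s := by simp [addVal]
    rw [Multiset.map_cons, Multiset.prod_cons, ih, e]
    unfold expPhase
    rw [← Complex.exp_add]
    congr 1
    push_cast
    ring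

lemma hasSum_poissonMass_expPhase (μ : NNReal) (t : ℝ) :
    HasSum (fun k : ℕ => (poissonMass μ k : ℂ) * expPhase t k)
      (Complex.exp (μ * (expPhase t 1 - 1))) := by
  have h := NormedSpace.expSeries_div_hasSum_exp ((μ : ℂ) * expPhase t 1)
  rw [← Complex.exp_eq_exp_ℂ] at h
  have h2 := h.mul_left (Complex.exp (-(μ : ℂ)))
  have e : Complex.exp (-(μ : ℂ)) * Complex.exp (μ * expPhase t 1) =
      Complex.exp (μ * (expPhase t 1 - 1)) := by
    rw [← Complex.exp_add]
    congr 1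
    ring
  rw [e] at h2
  refine h2.congr_fun fun k => ?_
  have : expPhase t k = expPhase t 1 ^ k := by
    unfold expPhase
    rw [← Complex.exp_nat_mul]
    congr 1
    push_cast
    ring
  rw [this, poissonMass, mul_pow]
  push_cast
  ring

/-- The Poisson characteristic function exp(μ(e(t)-1)) has modulus at least e^(-2μ) for every t; the
omitted tail costs ε. -/
lemma exp_neg_le_norm_sum (μ : NNReal) (t : ℝ) {K : ℕ} {ε : ℝ}
    (hK : 1 - ∑ k ∈ Finset.range K, poissonMass μ k ≤ ε) :
    Real.exp (-(2 * μ)) - ε ≤ ‖∑ k ∈ Finset.range K, (poissonMass μ k : ℂ) * expPhase t k‖ := by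
  have h1 := (hasSum_poissonMass_expPhase μ t).tendsto_sum_nat
  have h2 : ‖Complex.exp (μ * (expPhase t 1 - 1)) -
      ∑ k ∈ Finset.range K, (poissonMass μ k : ℂ) * expPhase t k‖ ≤ ε := by
    refine le_of_tendsto (h1.sub_const _).norm ?_
    filter_upwards [eventually_ge_atTop K] with M hM
    rw [← Finset.sum_Ico_eq_sub _ hM]
    refine (norm_sum_le _ _).trans ?_
    have h3 : ∑ k ∈ Finset.Ico K M, ‖(poissonMass μ k : ℂ) * expPhase t k‖ =
        ∑ k ∈ Finset.Ico K M, poissonMass μ k := by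
      refine Finset.sum_congr rfl fun k _ => ?_
      rw [norm_mul, norm_expPhase, mul_one, Complex.norm_real,
        Real.norm_of_nonneg (poissonMass_nonneg μ k)]
    have h4 := sum_le_hasSum (Finset.range M) (fun k _ => poissonMass_nonneg μ k)
      (hasSum_poissonMass μ)
    rw [h3, Finset.sum_Ico_eq_sub _ hM]
    linarith
  have h5 : Real.exp (-(2 * μ)) ≤ ‖Complex.exp (μ * (expPhase t 1 - 1))‖ := by
    rw [Complex.norm_exp, Real.exp_le_exp]
    have h6 := Complex.abs_re_le_norm (expPhase t 1)
    rw [norm_expPhase, abs_le] at h6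
    have e : ((μ : ℂ) * (expPhase t 1 - 1)).re = μ * ((expPhase t 1).re - 1) := by
      simp
    rw [e]
    have := NNReal.coe_nonneg μ
    nlinarith [h6.1]
  have h7 := norm_sub_norm_le (Complex.exp (μ * (expPhase t 1 - 1)))
    (∑ k ∈ Finset.range K, (poissonMass μ k : ℂ) * expPhase t k)
  linarith

-- `multSum` of the phases is p_n times the characteristic function of h at t. The three losses ε
-- come from the Poisson tail, the values of h outside [0, K) and the point masses. The hypotheses
-- do not mention t, so the bound is uniform in t.
open Classical in
lemma norm_multSum_expPhase_ge {θ : ℝ} (hθ : 1 ≤ θ) (a : ℕ → ℤ) (μ : NNReal) (n K : ℕ) (t ε : ℝ)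
    (hK : 1 - ∑ k ∈ Finset.range K, poissonMass μ k ≤ ε)
    (hout : prob θ n (fun s => ¬ (0 ≤ addVal a s ∧ addVal a s < K)) ≤ ε)
    (hin : ∑ k ∈ Finset.range K, |prob θ n (fun s => addVal a s = k) - poissonMass μ k| ≤ ε) :
    (Real.exp (-(2 * μ)) - 3 * ε) * binomCoeff θ n ≤
      ‖multSum θ (fun j => expPhase t (a j)) n‖ := by
  have hp := binomCoeff_pos hθ n
  have hθ0 : 0 ≤ θ := by linarith
  set R : Multiset ℕ → ℂ := fun s =>
    if ¬ (0 ≤ addVal a s ∧ addVal a s < K) then expPhase t (addVal a s) else 0 with hR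
  have h1 : multSum θ (fun j => expPhase t (a j)) n =
      ∑ k ∈ Finset.range K, ((binomCoeff θ n * prob θ n (fun s => addVal a s = k) : ℝ) : ℂ) *
        expPhase t k + partitionSum θ n R := by
    have h2 : ∀ k : ℕ, ((binomCoeff θ n * prob θ n (fun s => addVal a s = k) : ℝ) : ℂ) *
        expPhase t k = partitionSum θ n fun s =>
          if addVal a s = k then expPhase t k else 0 := by
      intro k
      unfold prob mean
      rw [mul_div_cancel₀ _ hp.ne']
      unfold partitionSum
      push_cast
      rw [Finset.sum_mul]
      refine Finset.sum_congr rfl fun p _ => ?_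
      split_ifs <;> simp
    simp_rw [h2]
    rw [← partitionSum_sum, ← partitionSum_add]
    refine partitionSum_congr θ n fun p => ?_
    simp only [prod_expPhase, hR]
    generalize addVal a p.parts = h
    rcases lt_or_ge h 0 with h0 | h0
    · rw [if_pos (by omega), Finset.sum_eq_zero, zero_add]
      intro k _
      rw [if_neg (by omega)]
    · lift h to ℕ using h0
      simp only [Nat.cast_inj]
      rw [Finset.sum_ite_eq]
      by_cases hmK : h < K
      · simp [hmK]
      · simp [hmK]
  have h3 : ‖partitionSum θ n R‖ ≤ binomCoeff θ n * ε := by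
    refine (norm_partitionSum_le hθ0 n R).trans ?_
    have : binomCoeff θ n * prob θ n (fun s => ¬ (0 ≤ addVal a s ∧ addVal a s < K)) =
        partitionSum θ n fun s => ‖R s‖ := by
      unfold prob mean
      rw [mul_div_cancel₀ _ hp.ne']
      refine partitionSum_congr θ n fun p => ?_
      simp only [hR]
      split_ifs <;> simp [norm_expPhase]
    rw [← this]
    gcongr
  have h4 : ‖∑ k ∈ Finset.range K, ((binomCoeff θ n * prob θ n (fun s => addVal a s = k) : ℝ) : ℂ) *
        expPhase t k -
      (binomCoeff θ n : ℂ) * ∑ k ∈ Finset.range K, (poissonMass μ k : ℂ) * expPhase t k‖ ≤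
        binomCoeff θ n * ε := by
    rw [Finset.mul_sum, ← Finset.sum_sub_distrib]
    refine (norm_sum_le _ _).trans ?_
    refine le_trans (le_of_eq ?_) (mul_le_mul_of_nonneg_left hin hp.le)
    rw [Finset.mul_sum]
    refine Finset.sum_congr rfl fun k _ => ?_
    have e : ((binomCoeff θ n * prob θ n (fun s => addVal a s = k) : ℝ) : ℂ) * expPhase t k -
        (binomCoeff θ n : ℂ) * ((poissonMass μ k : ℂ) * expPhase t k) =
        ((binomCoeff θ n * (prob θ n (fun s => addVal a s = k) - poissonMass μ k) : ℝ) : ℂ) *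
          expPhase t k := by
      push_cast
      ring
    rw [e, norm_mul, norm_expPhase, mul_one, Complex.norm_real, norm_mul,
      Real.norm_of_nonneg hp.le, Real.norm_eq_abs]
  have h5 := exp_neg_le_norm_sum μ t hK
  set A := ∑ k ∈ Finset.range K, ((binomCoeff θ n * prob θ n (fun s => addVal a s = k) : ℝ) : ℂ) *
        expPhase t k
  set B := ∑ k ∈ Finset.range K, (poissonMass μ k : ℂ) * expPhase t k
  have h6 : binomCoeff θ n * ‖B‖ = ‖(binomCoeff θ n : ℂ) * B‖ := by
    rw [norm_mul, Complex.norm_real, Real.norm_of_nonneg hp.le]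
  have h7 : ‖(binomCoeff θ n : ℂ) * B‖ ≤ ‖A + partitionSum θ n R‖ +
      ‖A - (binomCoeff θ n : ℂ) * B‖ + ‖partitionSum θ n R‖ := by
    have e : (binomCoeff θ n : ℂ) * B = (A + partitionSum θ n R) -
      (A - (binomCoeff θ n : ℂ) * B) - partitionSum θ n R := by ring
    conv_lhs => rw [e]
    exact (norm_sub_le _ _).trans (add_le_add_left (norm_sub_le _ _) _)
  rw [h1]
  have h8 := mul_le_mul_of_nonneg_left h5 hp.le
  linarith

lemma exists_logDist_le {n : ℕ} {C t : ℝ} {a : ℕ → ℤ} {z : ℂ} (hz : ‖z‖ = 1)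
    (h : ∑ j ∈ Finset.Icc 1 n, (1 - (expPhase t (a j) * z ^ j).re) / j ≤ C) :
    ∃ τ : ℝ, logDist n (fun j => t * a j - τ * j) ≤ C := by
  refine ⟨-(z.arg / (2 * Real.pi)), le_trans (le_of_eq ?_) h⟩
  unfold logDist
  refine Finset.sum_congr rfl fun j _ => ?_
  have hz' : z = Complex.exp (z.arg * Complex.I) := by
    have := Complex.norm_mul_exp_arg_mul_I z
    rw [hz, Complex.ofReal_one, one_mul] at this
    exact this.symm
  have e : expPhase t (a j) * z ^ j =
      Complex.exp ((2 * Real.pi * (t * a j - -(z.arg / (2 * Real.pi)) * j) : ℝ) * Complex.I) := by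
    conv_lhs => rw [hz']
    unfold expPhase
    rw [← Complex.exp_nat_mul, ← Complex.exp_add]
    congr 1
    have hpi : (Real.pi : ℂ) ≠ 0 := by exact_mod_cast Real.pi_ne_zero
    push_cast
    field_simp
    ring
  rw [e, Complex.exp_ofReal_mul_I_re]

/-! ### The nonzero coefficients have bounded logarithmic mass. -/

lemma multSum_indicator (θ : ℝ) (n : ℕ) (P : ℕ → Prop) [DecidablePred P] :
    multSum θ (fun j => if P j then (1 : ℝ) else 0) n =
      partitionSum θ n fun s => if ∀ j ∈ s, P j then (1 : ℝ) else 0 := by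
  refine partitionSum_congr θ n fun p => ?_
  induction p.parts using Multiset.induction_on with
  | empty => simp
  | cons j s ih =>
    rw [Multiset.map_cons, Multiset.prod_cons, ih]
    by_cases h1 : P j <;> by_cases h2 : ∀ i ∈ s, P i <;> simp [h1, h2]

lemma log_le_harmonicSum (n : ℕ) : Real.log (n + 1) ≤ harmonicSum n := by
  have h := log_add_one_le_harmonic n
  have e : harmonicSum n = (harmonic n : ℝ) := by
    rw [harmonic_eq_sum_Icc, harmonicSum]
    push_cast
    simp
  rw [e]
  exact_mod_cast h

lemma tendsto_harmonicSum : Tendsto harmonicSum atTop atTop := by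
  refine tendsto_atTop_mono log_le_harmonicSum (Real.tendsto_log_atTop.comp ?_)
  exact tendsto_atTop_add_const_right _ _ tendsto_natCast_atTop_atTop

lemma dvd_addVal_sub {q : ℤ} {a : ℕ → ℤ} {k : ℤ} {s : Multiset ℕ}
    (h : ∀ j ∈ s, q ∣ a j - k * j) : q ∣ addVal a s - k * s.sum := by
  induction s using Multiset.induction_on with
  | empty => simp [addVal]
  | cons j s ih =>
    have h1 := h j (Multiset.mem_cons_self j s)
    have h2 := ih fun i hi => h i (Multiset.mem_cons_of_mem hi)
    have e : addVal a (j ::ₘ s) - k * ((j ::ₘ s).sum : ℕ) =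
        (a j - k * j) + (addVal a s - k * (s.sum : ℕ)) := by
      simp only [addVal, Multiset.map_cons, Multiset.sum_cons]
      push_cast
      ring
    rw [e]
    exact dvd_add h1 h2

/-- If `h ≡ k n` modulo a large `q` with `h` bounded, and `a ≡ k j` for most `j`, then `a` vanishes
for most `j`. -/
lemma eq_zero_of_dvd {n K : ℕ} {a : ℕ → ℤ} {k b : ℤ} {q : ℕ} (hn : 1 ≤ n)
    (hq : n * ∑ j ∈ Finset.Icc 1 n, (a j).natAbs + n * K < q) (hb0 : 0 ≤ b) (hbK : b < K)
    (hb : (q : ℤ) ∣ b - k * n) {j : ℕ} (hj : j ∈ Finset.Icc 1 n) (hd : (q : ℤ) ∣ a j - k * j) :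
    (n : ℤ) * a j = j * b := by
  have h1 : (q : ℤ) ∣ n * a j - j * b := by
    -- The unknown slope k cancels in this combination.
    have : n * a j - j * b = n * (a j - k * j) - j * (b - k * n) := by ring
    rw [this]
    exact dvd_sub (Dvd.dvd.mul_left hd _) (Dvd.dvd.mul_left hb _)
  have h2 : |n * a j - j * b| < q := by
    have h3 : (a j).natAbs ≤ ∑ j ∈ Finset.Icc 1 n, (a j).natAbs :=
      Finset.single_le_sum (f := fun j => (a j).natAbs) (fun _ _ => Nat.zero_le _) hj
    have h4 : |(n : ℤ) * a j| ≤ n * ∑ j ∈ Finset.Icc 1 n, (a j).natAbs := by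
      rw [abs_mul, Nat.abs_cast, Int.abs_eq_natAbs]
      exact_mod_cast Nat.mul_le_mul_left n h3
    have h5 : |(j : ℤ) * b| ≤ n * K := by
      rw [abs_mul, Nat.abs_cast, abs_of_nonneg hb0]
      have : (j : ℤ) ≤ n := by exact_mod_cast (Finset.mem_Icc.1 hj).2
      exact mul_le_mul this hbK.le hb0 (by positivity)
    have h6 := abs_sub (n * a j : ℤ) (j * b)
    have hq' : ((n * ∑ j ∈ Finset.Icc 1 n, (a j).natAbs + n * K : ℕ) : ℤ) < q := by exact_mod_cast hq
    push_cast at hq' h4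
    linarith
  exact sub_eq_zero.1 (Int.eq_zero_of_abs_lt_dvd h1 h2)

open Classical in
/-- Under convergence to the Poisson law, the set of `j` with nonzero coefficients has bounded
logarithmic mass. -/
theorem PoissonLimit.sum_ne_zero_le {θ : ℝ} (hθ : 1 ≤ θ) {a : ℕ → ℕ → ℤ} {μ : NNReal}
    (h : PoissonLimit θ a μ) :
    ∃ C : ℝ, ∀ᶠ n in atTop, ∑ j ∈ Finset.Icc 1 n with a n j ≠ 0, 1 / (j : ℝ) ≤ C := by
  set c := Real.exp (-(2 * μ)) / 2 with hc
  have hc0 : 0 < c := by positivity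
  obtain ⟨C₁, N₁, h₁⟩ := exists_close_of_norm_multSum_ge hθ hc0
  obtain ⟨C₂, N₂, h₂⟩ := exists_linear_mod C₁
  obtain ⟨c₃, hc₃, N₃, h₃⟩ := exists_le_multSum hθ C₂
  obtain ⟨K₁, hK₁⟩ := h.uniform hθ (show 0 < c / 3 by positivity)
  obtain ⟨K₂, hK₂⟩ := h.uniform hθ (show 0 < c₃ / 2 by positivity)
  set K := max K₂ 1 with hK
  have hK1 : 1 ≤ K := le_max_right _ _
  have hharm : ∀ᶠ n : ℕ in atTop, C₂ < harmonicSum (n / K) :=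
    (tendsto_harmonicSum.comp (Nat.tendsto_div_const_atTop (by omega))).eventually_gt_atTop C₂
  refine ⟨C₂, ?_⟩
  filter_upwards [(hK₁ K₁ le_rfl).2, (hK₂ K (le_max_left _ _)).2, hharm, eventually_ge_atTop N₁,
    eventually_ge_atTop N₂, eventually_ge_atTop N₃, eventually_ge_atTop 1]
    with n hn1 hn2 hnh hN₁ hN₂ hN₃ hn
  have hp := binomCoeff_pos hθ n
  -- The modulus exceeds every quantity that will be compared modulo q, so those congruences become
  -- equalities.
  set q := n * ∑ j ∈ Finset.Icc 1 n, (a n j).natAbs + n * K + 1 with hq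
  obtain ⟨k, hk⟩ := h₂ n hN₂ q (by omega) (a n) (fun s => by
    have hge := norm_multSum_expPhase_ge hθ (a n) μ n K₁ (s / q) (c / 3) (hK₁ K₁ le_rfl).1
      hn1.1 hn1.2
    obtain ⟨z, hz, hzC⟩ := h₁ n hN₁ (fun j => expPhase (s / q) (a n j))
      (fun j => (norm_expPhase _ _).le) (by
        refine le_trans (le_of_eq ?_) hge
        rw [hc]
        ring)
    obtain ⟨τ, hτ⟩ := exists_logDist_le hz hzC
    refine ⟨τ, le_trans (le_of_eq ?_) hτ⟩
    congr 1
    funext j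
    ring)
  -- The exceptional j have logarithmic mass at most C₂, so all cycle lengths are good with
  -- probability at least c₃. Since h leaves [0, K) with probability at most c₃/2, both events meet.
  have hsieve := h₃ n hN₃ (fun j => if (q : ℤ) ∣ a n j - k * j then 1 else 0)
    (fun j => by split_ifs <;> norm_num) (by
      refine le_trans (le_of_eq ?_) hk
      rw [Finset.sum_filter]
      refine Finset.sum_congr rfl fun j _ => ?_
      by_cases hd : (q : ℤ) ∣ a n j - k * j <;> simp [hd])
  rw [multSum_indicator] at hsieve
  -- a partition with all parts good and a bounded value
  obtain ⟨p, hp1, hp2⟩ : ∃ p : n.Partition, (∀ j ∈ p.parts, (q : ℤ) ∣ a n j - k * j) ∧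
      (0 ≤ addVal (a n) p.parts ∧ addVal (a n) p.parts < K) := by
    by_contra! hcon
    have h4 : partitionSum θ n (fun s =>
        if ∀ j ∈ s, (q : ℤ) ∣ a n j - k * j then (1 : ℝ) else 0) ≤
        binomCoeff θ n * prob θ n
          (fun s => ¬ (0 ≤ addVal (a n) s ∧ addVal (a n) s < K)) := by
      unfold prob mean
      rw [mul_div_cancel₀ _ hp.ne']
      refine partitionSum_mono (by linarith) n fun p => ?_
      by_cases hg : ∀ j ∈ p.parts, (q : ℤ) ∣ a n j - k * j
      · rw [if_pos hg, if_pos]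
        intro hh
        exact absurd hh.2 (not_lt.2 (hcon p hg hh.1))
      · rw [if_neg hg]
        split_ifs <;> norm_num
    have h5 := mul_le_mul_of_nonneg_left hn2.1 hp.le
    nlinarith
  have hb := dvd_addVal_sub hp1
  rw [p.parts_sum] at hb
  have hlin : ∀ j ∈ Finset.Icc 1 n, (q : ℤ) ∣ a n j - k * j →
      (n : ℤ) * a n j = j * addVal (a n) p.parts := fun j hj hd =>
    eq_zero_of_dvd hn (Nat.lt_succ_self _) hp2.1 hp2.2 hb hj hd
  set b := addVal (a n) p.parts with hbdef
  -- If b > 0, a good j ≤ n/K would satisfy n a_j = jb with 0 < jb < n, which is impossible. Then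
  -- all j ≤ n/K would be exceptional, and their harmonic sum exceeds C₂.
  have hb0 : b = 0 := by
    by_contra hne
    have hbpos : 0 < b := lt_of_le_of_ne hp2.1 (Ne.symm hne)
    refine absurd hnh (not_lt.2 (le_trans ?_ hk))
    unfold harmonicSum
    refine Finset.sum_le_sum_of_subset_of_nonneg (fun j hj => ?_) fun j _ _ => by positivity
    rw [Finset.mem_Icc] at hj
    have hjK : j * K ≤ n := (Nat.le_div_iff_mul_le (by omega)).1 hj.2
    have hjn : j ≤ n := le_trans (Nat.le_mul_of_pos_right j (by omega)) hjK
    refine Finset.mem_filter.2 ⟨Finset.mem_Icc.2 ⟨hj.1, hjn⟩, fun hd => ?_⟩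
    have h6 := hlin j (Finset.mem_Icc.2 ⟨hj.1, hjn⟩) hd
    have hj0 : (0 : ℤ) < j := by exact_mod_cast hj.1
    have hn0 : (0 : ℤ) < n := by exact_mod_cast hn
    have h7 : 0 < a n j := by
      by_contra hle
      push Not at hle
      nlinarith [mul_pos hj0 hbpos]
    have h8 : (n : ℤ) ≤ n * a n j := by nlinarith
    have h9 : (j : ℤ) * b < j * K := mul_lt_mul_of_pos_left hp2.2 hj0
    have h10 : (j : ℤ) * K ≤ n := by exact_mod_cast hjK
    linarith
  refine le_trans ?_ hk
  refine Finset.sum_le_sum_of_subset_of_nonneg (fun j hj => ?_) fun j _ _ => by positivity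
  obtain ⟨hj1, hj2⟩ := Finset.mem_filter.1 hj
  refine Finset.mem_filter.2 ⟨hj1, fun hd => hj2 ?_⟩
  have h6 := hlin j hj1 hd
  rw [hb0, mul_zero] at h6
  have hn0 : (n : ℤ) ≠ 0 := by exact_mod_cast (by omega : n ≠ 0)
  exact (mul_eq_zero.1 h6).resolve_left hn0

/-! ### The moment functional and its logarithmic bound. -/

/-- The functional satisfying the recursion of the factorial moments of an additive function with
coefficients `A`; here `ψ` plays the role of the mass left after the marked cycles are removed. -/
def momentRec (θ : ℝ) (n : ℕ) (A : ℕ → ℕ) : ℕ → (ℕ → ℝ) → ℝ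
  | 0, ψ => ψ 0
  | l + 1, ψ => ∑ r ∈ Finset.range (l + 1), (l.choose r : ℝ) * ∑ j ∈ Finset.Icc 1 n,
      θ / j * ((A j).descFactorial (r + 1) : ℝ) * momentRec θ n A (l - r) (fun s => ψ (s + j))
  termination_by l => l

section MomentRec

variable {θ : ℝ} {n : ℕ} {A : ℕ → ℕ}

lemma momentRec_zero (ψ : ℕ → ℝ) : momentRec θ n A 0 ψ = ψ 0 := by rw [momentRec]

lemma momentRec_succ (l : ℕ) (ψ : ℕ → ℝ) : momentRec θ n A (l + 1) ψ =
    ∑ r ∈ Finset.range (l + 1), (l.choose r : ℝ) * ∑ j ∈ Finset.Icc 1 n,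
      θ / j * ((A j).descFactorial (r + 1) : ℝ) *
        momentRec θ n A (l - r) (fun s => ψ (s + j)) := by rw [momentRec]

lemma momentRec_sub (l : ℕ) (ψ φ : ℕ → ℝ) :
    momentRec θ n A l (fun s => ψ s - φ s) = momentRec θ n A l ψ - momentRec θ n A l φ := by
  induction l using Nat.strong_induction_on generalizing ψ φ with
  | _ l ih =>
    rcases l with _ | l
    · simp only [momentRec_zero]
    · simp only [momentRec_succ]
      rw [← Finset.sum_sub_distrib]
      refine Finset.sum_congr rfl fun r _ => ?_
      rw [← mul_sub, ← Finset.sum_sub_distrib]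
      congr 1
      refine Finset.sum_congr rfl fun j _ => ?_
      rw [ih (l - r) (by omega) (fun s => ψ (s + j)) (fun s => φ (s + j)), mul_sub]

lemma momentRec_mul_left (l : ℕ) (c : ℝ) (ψ : ℕ → ℝ) :
    momentRec θ n A l (fun s => c * ψ s) = c * momentRec θ n A l ψ := by
  induction l using Nat.strong_induction_on generalizing ψ with
  | _ l ih =>
    rcases l with _ | l
    · simp only [momentRec_zero]
    · simp only [momentRec_succ]
      rw [Finset.mul_sum]
      refine Finset.sum_congr rfl fun r _ => ?_
      rw [mul_left_comm, Finset.mul_sum (Finset.Icc 1 n) _ c]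
      congr 1
      refine Finset.sum_congr rfl fun j _ => ?_
      rw [ih (l - r) (by omega) (fun s => ψ (s + j))]
      ring

lemma momentRec_eq_zero (l : ℕ) : momentRec θ n A l (fun _ => 0) = 0 := by
  have h := momentRec_mul_left (θ := θ) (n := n) (A := A) l 0 fun _ => 0
  simpa using h

lemma momentRec_mono (hθ : 0 ≤ θ) (l : ℕ) {ψ φ : ℕ → ℝ} (h : ∀ s, ψ s ≤ φ s) :
    momentRec θ n A l ψ ≤ momentRec θ n A l φ := by
  induction l using Nat.strong_induction_on generalizing ψ φ with
  | _ l ih =>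
    rcases l with _ | l
    · simp only [momentRec_zero, h]
    · simp only [momentRec_succ]
      refine Finset.sum_le_sum fun r _ => mul_le_mul_of_nonneg_left
        (Finset.sum_le_sum fun j _ => mul_le_mul_of_nonneg_left
          (ih (l - r) (by omega) fun s => h (s + j)) (by positivity)) (by positivity)

lemma momentRec_nonneg (hθ : 0 ≤ θ) (l : ℕ) {ψ : ℕ → ℝ} (h : ∀ s, 0 ≤ ψ s) :
    0 ≤ momentRec θ n A l ψ := by
  rw [← momentRec_eq_zero (θ := θ) (n := n) (A := A) l]
  exact momentRec_mono hθ l h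

lemma abs_momentRec_le (hθ : 0 ≤ θ) (l : ℕ) (ψ : ℕ → ℝ) :
    |momentRec θ n A l ψ| ≤ momentRec θ n A l fun s => |ψ s| := by
  rw [abs_le]
  constructor
  · rw [← neg_one_mul, ← momentRec_mul_left]
    exact momentRec_mono hθ l fun s => by linarith [neg_abs_le (ψ s)]
  · exact momentRec_mono hθ l fun s => le_abs_self _

lemma harmonicSum_nonneg (n : ℕ) : 0 ≤ harmonicSum n :=
  Finset.sum_nonneg fun _ _ => by positivity

/-- The identity 1/(js) = (1/j + 1/s)/(j+s) turns the double sum into harmonic sums times shifted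
sums of ψ(t)/t; the shifts do not exceed the full sum because ψ vanishes beyond n. -/
lemma sum_sum_div_le (n : ℕ) {ψ : ℕ → ℝ} (h0 : ∀ s, 0 ≤ ψ s) (hn : ∀ s, n < s → ψ s = 0) :
    ∑ j ∈ Finset.Icc 1 n, 1 / (j : ℝ) * ∑ s ∈ Finset.Icc 1 n, ψ (s + j) / s ≤
      2 * harmonicSum n * ∑ t ∈ Finset.Icc 1 n, ψ t / t := by
  set S := ∑ t ∈ Finset.Icc 1 n, ψ t / t with hS
  have hshift : ∀ j, ∑ s ∈ Finset.Icc 1 n, ψ (s + j) / ((s + j : ℕ) : ℝ) ≤ S := by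
    intro j
    have hinj : Set.InjOn (fun s => s + j) (Finset.Icc 1 n : Finset ℕ) :=
      fun s _ t _ h => Nat.add_right_cancel h
    rw [← Finset.sum_image (f := fun t : ℕ => ψ t / (t : ℝ)) hinj]
    have h1 : ∑ t ∈ (Finset.Icc 1 n).image (fun s => s + j), ψ t / (t : ℝ) ≤
        ∑ t ∈ (Finset.Icc 1 n) ∪ (Finset.Icc 1 n).image (fun s => s + j), ψ t / (t : ℝ) :=
      Finset.sum_le_sum_of_subset_of_nonneg Finset.subset_union_right
        fun t _ _ => div_nonneg (h0 t) (Nat.cast_nonneg t)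
    refine h1.trans (le_of_eq (Finset.sum_subset Finset.subset_union_left fun t ht ht' => ?_).symm)
    rcases Finset.mem_union.1 ht with h | h
    · exact absurd h ht'
    · obtain ⟨s, hs, rfl⟩ := Finset.mem_image.1 h
      rw [Finset.mem_Icc] at hs ht'
      rw [hn _ (by omega), zero_div]
  have hsplit : ∑ j ∈ Finset.Icc 1 n, 1 / (j : ℝ) * ∑ s ∈ Finset.Icc 1 n, ψ (s + j) / s =
      ∑ j ∈ Finset.Icc 1 n, 1 / (j : ℝ) *
        ∑ s ∈ Finset.Icc 1 n, ψ (s + j) / ((s + j : ℕ) : ℝ) +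
      ∑ s ∈ Finset.Icc 1 n, 1 / (s : ℝ) *
        ∑ j ∈ Finset.Icc 1 n, ψ (s + j) / ((s + j : ℕ) : ℝ) := by
    simp_rw [Finset.mul_sum]
    conv_rhs =>
      arg 2
      rw [Finset.sum_comm]
    rw [← Finset.sum_add_distrib]
    refine Finset.sum_congr rfl fun j hj => ?_
    rw [← Finset.sum_add_distrib]
    refine Finset.sum_congr rfl fun s hs => ?_
    have hj0 : (0 : ℝ) < j := by exact_mod_cast (Finset.mem_Icc.1 hj).1
    have hs0 : (0 : ℝ) < s := by exact_mod_cast (Finset.mem_Icc.1 hs).1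
    push_cast
    field_simp
  have hbound : ∑ j ∈ Finset.Icc 1 n, 1 / (j : ℝ) *
        ∑ s ∈ Finset.Icc 1 n, ψ (s + j) / ((s + j : ℕ) : ℝ) ≤ harmonicSum n * S := by
    rw [harmonicSum, Finset.sum_mul]
    exact Finset.sum_le_sum fun j _ => mul_le_mul_of_nonneg_left (hshift j) (by positivity)
  have hsym : ∑ s ∈ Finset.Icc 1 n, 1 / (s : ℝ) *
        ∑ j ∈ Finset.Icc 1 n, ψ (s + j) / ((s + j : ℕ) : ℝ) =
      ∑ j ∈ Finset.Icc 1 n, 1 / (j : ℝ) *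
        ∑ s ∈ Finset.Icc 1 n, ψ (s + j) / ((s + j : ℕ) : ℝ) := by
    refine Finset.sum_congr rfl fun s _ => ?_
    congr 1
    refine Finset.sum_congr rfl fun j _ => ?_
    rw [add_comm]
  rw [hsplit, hsym]
  linarith

/-- The functional is bounded by a logarithmic average, up to powers of `log n`. -/
lemma exists_momentRec_le (hθ : 0 ≤ θ) (m l : ℕ) :
    ∃ D : ℝ, 0 ≤ D ∧ ∀ (n : ℕ) (A : ℕ → ℕ) (ψ : ℕ → ℝ), (∀ j, A j ≤ m) → (∀ s, 0 ≤ ψ s) →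
      (∀ s, n < s → ψ s = 0) → 1 ≤ l →
      momentRec θ n A l ψ ≤ D * (1 + harmonicSum n) ^ l * ∑ t ∈ Finset.Icc 1 n, ψ t / t := by
  induction l using Nat.strong_induction_on with
  | _ l ih =>
    rcases l with _ | l
    · exact ⟨0, le_rfl, fun _ _ _ _ _ _ h => absurd h (by norm_num)⟩
    · choose! D hD0 hD using ih
      refine ⟨∑ r ∈ Finset.range (l + 1), (l.choose r : ℝ) *
        (θ * (m : ℝ) ^ (r + 1) * (1 + 2 * D (l - r))), ?_, ?_⟩
      · refine Finset.sum_nonneg fun r _ => ?_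
        have := hD0 (l - r) (by omega)
        positivity
      intro n A ψ hA h0 hn _
      set S := ∑ t ∈ Finset.Icc 1 n, ψ t / t with hS
      have hS0 : 0 ≤ S := Finset.sum_nonneg fun t _ => div_nonneg (h0 t) (Nat.cast_nonneg t)
      have hH := harmonicSum_nonneg n
      rw [momentRec_succ, mul_assoc, Finset.sum_mul]
      refine Finset.sum_le_sum fun r _ => ?_
      rw [mul_assoc (l.choose r : ℝ)]
      refine mul_le_mul_of_nonneg_left ?_ (by positivity)
      have hDr := hD0 (l - r) (by omega)
      have hA' : ∀ j, ((A j).descFactorial (r + 1) : ℝ) ≤ (m : ℝ) ^ (r + 1) := by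
        intro j
        have := (Nat.descFactorial_le_pow (A j) (r + 1)).trans (Nat.pow_le_pow_left (hA j) _)
        exact_mod_cast this
      have h1 : ∑ j ∈ Finset.Icc 1 n, θ / j * ((A j).descFactorial (r + 1) : ℝ) *
          momentRec θ n A (l - r) (fun s => ψ (s + j)) ≤
          θ * (m : ℝ) ^ (r + 1) * ∑ j ∈ Finset.Icc 1 n, 1 / (j : ℝ) *
            momentRec θ n A (l - r) (fun s => ψ (s + j)) := by
        rw [Finset.mul_sum]
        refine Finset.sum_le_sum fun j _ => ?_
        have h2 : 0 ≤ momentRec θ n A (l - r) (fun s => ψ (s + j)) :=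
          momentRec_nonneg hθ _ fun s => h0 _
        calc _ ≤ θ / j * (m : ℝ) ^ (r + 1) * momentRec θ n A (l - r) (fun s => ψ (s + j)) := by
              gcongr
              exact hA' j
          _ = _ := by ring
      refine h1.trans ?_
      rw [mul_assoc (θ * (m : ℝ) ^ (r + 1))]
      refine mul_le_mul_of_nonneg_left ?_ (by positivity)
      rcases Nat.eq_zero_or_pos (l - r) with hlr | hlr
      · have h3 : ∑ j ∈ Finset.Icc 1 n, 1 / (j : ℝ) *
            momentRec θ n A (l - r) (fun s => ψ (s + j)) = S := by
          rw [hlr]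
          refine Finset.sum_congr rfl fun j _ => ?_
          rw [momentRec_zero, zero_add]
          ring
        rw [h3, ← mul_assoc]
        refine le_mul_of_one_le_left hS0 (one_le_mul_of_one_le_of_one_le (by linarith) ?_)
        exact one_le_pow₀ (by linarith)
      · have h3 : ∑ j ∈ Finset.Icc 1 n, 1 / (j : ℝ) *
            momentRec θ n A (l - r) (fun s => ψ (s + j)) ≤
            ∑ j ∈ Finset.Icc 1 n, 1 / (j : ℝ) * (D (l - r) * (1 + harmonicSum n) ^ (l - r) *
              ∑ s ∈ Finset.Icc 1 n, ψ (s + j) / s) := by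
          refine Finset.sum_le_sum fun j _ => mul_le_mul_of_nonneg_left ?_ (by positivity)
          exact hD (l - r) (by omega) n A (fun s => ψ (s + j)) hA (fun s => h0 _)
            (fun s hs => hn _ (by omega)) hlr
        have h4 : ∑ j ∈ Finset.Icc 1 n, 1 / (j : ℝ) * (D (l - r) *
            (1 + harmonicSum n) ^ (l - r) * ∑ s ∈ Finset.Icc 1 n, ψ (s + j) / s) =
            D (l - r) * (1 + harmonicSum n) ^ (l - r) * ∑ j ∈ Finset.Icc 1 n, 1 / (j : ℝ) *
              ∑ s ∈ Finset.Icc 1 n, ψ (s + j) / s := by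
          rw [Finset.mul_sum]
          refine Finset.sum_congr rfl fun j _ => ?_
          ring
        rw [h4] at h3
        refine h3.trans ?_
        have h5 := sum_sum_div_le n h0 hn
        rw [← hS] at h5
        have h6 : (1 + harmonicSum n) ^ (l - r) * harmonicSum n ≤ (1 + harmonicSum n) ^ (l + 1) := by
          calc _ ≤ (1 + harmonicSum n) ^ (l - r) * (1 + harmonicSum n) := by
                gcongr
                linarith
            _ = (1 + harmonicSum n) ^ (l - r + 1) := (pow_succ _ _).symm
            _ ≤ _ := pow_le_pow_right₀ (by linarith) (by omega)
        calc _ ≤ D (l - r) * (1 + harmonicSum n) ^ (l - r) * (2 * harmonicSum n * S) := by gcongr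
          _ = 2 * D (l - r) * ((1 + harmonicSum n) ^ (l - r) * harmonicSum n * S) := by ring
          _ ≤ 2 * D (l - r) * ((1 + harmonicSum n) ^ (l + 1) * S) := by gcongr
          _ ≤ (1 + 2 * D (l - r)) * ((1 + harmonicSum n) ^ (l + 1) * S) := by
              gcongr
              linarith

end MomentRec

/-! ### Factorial moments under the Ewens distribution. -/

section FactorialMoments

lemma add_descFactorial_eq (u v l : ℕ) : (u + v).descFactorial l =
    ∑ r ∈ Finset.range (l + 1), l.choose r * (u.descFactorial r * v.descFactorial (l - r)) := by
  rw [Nat.descFactorial_eq_factorial_mul_choose, Nat.add_choose_eq,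
    Finset.Nat.sum_antidiagonal_eq_sum_range_succ (fun i j => u.choose i * v.choose j),
    Finset.mul_sum]
  refine Finset.sum_congr rfl fun r hr => ?_
  have hrl : r ≤ l := Nat.lt_succ_iff.1 (Finset.mem_range.1 hr)
  rw [Nat.descFactorial_eq_factorial_mul_choose, Nat.descFactorial_eq_factorial_mul_choose,
    ← Nat.choose_mul_factorial_mul_factorial hrl]
  ring

/-- Let X be the total. Then (X)_(l+1) = X (X-1)_l = ∑ A_j (X-1)_l over the parts. Vandermonde's
identity applied to X-1 = (A_j-1) + rest, with A_j (A_j-1)_r = (A_j)_(r+1), separates the marked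
part from the others. -/
lemma descFactorial_sum_eq (A : ℕ → ℕ) (s : Multiset ℕ) (l : ℕ) :
    (s.map A).sum.descFactorial (l + 1) = (s.map fun j => ∑ r ∈ Finset.range (l + 1),
      l.choose r * ((A j).descFactorial (r + 1) *
        ((s.erase j).map A).sum.descFactorial (l - r))).sum := by
  have h1 : ∀ j ∈ s, (∑ r ∈ Finset.range (l + 1), l.choose r * ((A j).descFactorial (r + 1) *
        ((s.erase j).map A).sum.descFactorial (l - r))) =
      A j * ((s.map A).sum - 1).descFactorial l := by
    intro j hj
    have hs : (s.map A).sum = A j + ((s.erase j).map A).sum := by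
      conv_lhs => rw [← Multiset.cons_erase hj, Multiset.map_cons, Multiset.sum_cons]
    rcases Nat.eq_zero_or_pos (A j) with h0 | h0
    · rw [h0, zero_mul]
      refine Finset.sum_eq_zero fun r _ => ?_
      simp
    · obtain ⟨u, hu⟩ := Nat.exists_eq_add_of_lt h0
      rw [zero_add] at hu
      rw [hs, hu, show u + 1 + ((s.erase j).map A).sum - 1 = u + ((s.erase j).map A).sum by omega,
        add_descFactorial_eq, Finset.mul_sum]
      refine Finset.sum_congr rfl fun r _ => ?_
      rw [Nat.succ_descFactorial_succ]
      ring
  rw [Multiset.map_congr rfl h1, Multiset.sum_map_mul_right]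
  rcases Nat.eq_zero_or_pos (s.map A).sum with h0 | h0
  · rw [h0, zero_mul]
    simp
  · obtain ⟨u, hu⟩ := Nat.exists_eq_add_of_lt h0
    rw [zero_add] at hu
    rw [hu, Nat.succ_descFactorial_succ, Nat.add_sub_cancel]

lemma partitionSum_descFactorial_succ (θ : ℝ) (N l : ℕ) (A : ℕ → ℕ) :
    partitionSum θ N (fun s => ((s.map A).sum.descFactorial (l + 1) : ℝ)) =
      ∑ r ∈ Finset.range (l + 1), (l.choose r : ℝ) * ∑ j ∈ Finset.Icc 1 N,
        θ / j * ((A j).descFactorial (r + 1) : ℝ) *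
          partitionSum θ (N - j) fun s => ((s.map A).sum.descFactorial (l - r) : ℝ) := by
  have h1 : ∀ s : Multiset ℕ, ((s.map A).sum.descFactorial (l + 1) : ℝ) =
      (s.map fun j : ℕ => ∑ r ∈ Finset.range (l + 1), (l.choose r : ℝ) *
        (((A j).descFactorial (r + 1) : ℝ) *
          (((s.erase j).map A).sum.descFactorial (l - r) : ℝ))).sum := by
    intro s
    rw [descFactorial_sum_eq, Nat.cast_multiset_sum, Multiset.map_map]
    congr 1
    refine Multiset.map_congr rfl fun j _ => ?_
    simp only [Function.comp_apply]
    push_cast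
    rfl
  simp_rw [h1]
  rw [partitionSum_marked θ N fun j s => ∑ r ∈ Finset.range (l + 1), (l.choose r : ℝ) *
        (((A j).descFactorial (r + 1) : ℝ) * ((s.map A).sum.descFactorial (l - r) : ℝ))]
  simp_rw [Finset.mul_sum]
  rw [Finset.sum_comm]
  refine Finset.sum_congr rfl fun j _ => ?_
  rw [partitionSum_sum, Finset.smul_sum]
  refine Finset.sum_congr rfl fun r _ => ?_
  have h2 := partitionSum_smul θ (N - j) ((l.choose r : ℝ) * ((A j).descFactorial (r + 1) : ℝ))
    fun s => ((s.map A).sum.descFactorial (l - r) : ℝ)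
  simp only [smul_eq_mul] at h2
  simp only [← mul_assoc, smul_eq_mul]
  rw [h2]
  ring

/-- The factorial moments are given by `momentRec`. -/
lemma partitionSum_descFactorial (θ : ℝ) (n l : ℕ) (A : ℕ → ℕ) {N : ℕ} (hN : N ≤ n) :
    partitionSum θ N (fun s => ((s.map A).sum.descFactorial l : ℝ)) =
      momentRec θ n A l fun s => if s ≤ N then binomCoeff θ (N - s) else 0 := by
  induction l using Nat.strong_induction_on generalizing N with
  | _ l ih =>
    rcases l with _ | l
    · simp only [Nat.descFactorial_zero, Nat.cast_one, partitionSum_one, momentRec_zero]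
      simp
    · rw [partitionSum_descFactorial_succ, momentRec_succ]
      refine Finset.sum_congr rfl fun r _ => ?_
      congr 1
      -- The summation range n stays fixed while N varies: shifting ψ by j replaces N by N-j, and
      -- gives the zero function once j > N.
      have hsub : Finset.Icc 1 N ⊆ Finset.Icc 1 n := Finset.Icc_subset_Icc_right hN
      rw [← Finset.sum_subset hsub]
      · refine Finset.sum_congr rfl fun j hj => ?_
        rw [Finset.mem_Icc] at hj
        rw [ih (l - r) (by omega) (by omega : N - j ≤ n)]
        congr 2
        funext s
        by_cases hs : s + j ≤ N
        · rw [if_pos hs, if_pos (by omega)]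
          congr 1
          omega
        · rw [if_neg hs, if_neg (by omega)]
      · intro j hj hj'
        rw [Finset.mem_Icc] at hj hj'
        have : (fun s => if s + j ≤ N then binomCoeff θ (N - (s + j)) else 0) = fun _ => 0 := by
          funext s
          rw [if_neg (by omega)]
        rw [this, momentRec_eq_zero, mul_zero]

lemma mean_descFactorial (θ : ℝ) (n l : ℕ) (A : ℕ → ℕ) :
    mean θ n (fun s => ((s.map A).sum.descFactorial l : ℝ)) =
      momentRec θ n A l fun s =>
        if s ≤ n then binomCoeff θ (n - s) / binomCoeff θ n else 0 := by
  rw [mean, partitionSum_descFactorial θ n l A le_rfl, div_eq_inv_mul, ← momentRec_mul_left]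
  congr 1
  funext s
  split_ifs
  · rw [div_eq_inv_mul]
  · rw [mul_zero]

/-- Uniform bounds of the factorial moments in terms of the first-order sums. -/
lemma exists_mean_descFactorial_le {θ : ℝ} (hθ : 1 ≤ θ) (b : ℕ → ℝ) (l : ℕ) :
    ∃ c : ℝ, 0 ≤ c ∧ ∀ (n : ℕ) (A : ℕ → ℕ), (∀ r, 1 ≤ r → r ≤ l → ∑ j ∈ Finset.Icc 1 n,
      θ / j * ((A j).descFactorial r : ℝ) * (binomCoeff θ (n - j) / binomCoeff θ n) ≤ b r) →
      ∀ N ≤ n, mean θ N (fun s => ((s.map A).sum.descFactorial l : ℝ)) ≤ c := by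
  have hθ0 : 0 ≤ θ := by linarith
  induction l using Nat.strong_induction_on with
  | _ l ih =>
    rcases l with _ | l
    · refine ⟨1, by norm_num, fun n A _ N _ => ?_⟩
      simp only [Nat.descFactorial_zero, Nat.cast_one, mean_const hθ]
      exact le_rfl
    · choose! c hc0 hc using ih
      refine ⟨∑ r ∈ Finset.range (l + 1), (l.choose r : ℝ) * (max (b (r + 1)) 0 * c (l - r)),
        Finset.sum_nonneg fun r _ => ?_, fun n A hb N hN => ?_⟩
      · have := hc0 (l - r) (by omega)
        positivity
      · rw [mean, partitionSum_descFactorial_succ, Finset.sum_div]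
        refine Finset.sum_le_sum fun r hr => ?_
        rw [Finset.mem_range] at hr
        rw [mul_div_assoc]
        refine mul_le_mul_of_nonneg_left ?_ (by positivity)
        have hcr := hc0 (l - r) (by omega)
        have h1 := (hb (r + 1) (by omega) (by omega)).trans (le_max_left _ (0 : ℝ))
        refine le_trans ?_ (mul_le_mul_of_nonneg_right h1 hcr)
        rw [Finset.sum_mul, Finset.sum_div]
        have hsub : Finset.Icc 1 N ⊆ Finset.Icc 1 n := Finset.Icc_subset_Icc_right hN
        refine le_trans (Finset.sum_le_sum fun j hj => ?_)
          (Finset.sum_le_sum_of_subset_of_nonneg hsub fun j _ _ => ?_)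
        · rw [Finset.mem_Icc] at hj
          have h2 := hc (l - r) (by omega) n A (fun r' h1 h2 => hb r' h1 (by omega)) (N - j)
            (by omega)
          -- The recursion descends to the levels N-j, while the hypothesis is given at level n
          -- only; log-concavity bridges the two.
          have h3 := binomCoeff_log_concave hθ hj.2 hN
          have hp := binomCoeff_pos hθ (N - j)
          have hpN := binomCoeff_pos hθ N
          have h4 : partitionSum θ (N - j) (fun s => ((s.map A).sum.descFactorial (l - r) : ℝ)) =
              mean θ (N - j) (fun s => ((s.map A).sum.descFactorial (l - r) : ℝ)) *
                binomCoeff θ (N - j) := by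
            rw [mean, div_mul_cancel₀ _ hp.ne']
          rw [h4]
          calc _ = θ / j * ((A j).descFactorial (r + 1) : ℝ) *
                (binomCoeff θ (N - j) / binomCoeff θ N) *
                mean θ (N - j) (fun s => ((s.map A).sum.descFactorial (l - r) : ℝ)) := by ring
            _ ≤ θ / j * ((A j).descFactorial (r + 1) : ℝ) *
                (binomCoeff θ (N - j) / binomCoeff θ N) * c (l - r) := by gcongr
            _ ≤ θ / j * ((A j).descFactorial (r + 1) : ℝ) *
                (binomCoeff θ (n - j) / binomCoeff θ n) * c (l - r) := by gcongr
        · have := binomCoeff_pos hθ (n - j)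
          have := binomCoeff_pos hθ n
          positivity

end FactorialMoments

/-! ### The sums Υ as unfolded moment recursions. -/

lemma sum_piFinset_succ {M : Type*} [AddCommMonoid M] (u : ℕ) (S : Finset ℕ)
    (F : (Fin (u + 1) → ℕ) → M) :
    ∑ x ∈ Fintype.piFinset (fun _ : Fin (u + 1) => S), F x =
      ∑ a ∈ S, ∑ y ∈ Fintype.piFinset (fun _ : Fin u => S), F (Fin.cons a y) := by
  rw [← Finset.sum_product']
  refine Finset.sum_bij' (fun x _ => (x 0, Fin.tail x)) (fun p _ => Fin.cons p.1 p.2)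
    ?_ ?_ ?_ ?_ ?_
  · intro x hx
    rw [Fintype.mem_piFinset] at hx
    exact Finset.mem_product.2 ⟨hx 0, Fintype.mem_piFinset.2 fun i => hx i.succ⟩
  · intro p hp
    rw [Finset.mem_product, Fintype.mem_piFinset] at hp
    refine Fintype.mem_piFinset.2 fun i => ?_
    refine Fin.cases ?_ (fun i => ?_) i
    · exact hp.1
    · exact hp.2 i
  · intro x _
    exact Fin.cons_self_tail x
  · intro p _
    simp
  · intro x _
    rw [Fin.cons_self_tail]

lemma sum_Iio_succ (u : ℕ) (a : ℕ) (y : Fin u → ℕ) (i : Fin u) :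
    ∑ k ∈ Finset.Iio i.succ, (Fin.cons a y : Fin (u + 1) → ℕ) k = a + ∑ k ∈ Finset.Iio i, y k := by
  have h : (Finset.Iio i.succ : Finset (Fin (u + 1))) =
      insert 0 ((Finset.Iio i).map (Fin.succEmb u)) := by
    rw [Fin.map_succEmb_Iio]
    ext k
    simp only [Finset.mem_Iio, Finset.mem_insert, Finset.mem_Ioo]
    constructor
    · intro hk
      rcases eq_or_ne k 0 with h0 | h0
      · exact Or.inl h0
      · exact Or.inr ⟨Fin.pos_iff_ne_zero.2 h0, hk⟩
    · rintro (rfl | hk)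
      · exact Fin.succ_pos i
      · exact hk.2
  rw [h, Finset.sum_insert (by simp), Finset.sum_map]
  simp

section Upsilon

/-- The sum `∑ ∏ (A(j_i))_(r_i) / j_i · ψ(j_1 + ⋯ + j_u)` over `u`-tuples of indices up to `n`. -/
def tupleSum (n : ℕ) (A : ℕ → ℕ) (u : ℕ) (r : Fin u → ℕ) (ψ : ℕ → ℝ) : ℝ :=
  ∑ j ∈ Fintype.piFinset (fun _ : Fin u => Finset.Icc 1 n),
    (∏ i, ((A (j i)).descFactorial (r i) : ℝ) / (j i : ℝ)) * ψ (∑ i, j i)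

/-- The weight of a composition `r` of `l`. -/
def compositionWeight (u l : ℕ) (r : Fin u → ℕ) : ℕ :=
  ∏ i, (l - (∑ k ∈ Finset.Iio i, r k) - 1).choose (r i - 1)

/-- The sum of `tupleSum` over the compositions of `l` into `u` parts. -/
def compositionSum (n m : ℕ) (A : ℕ → ℕ) (u l : ℕ) (ψ : ℕ → ℝ) : ℝ :=
  ∑ r ∈ Fintype.piFinset (fun _ : Fin u => Finset.Icc 1 m),
    if ∑ i, r i = l then (compositionWeight u l r : ℝ) * tupleSum n A u r ψ else 0

variable {n m : ℕ} {A : ℕ → ℕ}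

lemma tupleSum_cons (u a : ℕ) (r : Fin u → ℕ) (ψ : ℕ → ℝ) :
    tupleSum n A (u + 1) (Fin.cons a r) ψ = ∑ j ∈ Finset.Icc 1 n,
      ((A j).descFactorial a : ℝ) / j * tupleSum n A u r (fun s => ψ (s + j)) := by
  unfold tupleSum
  rw [sum_piFinset_succ]
  refine Finset.sum_congr rfl fun j _ => ?_
  rw [Finset.mul_sum]
  refine Finset.sum_congr rfl fun y _ => ?_
  rw [Fin.prod_univ_succ, Fin.sum_univ_succ]
  simp only [Fin.cons_zero, Fin.cons_succ]
  rw [mul_assoc, add_comm j]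

lemma compositionWeight_cons (u l a : ℕ) (r : Fin u → ℕ) :
    compositionWeight (u + 1) l (Fin.cons a r) =
      (l - 1).choose (a - 1) * compositionWeight u (l - a) r := by
  unfold compositionWeight
  rw [Fin.prod_univ_succ]
  have h0 : (Finset.Iio (0 : Fin (u + 1))) = ∅ := by
    ext k
    simp
  rw [h0, Finset.sum_empty, Nat.sub_zero, Fin.cons_zero]
  congr 1
  refine Finset.prod_congr rfl fun i _ => ?_
  rw [sum_Iio_succ, Fin.cons_succ, Nat.sub_sub l a]

/-- Splitting off the first part r+1 of a composition of l+1 produces its binomial coefficient and a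
composition of l-r. Parts above m may be restored or dropped freely, since A ≤ m makes the
corresponding falling factorials vanish. -/
lemma compositionSum_succ (hA : ∀ j, A j ≤ m) (u l : ℕ) (ψ : ℕ → ℝ) :
    compositionSum n m A (u + 1) (l + 1) ψ = ∑ r ∈ Finset.range (l + 1), (l.choose r : ℝ) *
      ∑ j ∈ Finset.Icc 1 n, ((A j).descFactorial (r + 1) : ℝ) / j *
        compositionSum n m A u (l - r) (fun s => ψ (s + j)) := by
  unfold compositionSum
  rw [sum_piFinset_succ]
  have h1 : ∀ a ∈ Finset.Icc 1 m, ∑ y ∈ Fintype.piFinset (fun _ : Fin u => Finset.Icc 1 m),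
      (if ∑ i, (Fin.cons a y : Fin (u + 1) → ℕ) i = l + 1 then
        (compositionWeight (u + 1) (l + 1) (Fin.cons a y) : ℝ) *
          tupleSum n A (u + 1) (Fin.cons a y) ψ else 0) =
      if a ≤ l + 1 then (l.choose (a - 1) : ℝ) * ∑ j ∈ Finset.Icc 1 n,
        ((A j).descFactorial a : ℝ) / j *
        ∑ y ∈ Fintype.piFinset (fun _ : Fin u => Finset.Icc 1 m), (if ∑ i, y i = l + 1 - a then
          (compositionWeight u (l + 1 - a) y : ℝ) *
            tupleSum n A u y (fun s => ψ (s + j)) else 0) else 0 := by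
    intro a ha
    rw [Finset.mem_Icc] at ha
    split_ifs with hal
    · simp_rw [Finset.mul_sum]
      rw [Finset.sum_comm]
      refine Finset.sum_congr rfl fun y _ => ?_
      rw [Fin.sum_univ_succ]
      simp only [Fin.cons_zero, Fin.cons_succ]
      by_cases hy : ∑ i, y i = l + 1 - a
      · rw [if_pos (by omega), compositionWeight_cons, tupleSum_cons, Finset.mul_sum]
        refine Finset.sum_congr rfl fun j _ => ?_
        rw [if_pos hy, Nat.add_sub_cancel]
        push_cast
        ring
      · rw [if_neg (by omega)]
        simp [hy]
    · refine Finset.sum_eq_zero fun y _ => ?_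
      rw [Fin.sum_univ_succ, if_neg]
      simp only [Fin.cons_zero]
      omega
  rw [Finset.sum_congr rfl h1, ← Finset.sum_filter]
  -- compare the ranges of the first part
  have h2 : ∀ F : ℕ → ℝ, (∀ a, m < a → F a = 0) →
      ∑ a ∈ (Finset.Icc 1 m).filter (fun a => a ≤ l + 1), F a =
        ∑ r ∈ Finset.range (l + 1), F (r + 1) := by
    intro F hF
    have e : ∑ r ∈ Finset.range (l + 1), F (r + 1) = ∑ a ∈ Finset.Icc 1 (l + 1), F a := by
      refine Finset.sum_bij' (fun r _ => r + 1) (fun a _ => a - 1) ?_ ?_ ?_ ?_ ?_ <;>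
        intro x hx <;> simp only [Finset.mem_range, Finset.mem_Icc] at * <;> omega
    rw [e]
    refine Finset.sum_subset (fun a ha => ?_) fun a ha ha' => hF a ?_
    · simp only [Finset.mem_filter, Finset.mem_Icc] at *
      omega
    · simp only [Finset.mem_filter, Finset.mem_Icc] at *
      omega
  rw [h2]
  · refine Finset.sum_congr rfl fun r _ => ?_
    rw [Nat.add_sub_cancel, show l + 1 - (r + 1) = l - r by omega]
  · intro a ha
    rw [Finset.sum_eq_zero, mul_zero]
    intro j _
    rw [Nat.descFactorial_of_lt ((hA j).trans_lt ha)]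
    simp

lemma compositionSum_eq_zero {u l : ℕ} (h : l < u) (ψ : ℕ → ℝ) :
    compositionSum n m A u l ψ = 0 := by
  refine Finset.sum_eq_zero fun r hr => if_neg fun hsum => ?_
  rw [Fintype.mem_piFinset] at hr
  have h1 : ∑ _i : Fin u, 1 ≤ ∑ i, r i :=
    Finset.sum_le_sum fun i _ => (Finset.mem_Icc.1 (hr i)).1
  simp only [Finset.sum_const, Finset.card_univ, Fintype.card_fin, smul_eq_mul, mul_one] at h1
  omega

lemma compositionSum_zero_succ (l : ℕ) (ψ : ℕ → ℝ) : compositionSum n m A 0 (l + 1) ψ = 0 := by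
  refine Finset.sum_eq_zero fun r _ => if_neg ?_
  simp

lemma compositionSum_zero_zero (ψ : ℕ → ℝ) : compositionSum n m A 0 0 ψ = ψ 0 := by
  simp [compositionSum, compositionWeight, tupleSum]

/-- Both sides obey the same recursion. Compositions of l have at most l parts, so a larger L only
adds zeros; this freedom is needed because the induction descends to l-r for all r at once. -/
lemma sum_compositionSum (θ : ℝ) (hA : ∀ j, A j ≤ m) (l : ℕ) (ψ : ℕ → ℝ) {L : ℕ} (hL : l ≤ L) :
    ∑ u ∈ Finset.range (L + 1), θ ^ u * compositionSum n m A u l ψ = momentRec θ n A l ψ := by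
  induction l using Nat.strong_induction_on generalizing ψ L with
  | _ l ih =>
    rcases l with _ | l
    · rw [Finset.sum_range_succ', Finset.sum_eq_zero, compositionSum_zero_zero, momentRec_zero]
      · simp
      · intro u _
        rw [compositionSum_eq_zero (by omega), mul_zero]
    · rw [Finset.sum_range_succ', compositionSum_zero_succ, mul_zero, add_zero, momentRec_succ]
      simp_rw [compositionSum_succ hA, Finset.mul_sum]
      rw [Finset.sum_comm]
      refine Finset.sum_congr rfl fun r _ => ?_
      rw [Finset.sum_comm]
      refine Finset.sum_congr rfl fun j _ => ?_
      obtain ⟨L', rfl⟩ : ∃ L', L = L' + 1 := ⟨L - 1, by omega⟩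
      rw [← ih (l - r) (by omega) (fun s => ψ (s + j)) (L := L') (by omega), Finset.mul_sum,
        Finset.mul_sum]
      refine Finset.sum_congr rfl fun u _ => ?_
      ring

lemma trunc_le (m : ℕ) (a : ℤ) : trunc m a ≤ m := min_le_right _ _

lemma Upsilon_eq_momentRec (θ : ℝ) (a : ℕ → ℕ → ℤ) (n m : ℕ) {l : ℕ} (hl : 1 ≤ l) :
    Upsilon θ a n l m = momentRec θ n (fun j => trunc m (a n j)) l
      fun s => if s < n then (1 - (s : ℝ) / n) ^ (θ - 1) else 0 := by
  rw [← sum_compositionSum θ (m := m) (fun j => trunc_le m _) l _ le_rfl]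
  have hsub : Finset.Icc 1 l ⊆ Finset.range (l + 1) := by
    intro u hu
    rw [Finset.mem_Icc] at hu
    rw [Finset.mem_range]
    omega
  rw [← Finset.sum_subset hsub]
  · unfold Upsilon compositionSum
    refine Finset.sum_congr rfl fun u _ => ?_
    rw [Finset.sum_filter]
    congr 1
    refine Finset.sum_congr rfl fun r _ => ?_
    congr 2
    unfold innerSum tupleSum
    rw [Finset.sum_filter]
    refine Finset.sum_congr rfl fun j _ => ?_
    beta_reduce
    by_cases h : ∑ i, j i < n
    · rw [if_pos h, if_pos h]
      push_cast
      rfl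
    · rw [if_neg h, if_neg h, mul_zero]
  · intro u hu hu'
    rw [Finset.mem_range] at hu
    rw [Finset.mem_Icc] at hu'
    obtain rfl : u = 0 := by omega
    obtain ⟨l', rfl⟩ : ∃ l', l = l' + 1 := ⟨l - 1, by omega⟩
    rw [compositionSum_zero_succ, mul_zero]

end Upsilon

/-! ### Υ as an asymptotic factorial moment. -/

/-- The additive function with truncated coefficients. -/
def truncVal (m : ℕ) (a : ℕ → ℤ) (s : Multiset ℕ) : ℕ := (s.map fun j => trunc m (a j)).sum

lemma tendsto_log_pow_div (D c : ℝ) (l : ℕ) :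
    Tendsto (fun n : ℕ => D * (1 + harmonicSum n) ^ l * ((c * harmonicSum n + 1) / n)) atTop
      (𝓝 0) := by
  have hlim : Tendsto (fun n : ℕ => |D| * ((|c| + 1) * (2 ^ (l + 1) *
      ((1 + Real.log n) ^ (l + 1) / n)))) atTop (𝓝 (|D| * ((|c| + 1) * (2 ^ (l + 1) * 0)))) := by
    refine Tendsto.const_mul _ (Tendsto.const_mul _ (Tendsto.const_mul _ ?_))
    have h1 : (fun x : ℝ => (1 + Real.log x) ^ (l + 1)) =o[atTop] fun x => x := by
      have h2 : (fun x : ℝ => 1 + Real.log x) =O[atTop] Real.log := by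
        refine Asymptotics.IsBigO.add ?_ (Asymptotics.isBigO_refl _ _)
        exact Real.isLittleO_const_log_atTop.isBigO
      exact (h2.pow (l + 1)).trans_isLittleO Real.isLittleO_pow_log_id_atTop
    exact h1.tendsto_div_nhds_zero.comp tendsto_natCast_atTop_atTop
  rw [mul_zero, mul_zero, mul_zero] at hlim
  refine squeeze_zero_norm' ?_ hlim
  filter_upwards [eventually_ge_atTop 1] with n hn
  have hn0 : (0 : ℝ) < n := by exact_mod_cast hn
  have hH0 := harmonicSum_nonneg n
  have hH := harmonicSum_le n
  have hlog : 0 ≤ Real.log n := Real.log_natCast_nonneg n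
  rw [norm_mul, norm_mul, Real.norm_eq_abs D, norm_pow, norm_div, Real.norm_natCast, mul_assoc,
    Real.norm_of_nonneg (by linarith : 0 ≤ 1 + harmonicSum n), Real.norm_eq_abs]
  refine mul_le_mul_of_nonneg_left ?_ (abs_nonneg D)
  rw [mul_div_assoc', mul_div_assoc', mul_div_assoc']
  refine div_le_div_of_nonneg_right ?_ hn0.le
  have h3 : |c * harmonicSum n + 1| ≤ (|c| + 1) * (1 + harmonicSum n) := by
    refine (abs_add_le _ _).trans ?_
    rw [abs_mul, abs_of_nonneg hH0, abs_one]
    nlinarith [abs_nonneg c]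
  have h4 : 1 + harmonicSum n ≤ 2 * (1 + Real.log n) := by linarith
  calc (1 + harmonicSum n) ^ l * |c * harmonicSum n + 1|
      ≤ (1 + harmonicSum n) ^ l * ((|c| + 1) * (1 + harmonicSum n)) := by gcongr
    _ = (|c| + 1) * (1 + harmonicSum n) ^ (l + 1) := by ring
    _ ≤ (|c| + 1) * (2 * (1 + Real.log n)) ^ (l + 1) := by gcongr
    _ = _ := by rw [mul_pow]

/-- The density `(1 - t / n) ^ (θ - 1)` approximates the ratio of the normalizing constants. -/
lemma sum_abs_ratio_sub_rpow_le {θ : ℝ} (hθ : 1 ≤ θ) {n : ℕ} (hn : 1 ≤ n) :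
    ∑ t ∈ Finset.Icc 1 n, |(if t ≤ n then binomCoeff θ (n - t) / binomCoeff θ n else 0) -
      (if t < n then (1 - (t : ℝ) / n) ^ (θ - 1) else 0)| / t ≤
      ((θ - 1) * θ * harmonicSum n + 1) / n := by
  have hθ0 : 0 ≤ θ := by linarith
  have hn0 : (0 : ℝ) < n := by exact_mod_cast hn
  -- At t = n the first term of the bound reads 1/0 = 0; the contribution p_0/(n p_n) ≤ 1/n is
  -- carried by the second term.
  have hterm : ∀ t ∈ Finset.Icc 1 n,
      |(if t ≤ n then binomCoeff θ (n - t) / binomCoeff θ n else 0) -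
        (if t < n then (1 - (t : ℝ) / n) ^ (θ - 1) else 0)| / t ≤
      (θ - 1) * θ / n * (1 / (n - t : ℕ)) + if t = n then 1 / (n : ℝ) else 0 := by
    intro t ht
    rw [Finset.mem_Icc] at ht
    have ht0 : (0 : ℝ) < t := by exact_mod_cast ht.1
    rw [if_pos ht.2]
    rcases lt_or_eq_of_le ht.2 with h | h
    · rw [if_pos h, if_neg (by omega), add_zero]
      have h1 := rpow_le_binomCoeff_ratio hθ h
      have h2 := binomCoeff_ratio_sub_le hθ h
      have hnt : (0 : ℝ) < n - t := by
        have : (t : ℝ) < n := by exact_mod_cast h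
        linarith
      rw [abs_of_nonneg (by linarith), div_le_iff₀ ht0, Nat.cast_sub ht.2]
      refine h2.trans (le_of_eq ?_)
      field_simp
    · rw [if_neg (by omega), if_pos h, sub_zero, h, Nat.sub_self, binomCoeff_zero]
      have h1 := one_le_binomCoeff hθ n
      rw [abs_of_nonneg (by positivity), Nat.cast_zero, div_zero, mul_zero, zero_add]
      gcongr
      rw [div_le_one (by linarith)]
      exact h1
  refine (Finset.sum_le_sum hterm).trans ?_
  rw [Finset.sum_add_distrib, Finset.sum_ite_eq', if_pos (Finset.mem_Icc.2 ⟨hn, le_rfl⟩),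
    ← Finset.mul_sum, sum_Icc_sub n fun k => 1 / (k : ℝ)]
  have h5 : ∑ k ∈ Finset.range n, 1 / (k : ℝ) ≤ harmonicSum n := by
    obtain ⟨n', rfl⟩ : ∃ n', n = n' + 1 := ⟨n - 1, by omega⟩
    rw [Finset.sum_range_succ']
    simp only [Nat.cast_zero, div_zero, add_zero]
    have e : ∑ k ∈ Finset.range n', 1 / ((k + 1 : ℕ) : ℝ) =
        ∑ j ∈ Finset.Icc 1 n', 1 / (j : ℝ) := by
      refine Finset.sum_bij' (fun r _ => r + 1) (fun a _ => a - 1) ?_ ?_ ?_ ?_ ?_ <;>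
        intro x hx <;> simp only [Finset.mem_range, Finset.mem_Icc] at * <;> omega
    rw [e]
    exact Finset.sum_le_sum_of_subset_of_nonneg
      (Finset.Icc_subset_Icc_right (Nat.le_succ n')) fun _ _ _ => by positivity
  have h6 : 0 ≤ (θ - 1) * θ / n := by
    have : 0 ≤ θ - 1 := by linarith
    positivity
  rw [add_div]
  have := mul_le_mul_of_nonneg_left h5 h6
  have e : (θ - 1) * θ / n * harmonicSum n = (θ - 1) * θ * harmonicSum n / n := by ring
  linarith

/-- The quantities `Upsilon` are asymptotically the factorial moments of the additive functions
with truncated coefficients. -/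
lemma tendsto_mean_sub_Upsilon {θ : ℝ} (hθ : 1 ≤ θ) (a : ℕ → ℕ → ℤ) (m : ℕ) {l : ℕ} (hl : 1 ≤ l) :
    Tendsto (fun n => mean θ n (fun s => ((truncVal m (a n) s).descFactorial l : ℝ)) -
      Upsilon θ a n l m) atTop (𝓝 0) := by
  have hθ0 : 0 ≤ θ := by linarith
  obtain ⟨D, hD0, hD⟩ := exists_momentRec_le hθ0 m l
  refine squeeze_zero_norm' ?_ (tendsto_log_pow_div D ((θ - 1) * θ) l)
  filter_upwards [eventually_ge_atTop 1] with n hn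
  have hn0 : (0 : ℝ) < n := by exact_mod_cast hn
  unfold truncVal
  rw [mean_descFactorial θ n l (fun j => trunc m (a n j)), Upsilon_eq_momentRec θ a n m hl,
    ← momentRec_sub]
  refine (abs_momentRec_le hθ0 l _).trans ((hD n _ _ (fun j => trunc_le m _)
    (fun s => abs_nonneg _) (fun s hs => ?_) hl).trans ?_)
  · rw [if_neg (by omega), if_neg (by omega), sub_zero, abs_zero]
  · have hH0 := harmonicSum_nonneg n
    refine mul_le_mul_of_nonneg_left ?_ (by positivity)
    exact sum_abs_ratio_sub_rpow_le hθ hn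

/-! ### Sufficiency: truncation and the method of factorial moments. -/

lemma isErrorTerm_iff {ρ : ℕ → ℕ → ℝ} :
    IsErrorTerm ρ ↔ ∀ ε : ℝ, 0 < ε → ∃ m₀ : ℕ, ∀ m ≥ m₀, ∀ᶠ n in atTop, |ρ n m| ≤ ε := by
  unfold IsErrorTerm
  rw [ENNReal.tendsto_atTop_zero]
  constructor
  · intro h ε hε
    obtain ⟨m₀, hm₀⟩ := h (ENNReal.ofReal (ε / 2)) (by simpa using hε)
    refine ⟨m₀, fun m hm => ?_⟩
    have h1 : limsup (fun n : ℕ => ENNReal.ofReal |ρ n m|) atTop < ENNReal.ofReal ε :=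
      (hm₀ m hm).trans_lt ((ENNReal.ofReal_lt_ofReal_iff hε).2 (by linarith))
    filter_upwards [eventually_lt_of_limsup_lt h1] with n hn
    exact (ENNReal.ofReal_le_ofReal_iff hε.le).1 hn.le
  · intro h ε hε
    rcases eq_or_ne ε ⊤ with rfl | hε'
    · exact ⟨0, fun m _ => le_top⟩
    obtain ⟨m₀, hm₀⟩ := h ε.toReal (ENNReal.toReal_pos hε.ne' hε')
    refine ⟨m₀, fun m hm => limsup_le_of_le (by isBoundedDefault) ?_⟩
    filter_upwards [hm₀ m hm] with n hn
    exact ENNReal.ofReal_le_of_le_toReal hn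

lemma mean_sum_map (θ : ℝ) (n : ℕ) (g : ℕ → ℝ) :
    mean θ n (fun s => (s.map g).sum) =
      ∑ j ∈ Finset.Icc 1 n, θ / j * g j * (binomCoeff θ (n - j) / binomCoeff θ n) := by
  have h := partitionSum_marked θ n fun j _ => g j
  rw [mean, h, Finset.sum_div]
  refine Finset.sum_congr rfl fun j _ => ?_
  have h2 := partitionSum_smul θ (n - j) (g j) fun _ => (1 : ℝ)
  simp only [smul_eq_mul, mul_one] at h2 ⊢
  rw [h2, partitionSum_one]
  ring

lemma le_sum_map {s : Multiset ℕ} {g : ℕ → ℝ} (hg : ∀ j, 0 ≤ g j) {j : ℕ} (hj : j ∈ s) :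
    g j ≤ (s.map g).sum :=
  Multiset.single_le_sum (fun x hx => by
    obtain ⟨i, _, rfl⟩ := Multiset.mem_map.1 hx
    exact hg i) _ (Multiset.mem_map_of_mem g hj)

open Classical in
lemma prob_exists_le {θ : ℝ} (hθ : 1 ≤ θ) (n : ℕ) (Q : ℕ → Prop) :
    prob θ n (fun s => ∃ j ∈ s, Q j) ≤
      ∑ j ∈ Finset.Icc 1 n with Q j, θ / j * (binomCoeff θ (n - j) / binomCoeff θ n) := by
  have h := mean_sum_map θ n fun j => if Q j then 1 else 0
  have h1 : ∑ j ∈ Finset.Icc 1 n with Q j, θ / j * (binomCoeff θ (n - j) / binomCoeff θ n) =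
      mean θ n fun s => (s.map fun j => if Q j then (1 : ℝ) else 0).sum := by
    rw [h, Finset.sum_filter]
    refine Finset.sum_congr rfl fun j _ => ?_
    split_ifs <;> ring
  rw [h1]
  refine mean_mono hθ fun p => ?_
  have h0 : ∀ j, 0 ≤ if Q j then (1 : ℝ) else 0 := fun j => by split_ifs <;> norm_num
  by_cases hp : ∃ j ∈ p.parts, Q j
  · rw [if_pos hp]
    obtain ⟨j, hj, hQ⟩ := hp
    have := le_sum_map h0 hj
    rwa [if_pos hQ] at this
  · rw [if_neg hp]
    refine Multiset.sum_nonneg fun x hx => ?_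
    obtain ⟨i, _, rfl⟩ := Multiset.mem_map.1 hx
    exact h0 i

/-- The union bound comes with the weights p_(n-j)/p_n, which exceed (1-j/n)^(θ-1); the excess,
including the term j = n, is O((log n)/n). -/
lemma NegativePartNegligible.tendsto_prob {θ : ℝ} (hθ : 1 ≤ θ) {a : ℕ → ℕ → ℤ}
    (h : NegativePartNegligible θ a) :
    Tendsto (fun n => prob θ n fun s => ∃ j ∈ s, a n j ≤ -1) atTop (𝓝 0) := by
  classical
  have hθ0 : 0 ≤ θ := by linarith
  have hlim := (h.const_mul θ).add (tendsto_log_pow_div θ ((θ - 1) * θ) 0)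
  rw [mul_zero, add_zero] at hlim
  refine squeeze_zero' (.of_forall fun n => prob_nonneg hθ _) ?_ hlim
  filter_upwards [eventually_ge_atTop 1] with n hn
  refine (prob_exists_le hθ n fun j => a n j ≤ -1).trans ?_
  have h1 := mul_le_mul_of_nonneg_left (sum_abs_ratio_sub_rpow_le hθ hn) hθ0
  have h2 : ∑ j ∈ Finset.Ico 1 n with a n j ≤ -1, (1 / (j : ℝ)) * (1 - (j : ℝ) / n) ^ (θ - 1) =
      ∑ j ∈ Finset.Icc 1 n with a n j ≤ -1,
        (if j < n then (1 - (j : ℝ) / n) ^ (θ - 1) else 0) / j := by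
    rw [Finset.sum_filter, Finset.sum_filter, ← Finset.Ico_insert_right hn,
      Finset.sum_insert Finset.right_notMem_Ico]
    simp only [lt_irrefl, if_false, zero_div, ite_self, zero_add]
    refine Finset.sum_congr rfl fun j hj => ?_
    rw [if_pos (Finset.mem_Ico.1 hj).2, one_div_mul_eq_div]
  rw [h2, pow_zero, mul_one]
  refine le_trans ?_ (add_le_add_right h1 _)
  rw [← mul_add]
  rw [Finset.sum_filter, Finset.sum_filter, ← Finset.sum_add_distrib, Finset.mul_sum]
  refine Finset.sum_le_sum fun j hj => ?_
  rw [Finset.mem_Icc] at hj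
  rw [if_pos hj.2]
  by_cases hQ : a n j ≤ -1
  · rw [if_pos hQ, if_pos hQ, div_mul_eq_mul_div, mul_div_assoc, ← add_div]
    have := le_abs_self (binomCoeff θ (n - j) / binomCoeff θ n -
      if j < n then (1 - (j : ℝ) / n) ^ (θ - 1) else 0)
    gcongr
    linarith
  · rw [if_neg hQ, if_neg hQ]
    positivity

lemma addVal_eq_truncVal {a : ℕ → ℤ} {m : ℕ} {s : Multiset ℕ} (h : ∀ j ∈ s, 0 ≤ a j ∧ a j ≤ m) :
    addVal a s = truncVal m a s := by
  unfold addVal truncVal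
  rw [Nat.cast_multiset_sum, Multiset.map_map]
  congr 1
  refine Multiset.map_congr rfl fun j hj => ?_
  have := h j hj
  unfold trunc
  simp only [Function.comp_apply]
  omega

/-- The two values differ only if some cycle has a negative coefficient or one above m. In the
latter case the truncated sum is at least m, and Markov's inequality applies. -/
lemma prob_addVal_ne_truncVal_le {θ : ℝ} (hθ : 1 ≤ θ) (a : ℕ → ℤ) (n : ℕ) {m : ℕ} (hm : 1 ≤ m) :
    prob θ n (fun s => addVal a s ≠ truncVal m a s) ≤ prob θ n (fun s => ∃ j ∈ s, a j ≤ -1) +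
      mean θ n (fun s => ((truncVal m a s).descFactorial 1 : ℝ)) / m := by
  have hm0 : (0 : ℝ) < m := by exact_mod_cast hm
  have h1 : prob θ n (fun s => m ≤ truncVal m a s) ≤
      mean θ n (fun s => ((truncVal m a s).descFactorial 1 : ℝ)) / m := by
    rw [div_eq_inv_mul, ← mean_mul_left]
    refine mean_mono hθ fun p => ?_
    rw [Nat.descFactorial_one]
    split_ifs with h
    · rw [← div_eq_inv_mul, le_div_iff₀ hm0, one_mul]
      exact_mod_cast h
    · positivity
  refine le_trans (prob_mono hθ fun p hp => ?_)
    ((prob_or_le hθ (fun s => ∃ j ∈ s, a j ≤ -1) fun s => m ≤ truncVal m a s).trans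
      (add_le_add_right h1 _))
  by_contra hcon
  push Not at hcon
  refine hp (addVal_eq_truncVal fun j hj => ⟨by have := hcon.1 j hj; omega, ?_⟩)
  by_contra hj'
  have h2 : trunc m (a j) ≤ truncVal m a p.parts :=
    Multiset.single_le_sum (fun x _ => Nat.zero_le x) _
      (Multiset.mem_map_of_mem (fun j => trunc m (a j)) hj)
  unfold trunc at h2
  have := hcon.2
  omega

/-- If the negative values are negligible and the truncated means are bounded, the truncation is
asymptotically harmless. -/
lemma exists_prob_addVal_ne_truncVal_le {θ : ℝ} (hθ : 1 ≤ θ) {a : ℕ → ℕ → ℤ}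
    (h : NegativePartNegligible θ a) {C : ℝ} {m₁ : ℕ} (hC : ∀ m ≥ m₁, ∀ᶠ n in atTop,
      mean θ n (fun s => ((truncVal m (a n) s).descFactorial 1 : ℝ)) ≤ C) {ε : ℝ} (hε : 0 < ε) :
    ∃ m₀ : ℕ, ∀ m ≥ m₀, ∀ᶠ n in atTop,
      prob θ n (fun s => addVal (a n) s ≠ truncVal m (a n) s) ≤ ε := by
  obtain ⟨m₂, hm₂⟩ := exists_nat_gt (2 * C / ε)
  refine ⟨max m₁ (max m₂ 1), fun m hm => ?_⟩
  simp only [ge_iff_le, max_le_iff] at hm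
  have hm0 : (0 : ℝ) < m := by exact_mod_cast hm.2.2
  filter_upwards [hC m hm.1, (h.tendsto_prob hθ).eventually_le_const (half_pos hε)] with n h1 h2
  refine (prob_addVal_ne_truncVal_le hθ (a n) n hm.2.2).trans ?_
  have h3 : mean θ n (fun s => ((truncVal m (a n) s).descFactorial 1 : ℝ)) / m ≤ ε / 2 := by
    rw [div_le_iff₀ hm0]
    have h4 : 2 * C / ε ≤ m := hm₂.le.trans (by exact_mod_cast hm.2.1)
    rw [div_le_iff₀ hε] at h4
    linarith
  linarith

lemma abs_prob_sub_prob_le {θ : ℝ} (hθ : 1 ≤ θ) (n : ℕ) (P Q R : Multiset ℕ → Prop)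
    (h : ∀ s, ¬ R s → (P s ↔ Q s)) : |prob θ n P - prob θ n Q| ≤ prob θ n R := by
  have key : ∀ P Q : Multiset ℕ → Prop, (∀ s, ¬ R s → (P s ↔ Q s)) →
      prob θ n P ≤ prob θ n Q + prob θ n R := fun P Q h =>
    (prob_mono hθ fun p hp => by
      by_cases hR : R p.parts
      · exact Or.inr hR
      · exact Or.inl ((h _ hR).1 hp)).trans (prob_or_le hθ Q R)
  have h1 := key P Q h
  have h2 := key Q P fun s hs => (h s hs).symm
  rw [abs_le]
  constructor <;> linarith

/-- Bonferroni's inequality in terms of factorial moments. -/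
lemma abs_indicator_sub_le (x k M : ℕ) :
    |(if x = k then (1 : ℝ) else 0) - ∑ i ∈ Finset.range M,
      (-1) ^ i * (1 / (k.factorial * i.factorial) : ℝ) * (x.descFactorial (k + i) : ℝ)| ≤
      1 / (k.factorial * M.factorial) * (x.descFactorial (k + M) : ℝ) := by
  -- After this rewriting the sum is C(x,k) times a truncated alternating sum of the binomials of
  -- x-k, which for x > k equals ± C(x-k-1, M-1) when M ≥ 1.
  have hterm : ∀ i, (1 / (k.factorial * i.factorial) : ℝ) * (x.descFactorial (k + i) : ℝ) =
      x.choose k * (x - k).choose i := by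
    intro i
    have h1 := Nat.descFactorial_mul_descFactorial (n := x) (Nat.le_add_right k i)
    rw [Nat.add_sub_cancel_left, Nat.descFactorial_eq_factorial_mul_choose,
      Nat.descFactorial_eq_factorial_mul_choose] at h1
    rw [← h1]
    push_cast
    have hk : (k.factorial : ℝ) ≠ 0 := by positivity
    have hi : (i.factorial : ℝ) ≠ 0 := by positivity
    field_simp
  simp_rw [mul_assoc, hterm]
  rcases lt_trichotomy x k with h | h | h
  · rw [if_neg h.ne, Nat.choose_eq_zero_of_lt h]
    simp
  · subst h
    rw [if_pos rfl]
    rcases M with _ | M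
    · simp
    · rw [Finset.sum_range_succ']
      simp
  · rw [if_neg h.ne']
    obtain ⟨y, rfl⟩ : ∃ y, x = k + (y + 1) := ⟨x - k - 1, by omega⟩
    rw [Nat.add_sub_cancel_left]
    have h2 : ∑ i ∈ Finset.range M, (-1 : ℝ) ^ i * (((k + (y + 1)).choose k : ℝ) *
        ((y + 1).choose i : ℝ)) = (k + (y + 1)).choose k *
          ∑ i ∈ Finset.range M, (-1 : ℝ) ^ i * ((y + 1).choose i : ℝ) := by
      rw [Finset.mul_sum]
      exact Finset.sum_congr rfl fun i _ => by ring
    rw [h2, zero_sub, abs_neg, abs_mul, Nat.abs_cast]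
    refine mul_le_mul_of_nonneg_left ?_ (Nat.cast_nonneg _)
    rcases M with _ | M
    · simp
    · have h3 : ∑ i ∈ Finset.range (M + 1), (-1 : ℝ) ^ i * ((y + 1).choose i : ℝ) =
          (-1) ^ M * (y.choose M : ℝ) := by
        have := Int.alternating_sum_range_choose_eq_choose (n := y) (m := M)
        exact_mod_cast this
      rw [h3, abs_mul, abs_pow, abs_neg, abs_one, one_pow, one_mul, Nat.abs_cast,
        Nat.choose_succ_succ]
      exact_mod_cast Nat.le_add_right _ _

lemma tendsto_poissonMass (μ : NNReal) (k : ℕ) :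
    Tendsto (fun M => ∑ i ∈ Finset.range M,
      (-1) ^ i * (1 / (k.factorial * i.factorial) : ℝ) * (μ : ℝ) ^ (k + i)) atTop
      (𝓝 (poissonMass μ k)) := by
  have h := (NormedSpace.expSeries_div_hasSum_exp (𝔸 := ℝ) (-(μ : ℝ))).mul_left
    ((μ : ℝ) ^ k / k.factorial)
  rw [← Real.exp_eq_exp_ℝ] at h
  have h2 := h.tendsto_sum_nat
  unfold poissonMass
  convert h2 using 2
  · refine Finset.sum_congr rfl fun i _ => ?_
    rw [neg_pow (μ : ℝ), pow_add]
    have hk : (k.factorial : ℝ) ≠ 0 := by positivity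
    have hi : (i.factorial : ℝ) ≠ 0 := by positivity
    field_simp
  · ring

/-- The method of factorial moments for a single Ewens distribution. -/
lemma abs_prob_sub_le {θ : ℝ} (hθ : 1 ≤ θ) (n k M : ℕ) (H : Multiset ℕ → ℕ) (x δ : ℝ)
    (hδ : ∀ i ≤ M, |mean θ n (fun s => ((H s).descFactorial (k + i) : ℝ)) - x ^ (k + i)| ≤ δ) :
    |prob θ n (fun s => H s = k) - ∑ i ∈ Finset.range M,
      (-1) ^ i * (1 / (k.factorial * i.factorial) : ℝ) * x ^ (k + i)| ≤
      (∑ i ∈ Finset.range (M + 1), (1 / (k.factorial * i.factorial) : ℝ)) * δ +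
        1 / (k.factorial * M.factorial) * x ^ (k + M) := by
  set w : ℕ → ℝ := fun i => 1 / (k.factorial * i.factorial) with hw
  have hw0 : ∀ i, 0 ≤ w i := fun i => by positivity
  set E : ℕ → ℝ := fun i => mean θ n fun s => ((H s).descFactorial (k + i) : ℝ) with hE
  have h1 : |prob θ n (fun s => H s = k) - ∑ i ∈ Finset.range M, (-1) ^ i * w i * E i| ≤
      w M * E M := by
    have e : prob θ n (fun s => H s = k) - ∑ i ∈ Finset.range M, (-1) ^ i * w i * E i =
        mean θ n fun s => (if H s = k then (1 : ℝ) else 0) - ∑ i ∈ Finset.range M,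
          (-1) ^ i * w i * ((H s).descFactorial (k + i) : ℝ) := by
      rw [mean_sub, mean_sum]
      simp_rw [mean_mul_left]
      congr 1
      unfold prob
      congr 1
      funext s
      congr
    rw [e]
    refine (abs_mean_le hθ _).trans ?_
    rw [hE, ← mean_mul_left]
    exact mean_mono hθ fun p => abs_indicator_sub_le _ _ _
  have h2 : |∑ i ∈ Finset.range M, (-1) ^ i * w i * E i -
      ∑ i ∈ Finset.range M, (-1) ^ i * w i * x ^ (k + i)| ≤ ∑ i ∈ Finset.range M, w i * δ := by
    rw [← Finset.sum_sub_distrib]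
    refine (Finset.abs_sum_le_sum_abs _ _).trans (Finset.sum_le_sum fun i hi => ?_)
    rw [← mul_sub, abs_mul, abs_mul, abs_pow, abs_neg, abs_one, one_pow, one_mul,
      abs_of_nonneg (hw0 i)]
    exact mul_le_mul_of_nonneg_left (hδ i (Finset.mem_range.1 hi).le) (hw0 i)
  have h3 : w M * E M ≤ w M * δ + w M * x ^ (k + M) := by
    rw [← mul_add]
    refine mul_le_mul_of_nonneg_left ?_ (hw0 M)
    have := (abs_le.1 (hδ M le_rfl)).2
    linarith
  rw [Finset.sum_range_succ, add_mul, Finset.sum_mul]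
  refine (abs_sub_le _ (∑ i ∈ Finset.range M, (-1) ^ i * w i * E i) _).trans ?_
  linarith

/-- The truncated factorial moments are close to those of the Poisson distribution as soon as the
quantities `Upsilon` are. -/
lemma isErrorTerm_Upsilon_iff {θ : ℝ} (hθ : 1 ≤ θ) (a : ℕ → ℕ → ℤ) {l : ℕ} (hl : 1 ≤ l) (x : ℝ) :
    IsErrorTerm (fun n m => Upsilon θ a n l m - x) ↔ ∀ ε : ℝ, 0 < ε → ∃ m₀ : ℕ, ∀ m ≥ m₀,
      ∀ᶠ n in atTop, |mean θ n (fun s => ((truncVal m (a n) s).descFactorial l : ℝ)) - x| ≤ ε := by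
  have key : ∀ {ε : ℝ}, 0 < ε → ∀ m, ∀ᶠ n in atTop,
      |mean θ n (fun s => ((truncVal m (a n) s).descFactorial l : ℝ)) - Upsilon θ a n l m| ≤ ε := by
    intro ε hε m
    have h := (tendsto_mean_sub_Upsilon hθ a m hl).abs
    rw [abs_zero] at h
    exact h.eventually_le_const hε
  rw [isErrorTerm_iff]
  constructor
  · intro h ε hε
    obtain ⟨m₀, hm₀⟩ := h (ε / 2) (half_pos hε)
    refine ⟨m₀, fun m hm => ?_⟩
    filter_upwards [hm₀ m hm, key (half_pos hε) m] with n h1 h2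
    refine (abs_sub_le _ (Upsilon θ a n l m) _).trans ?_
    linarith
  · intro h ε hε
    obtain ⟨m₀, hm₀⟩ := h (ε / 2) (half_pos hε)
    refine ⟨m₀, fun m hm => ?_⟩
    filter_upwards [hm₀ m hm, key (half_pos hε) m] with n h1 h2
    rw [abs_sub_comm] at h2
    refine (abs_sub_le _ (mean θ n (fun s => ((truncVal m (a n) s).descFactorial l : ℝ))) _).trans ?_
    linarith

/-- The sufficiency of the conditions for the Poisson limit. -/
lemma poissonLimit_of_isErrorTerm {θ : ℝ} (hθ : 1 ≤ θ) {a : ℕ → ℕ → ℤ} {μ : NNReal}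
    (hneg : NegativePartNegligible θ a)
    (hU : ∀ l : ℕ, 1 ≤ l → IsErrorTerm fun n m => Upsilon θ a n l m - (μ : ℝ) ^ l) :
    PoissonLimit θ a μ := by
  refine ⟨squeeze_zero (fun n => prob_nonneg hθ _) (fun n => prob_mono hθ fun p hp => ?_)
    (hneg.tendsto_prob hθ), fun k => ?_⟩
  · by_contra hcon
    push Not at hcon
    refine absurd hp (not_lt.2 (Multiset.sum_nonneg fun x hx => ?_))
    obtain ⟨j, hj, rfl⟩ := Multiset.mem_map.1 hx
    have := hcon j hj
    omega
  · have hmom : ∀ l : ℕ, ∀ ε : ℝ, 0 < ε → ∃ m₀ : ℕ, ∀ m ≥ m₀, ∀ᶠ n in atTop,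
        |mean θ n (fun s => ((truncVal m (a n) s).descFactorial l : ℝ)) - (μ : ℝ) ^ l| ≤ ε := by
      intro l ε hε
      rcases l with _ | l
      · refine ⟨0, fun m _ => .of_forall fun n => ?_⟩
        simp only [Nat.descFactorial_zero, Nat.cast_one, mean_const hθ, pow_zero, sub_self,
          abs_zero, hε.le]
      · exact (isErrorTerm_Upsilon_iff hθ a (Nat.succ_pos l) _).1 (hU _ (Nat.succ_pos l)) ε hε
    rw [Metric.tendsto_nhds]
    intro ε hε
    have hlast : Tendsto (fun M => (1 / (k.factorial * M.factorial) : ℝ) * (μ : ℝ) ^ (k + M)) atTop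
        (𝓝 0) := by
      have := (FloorSemiring.tendsto_pow_div_factorial_atTop (μ : ℝ)).const_mul
        ((μ : ℝ) ^ k / k.factorial)
      rw [mul_zero] at this
      refine this.congr fun M => ?_
      rw [pow_add]
      have hk : (k.factorial : ℝ) ≠ 0 := by positivity
      have hi : (M.factorial : ℝ) ≠ 0 := by positivity
      field_simp
    have hser := (tendsto_iff_dist_tendsto_zero.1 (tendsto_poissonMass μ k)).eventually_le_const
      (show 0 < ε / 8 by positivity)
    -- The order of the choices matters: M from the Poisson series, δ from M, one truncation level m
    -- serving all moments up to k+M, and n last.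
    obtain ⟨M, hM1, hM2⟩ := (hser.and (hlast.eventually_le_const
      (show 0 < ε / 8 by positivity))).exists
    set B := ∑ i ∈ Finset.range (M + 1), (1 / (k.factorial * i.factorial) : ℝ) with hB
    have hB0 : 0 ≤ B := Finset.sum_nonneg fun i _ => by positivity
    set δ := ε / (8 * (B + 1)) with hδ
    have hδ0 : 0 < δ := by positivity
    have hBδ : B * δ ≤ ε / 8 := by
      rw [hδ, mul_div_assoc', div_le_div_iff₀ (by positivity) (by norm_num)]
      nlinarith
    choose m₀ hm₀ using fun i => hmom (k + i) δ hδ0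
    obtain ⟨m₁, hm₁⟩ := hmom 1 1 one_pos
    obtain ⟨m₂, hm₂⟩ := exists_prob_addVal_ne_truncVal_le hθ hneg (C := μ + 1) (m₁ := m₁)
      (fun m hm => by
        filter_upwards [hm₁ m hm] with n hn
        have := (abs_le.1 hn).2
        rw [pow_one] at this
        linarith) (show 0 < ε / 8 by positivity)
    set m := m₂ + ∑ i ∈ Finset.range (M + 1), m₀ i with hm
    have h1 : ∀ᶠ n in atTop, ∀ i ∈ Finset.range (M + 1),
        |mean θ n (fun s => ((truncVal m (a n) s).descFactorial (k + i) : ℝ)) -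
          (μ : ℝ) ^ (k + i)| ≤ δ := by
      rw [Filter.eventually_all_finset]
      intro i hi
      refine hm₀ i m ?_
      have := Finset.single_le_sum (f := m₀) (fun _ _ => Nat.zero_le _) hi
      omega
    filter_upwards [h1, hm₂ m (by omega)] with n hn1 hn2
    have h2 := abs_prob_sub_le hθ n k M (truncVal m (a n)) μ δ fun i hi =>
      hn1 i (Finset.mem_range.2 (by omega))
    have h3 := abs_prob_sub_prob_le hθ n (fun s => addVal (a n) s = k)
      (fun s => truncVal m (a n) s = k) (fun s => addVal (a n) s ≠ truncVal m (a n) s) fun s hs => by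
        rw [not_not.1 hs]
        exact Nat.cast_inj
    rw [Real.dist_eq] at hM1 ⊢
    have h4 := abs_sub_le (prob θ n fun s => addVal (a n) s = k)
      (prob θ n fun s => truncVal m (a n) s = k) (poissonMass μ k)
    have h5 := abs_sub_le (prob θ n fun s => truncVal m (a n) s = k) (∑ i ∈ Finset.range M,
      (-1) ^ i * (1 / (k.factorial * i.factorial) : ℝ) * (μ : ℝ) ^ (k + i)) (poissonMass μ k)
    linarith

/-! ### Necessity of the conditions. -/

-- A part j contributes only when it alone has a nonzero coefficient, and then h = a_j. Hence at
-- most one summand survives.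
open Classical in
lemma sum_map_single_nonzero_le (a : ℕ → ℤ) {g : ℤ → ℝ} (hg : ∀ x, 0 ≤ g x) (hg0 : g 0 = 0)
    (s : Multiset ℕ) :
    (s.map fun j : ℕ => g (a j) * if ∀ i ∈ s.erase j, a i = 0 then (1 : ℝ) else 0).sum ≤
      g (addVal a s) := by
  by_cases h : ∃ j ∈ s, a j ≠ 0 ∧ ∀ i ∈ s.erase j, a i = 0
  · obtain ⟨j, hj, -, hs⟩ := h
    have hs' : s = j ::ₘ s.erase j := (Multiset.cons_erase hj).symm
    have h1 : ((s.erase j).map fun j' : ℕ =>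
        g (a j') * if ∀ i ∈ s.erase j', a i = 0 then (1 : ℝ) else 0).sum = 0 := by
      refine Multiset.sum_eq_zero fun x hx => ?_
      obtain ⟨i, hi, rfl⟩ := Multiset.mem_map.1 hx
      rw [hs i hi, hg0, zero_mul]
    have h2 : addVal a s = a j := by
      conv_lhs => rw [hs']
      unfold addVal
      rw [Multiset.map_cons, Multiset.sum_cons, Multiset.sum_eq_zero, add_zero]
      intro x hx
      obtain ⟨i, hi, rfl⟩ := Multiset.mem_map.1 hx
      exact hs i hi
    rw [h2]
    calc _ = ((j ::ₘ s.erase j).map fun j' : ℕ =>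
          g (a j') * if ∀ i ∈ s.erase j', a i = 0 then (1 : ℝ) else 0).sum := by rw [← hs']
      _ ≤ _ := by rw [Multiset.map_cons, Multiset.sum_cons, h1, if_pos hs, mul_one, add_zero]
  · rw [Multiset.sum_eq_zero]
    · exact hg _
    · intro x hx
      obtain ⟨j, hj, rfl⟩ := Multiset.mem_map.1 hx
      by_cases hz : a j = 0
      · rw [hz, hg0, zero_mul]
      · rw [if_neg fun hs => h ⟨j, hj, hz, hs⟩, mul_zero]

/-- The mean is restricted to the permutations with a single cycle of nonzero coefficient; the
remaining n-j points carry only cycles with coefficient zero, and the sieve bounds their weight from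
below. -/
lemma sum_map_mul_multSum_le {θ : ℝ} (hθ : 1 ≤ θ) (n : ℕ) (a : ℕ → ℤ) {g : ℤ → ℝ}
    (hg : ∀ x, 0 ≤ g x) (hg0 : g 0 = 0) :
    ∑ j ∈ Finset.Icc 1 n, θ / j * g (a j) *
      (multSum θ (fun i => if a i = 0 then (1 : ℝ) else 0) (n - j) / binomCoeff θ n) ≤
      mean θ n fun s => g (addVal a s) := by
  classical
  have h := partitionSum_marked θ n fun j s => g (a j) * if ∀ i ∈ s, a i = 0 then (1 : ℝ) else 0
  have h1 : ∑ j ∈ Finset.Icc 1 n, θ / j * g (a j) *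
      (multSum θ (fun i => if a i = 0 then (1 : ℝ) else 0) (n - j) / binomCoeff θ n) =
      mean θ n fun s => (s.map fun j : ℕ =>
        g (a j) * if ∀ i ∈ s.erase j, a i = 0 then (1 : ℝ) else 0).sum := by
    rw [mean, h, Finset.sum_div]
    refine Finset.sum_congr rfl fun j _ => ?_
    have h2 := partitionSum_smul θ (n - j) (g (a j)) fun s =>
      if ∀ i ∈ s, a i = 0 then (1 : ℝ) else 0
    simp only [smul_eq_mul] at h2 ⊢
    rw [h2, multSum_indicator]
    ring
  rw [h1]
  exact mean_mono hθ fun p => sum_map_single_nonzero_le a hg hg0 _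

/-- In the case of a Poisson limit, the expectation of a bounded function of the additive function
controls the corresponding sum over the cycle lengths. -/
lemma PoissonLimit.exists_mul_sum_le {θ : ℝ} (hθ : 1 ≤ θ) {a : ℕ → ℕ → ℤ} {μ : NNReal}
    (h : PoissonLimit θ a μ) :
    ∃ c : ℝ, 0 < c ∧ ∀ (g : ℤ → ℝ) (G : ℝ), (∀ x, 0 ≤ g x) → g 0 = 0 → (∀ x, g x ≤ G) →
      ∀ ε : ℝ, 0 < ε → ∀ᶠ n in atTop, c * ∑ j ∈ Finset.Icc 1 n,
        θ / j * g (a n j) * (binomCoeff θ (n - j) / binomCoeff θ n) ≤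
        mean θ n (fun s => g (addVal (a n) s)) + ε := by
  classical
  have hθ0 : 0 ≤ θ := by linarith
  obtain ⟨C, hC⟩ := h.sum_ne_zero_le hθ
  obtain ⟨c, hc0, N₀, hc⟩ := exists_le_multSum hθ C
  refine ⟨c, hc0, fun g G hg hg0 hG ε hε => ?_⟩
  have hG0 : 0 ≤ G := (hg 0).trans (hG 0)
  have hlim := tendsto_const_div_atTop_nhds_zero_nat (N₀ * (2 * (c * θ * G)))
  filter_upwards [hC, hlim.eventually_le_const hε, eventually_ge_atTop (2 * N₀ + 1)]
    with n hn1 hn2 hn3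
  have hn0 : (0 : ℝ) < n := by
    have : 0 < n := by omega
    exact_mod_cast this
  have hpn := binomCoeff_pos hθ n
  set f : ℕ → ℝ := fun i => if a n i = 0 then 1 else 0 with hf
  have hf01 : ∀ i, 0 ≤ f i ∧ f i ≤ 1 := fun i => by
    rw [hf]
    beta_reduce
    split_ifs <;> norm_num
  have hsieve : ∀ j, N₀ ≤ n - j → c * binomCoeff θ (n - j) ≤ multSum θ f (n - j) := by
    intro j hj
    refine hc _ hj f hf01 (le_trans ?_ hn1)
    rw [Finset.sum_filter]
    refine (Finset.sum_le_sum fun i _ => ?_).trans (Finset.sum_le_sum_of_subset_of_nonneg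
      (Finset.Icc_subset_Icc_right (Nat.sub_le n j)) fun i _ _ => ?_)
    · rw [hf]
      by_cases hi : a n i = 0 <;> simp [hi]
    · split_ifs <;> positivity
  have hterm : ∀ j ∈ Finset.Icc 1 n,
      c * (θ / j * g (a n j) * (binomCoeff θ (n - j) / binomCoeff θ n)) ≤
      θ / j * g (a n j) * (multSum θ f (n - j) / binomCoeff θ n) +
        if n - j < N₀ then 2 * (c * θ * G) / n else 0 := by
    intro j hj
    rw [Finset.mem_Icc] at hj
    have hj0 : (0 : ℝ) < j := by exact_mod_cast hj.1
    have hgj := hg (a n j)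
    have hw : 0 ≤ θ / j * g (a n j) / binomCoeff θ n := by positivity
    -- Here the sieve is not available, but j ≥ n/2, so these at most N₀ terms are O(1/n) each; this
    -- uses that g is bounded.
    by_cases hN : n - j < N₀
    · rw [if_pos hN]
      have h1 : 0 ≤ multSum θ f (n - j) := multSum_nonneg hθ0 (fun i => (hf01 i).1) _
      have h2 : 0 ≤ θ / j * g (a n j) * (multSum θ f (n - j) / binomCoeff θ n) := by positivity
      have h3 : binomCoeff θ (n - j) / binomCoeff θ n ≤ 1 := by
        rw [div_le_one hpn]
        exact binomCoeff_mono hθ (Nat.sub_le n j)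
      have h4 : (n : ℝ) ≤ 2 * j := by
        have : n ≤ 2 * j := by omega
        exact_mod_cast this
      have h5 : c * (θ / j * g (a n j) * (binomCoeff θ (n - j) / binomCoeff θ n)) ≤
          c * (θ / j * G * 1) := by
        have := hG (a n j)
        have hq : 0 ≤ binomCoeff θ (n - j) / binomCoeff θ n :=
          div_nonneg (binomCoeff_pos hθ _).le hpn.le
        gcongr
      have h6 : c * (θ / j * G * 1) ≤ 2 * (c * θ * G) / n := by
        rw [le_div_iff₀ hn0]
        calc c * (θ / j * G * 1) * n ≤ c * (θ / j * G * 1) * (2 * j) := by gcongr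
          _ = _ := by field_simp
      linarith
    · rw [if_neg hN, add_zero]
      calc _ = θ / j * g (a n j) / binomCoeff θ n * (c * binomCoeff θ (n - j)) := by ring
        _ ≤ θ / j * g (a n j) / binomCoeff θ n * multSum θ f (n - j) :=
          mul_le_mul_of_nonneg_left (hsieve j (by omega)) hw
        _ = _ := by ring
  rw [Finset.mul_sum]
  refine (Finset.sum_le_sum hterm).trans ?_
  rw [Finset.sum_add_distrib,
    sum_Icc_sub n fun k => if k < N₀ then 2 * (c * θ * G) / (n : ℝ) else 0, ← Finset.sum_filter,
    Finset.sum_const, nsmul_eq_mul]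
  refine add_le_add (sum_map_mul_multSum_le hθ n (a n) hg hg0) (le_trans ?_ hn2)
  rw [mul_div_assoc (N₀ : ℝ)]
  refine mul_le_mul_of_nonneg_right ?_ (by positivity)
  have : (Finset.range n).filter (fun k => k < N₀) ⊆ Finset.range N₀ := fun k hk =>
    Finset.mem_range.2 (Finset.mem_filter.1 hk).2
  have := Finset.card_le_card this
  rw [Finset.card_range] at this
  exact_mod_cast this

/-- Apply `PoissonLimit.exists_mul_sum_le` to the indicator of the negative integers: its mean tends
to 0, and the weights in the condition are dominated by (θ/j) p_(n-j)/p_n. -/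
lemma PoissonLimit.negativePartNegligible {θ : ℝ} (hθ : 1 ≤ θ) {a : ℕ → ℕ → ℤ} {μ : NNReal}
    (h : PoissonLimit θ a μ) : NegativePartNegligible θ a := by
  classical
  obtain ⟨c, hc0, hc⟩ := h.exists_mul_sum_le hθ
  have hnonneg : ∀ n : ℕ, ∀ j ∈ Finset.Ico 1 n,
      0 ≤ (1 / (j : ℝ)) * (1 - (j : ℝ) / n) ^ (θ - 1) := by
    intro n j hj
    have : (j : ℝ) / n ≤ 1 :=
      div_le_one_of_le₀ (by exact_mod_cast (Finset.mem_Ico.1 hj).2.le) (Nat.cast_nonneg n)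
    exact mul_nonneg (one_div_nonneg.2 (Nat.cast_nonneg j)) (Real.rpow_nonneg (by linarith) _)
  unfold NegativePartNegligible
  rw [Metric.tendsto_nhds]
  intro ε hε
  have h1 := hc (fun x => if x < 0 then 1 else 0) 1 (fun x => by split_ifs <;> norm_num) (by simp)
    (fun x => by split_ifs <;> norm_num) (c * ε / 4) (by positivity)
  filter_upwards [h1, h.1.eventually_le_const (show 0 < c * ε / 4 by positivity)] with n hn1 hn2
  have h2 : prob θ n (fun s => addVal (a n) s < 0) =
      mean θ n fun s => if addVal (a n) s < 0 then (1 : ℝ) else 0 := by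
    unfold prob
    congr
    funext s
    congr
  rw [h2] at hn2
  rw [Real.dist_0_eq_abs, abs_of_nonneg (Finset.sum_nonneg fun j hj =>
    hnonneg n j (Finset.mem_filter.1 hj).1)]
  have h3 : ∑ j ∈ Finset.Ico 1 n with a n j ≤ -1, 1 / (j : ℝ) * (1 - (j : ℝ) / n) ^ (θ - 1) ≤
      ∑ j ∈ Finset.Icc 1 n, θ / j * (if a n j < 0 then 1 else 0) *
        (binomCoeff θ (n - j) / binomCoeff θ n) := by
    rw [Finset.sum_filter]
    refine (Finset.sum_le_sum fun j hj => ?_).trans (Finset.sum_le_sum_of_subset_of_nonneg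
      Finset.Ico_subset_Icc_self fun j _ _ => ?_)
    · by_cases hj' : a n j ≤ -1
      · rw [if_pos hj', if_pos (by omega), mul_one]
        have h4 := rpow_le_binomCoeff_ratio hθ (Finset.mem_Ico.1 hj).2
        have h5 : (1 / (j : ℝ)) ≤ θ / j := by gcongr
        have h6 := div_pos (binomCoeff_pos hθ (n - j)) (binomCoeff_pos hθ n)
        calc _ ≤ 1 / (j : ℝ) * (binomCoeff θ (n - j) / binomCoeff θ n) := by gcongr
          _ ≤ _ := by gcongr
      · rw [if_neg hj', if_neg (by omega)]
        simp
    · have h6 := div_pos (binomCoeff_pos hθ (n - j)) (binomCoeff_pos hθ n)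
      split_ifs <;> positivity
  have h7 : c * (ε / 2) < c * ε := by nlinarith
  have h8 := mul_le_mul_of_nonneg_left h3 hc0.le
  exact lt_of_mul_lt_mul_left (by linarith) hc0.le

lemma hasSum_descFactorial_mul_poissonMass (μ : NNReal) (r : ℕ) :
    HasSum (fun k => (k.descFactorial r : ℝ) * poissonMass μ k) ((μ : ℝ) ^ r) := by
  have h := (hasSum_poissonMass μ).mul_left ((μ : ℝ) ^ r)
  have h1 : (fun k => ((k + r).descFactorial r : ℝ) * poissonMass μ (k + r)) =
      fun k => (μ : ℝ) ^ r * poissonMass μ k := by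
    funext k
    have h2 := Nat.factorial_mul_descFactorial (Nat.le_add_left r k)
    rw [Nat.add_sub_cancel] at h2
    unfold poissonMass
    rw [← h2, pow_add]
    have h3 : (k.factorial : ℝ) ≠ 0 := by positivity
    have h4 : ((k + r).descFactorial r : ℝ) ≠ 0 := by
      rw [Nat.cast_ne_zero, Ne, Nat.descFactorial_eq_zero_iff_lt]
      omega
    push_cast
    field_simp
  rw [← h1, mul_one,
    hasSum_nat_add_iff (f := fun k => (k.descFactorial r : ℝ) * poissonMass μ k) r] at h
  rwa [Finset.sum_eq_zero, add_zero] at h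
  intro k hk
  rw [Nat.descFactorial_of_lt (Finset.mem_range.1 hk)]
  simp

/-- Upper bounds of expectations of bounded functions in the case of a Poisson limit. -/
lemma PoissonLimit.mean_le {θ : ℝ} (hθ : 1 ≤ θ) {a : ℕ → ℕ → ℤ} {μ : NNReal}
    (h : PoissonLimit θ a μ) {g : ℤ → ℝ} {G S : ℝ} {f : ℕ → ℝ} (hg : ∀ x, 0 ≤ g x)
    (hG : ∀ x, g x ≤ G) (hf : ∀ k, 0 ≤ f k) (hgf : ∀ k : ℕ, g k ≤ f k)
    (hS : HasSum (fun k => f k * poissonMass μ k) S) {ε : ℝ} (hε : 0 < ε) :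
    ∀ᶠ n in atTop, mean θ n (fun s => g (addVal (a n) s)) ≤ S + ε := by
  have hG0 : 0 ≤ G := (hg 0).trans (hG 0)
  obtain ⟨K, hK⟩ := h.uniform hθ (show 0 < ε / (2 * (G + 1)) by positivity)
  filter_upwards [(hK K le_rfl).2] with n hn
  have hGε : G * (ε / (2 * (G + 1))) ≤ ε / 2 := by
    rw [mul_div_assoc', div_le_div_iff₀ (by positivity) (by norm_num)]
    nlinarith
  have h1 : mean θ n (fun s => g (addVal (a n) s)) ≤
      G * prob θ n (fun s => ¬ (0 ≤ addVal (a n) s ∧ addVal (a n) s < K)) +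
        ∑ k ∈ Finset.range K, g k * prob θ n fun s => addVal (a n) s = k := by
    unfold prob
    simp_rw [← mean_mul_left]
    rw [← mean_sum, ← mean_add]
    refine mean_mono hθ fun p => ?_
    beta_reduce
    generalize addVal (a n) p.parts = x
    have h0 : ∀ k ∈ Finset.range K,
        0 ≤ g k * @ite ℝ (x = (k : ℤ)) (Classical.propDecidable _) 1 0 := fun k _ =>
      mul_nonneg (hg k) (by split_ifs <;> norm_num)
    by_cases hx : 0 ≤ x ∧ x < K
    · lift x to ℕ using hx.1
      have h2 := Finset.single_le_sum h0 (Finset.mem_range.2 (by exact_mod_cast hx.2 : x < K))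
      rw [if_pos rfl, mul_one] at h2
      rw [if_neg (not_not.2 hx), mul_zero, zero_add]
      exact h2
    · rw [if_pos hx, mul_one]
      have := Finset.sum_nonneg h0
      have := hG x
      linarith
  have h3 : ∑ k ∈ Finset.range K, g k * prob θ n (fun s => addVal (a n) s = k) ≤
      ∑ k ∈ Finset.range K, f k * poissonMass μ k + G * ∑ k ∈ Finset.range K,
        |prob θ n (fun s => addVal (a n) s = k) - poissonMass μ k| := by
    rw [Finset.mul_sum, ← Finset.sum_add_distrib]
    refine Finset.sum_le_sum fun k _ => ?_
    have e1 := mul_le_mul_of_nonneg_right (hgf k) (poissonMass_nonneg μ k)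
    have e2 := mul_le_mul_of_nonneg_left
      (le_abs_self (prob θ n (fun s => addVal (a n) s = k) - poissonMass μ k)) (hg k)
    have e3 := mul_le_mul_of_nonneg_right (hG k)
      (abs_nonneg (prob θ n (fun s => addVal (a n) s = k) - poissonMass μ k))
    rw [mul_sub] at e2
    linarith
  have h4 := sum_le_hasSum (Finset.range K)
    (fun k _ => mul_nonneg (hf k) (poissonMass_nonneg μ k)) hS
  have h5 := mul_le_mul_of_nonneg_left hn.1 hG0
  have h6 := mul_le_mul_of_nonneg_left hn.2 hG0
  linarith

/-- The factorial moments of the truncations are bounded uniformly in the level. -/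
lemma PoissonLimit.exists_mean_truncVal_le {θ : ℝ} (hθ : 1 ≤ θ) {a : ℕ → ℕ → ℤ} {μ : NNReal}
    (h : PoissonLimit θ a μ) (l : ℕ) : ∃ C : ℝ, 0 ≤ C ∧ ∀ m, ∀ᶠ n in atTop,
      mean θ n (fun s => ((truncVal m (a n) s).descFactorial l : ℝ)) ≤ C := by
  obtain ⟨c, hc0, hc⟩ := h.exists_mul_sum_le hθ
  -- The limiting bound μ^r is free of m because (min(k,m))_r ≤ (k)_r, so C is uniform in m; only
  -- the threshold for n depends on m. The summand 2 absorbs two errors equal to 1.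
  obtain ⟨C, hC0, hC⟩ := exists_mean_descFactorial_le hθ (fun r => ((μ : ℝ) ^ r + 2) / c) l
  refine ⟨C, hC0, fun m => ?_⟩
  have h1 : ∀ᶠ n in atTop, ∀ r ∈ Finset.Icc 1 l, ∑ j ∈ Finset.Icc 1 n,
      θ / j * ((trunc m (a n j)).descFactorial r : ℝ) * (binomCoeff θ (n - j) / binomCoeff θ n) ≤
        ((μ : ℝ) ^ r + 2) / c := by
    rw [Filter.eventually_all_finset]
    intro r hr
    have hG : ∀ x, ((trunc m x).descFactorial r : ℝ) ≤ (m : ℝ) ^ r := fun x => by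
      have := (Nat.descFactorial_le_pow (trunc m x) r).trans (Nat.pow_le_pow_left (trunc_le m x) r)
      exact_mod_cast this
    have hr0 : (0 : ℕ).descFactorial r = 0 := Nat.descFactorial_of_lt (Finset.mem_Icc.1 hr).1
    filter_upwards [hc (fun x => ((trunc m x).descFactorial r : ℝ)) ((m : ℝ) ^ r)
      (fun x => Nat.cast_nonneg _) (by simp [trunc, hr0]) hG 1 one_pos,
      h.mean_le hθ (g := fun x => ((trunc m x).descFactorial r : ℝ)) (fun x => Nat.cast_nonneg _) hG
        (fun k => Nat.cast_nonneg (k.descFactorial r))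
        (fun k => by
          have : (trunc m k).descFactorial r ≤ k.descFactorial r :=
            Nat.descFactorial_le r (by simp [trunc])
          exact_mod_cast this)
        (hasSum_descFactorial_mul_poissonMass μ r) one_pos] with n h1 h2
    rw [le_div_iff₀ hc0, mul_comm]
    linarith
  filter_upwards [h1] with n hn
  exact hC n (fun j => trunc m (a n j)) (fun r hr1 hr2 => hn r (Finset.mem_Icc.2 ⟨hr1, hr2⟩)) n
    le_rfl

/-- For x ≥ l+J one has (x)_(l+1) = (x-l)(x)_l ≥ J (x)_l. Thus a bound on the next factorial moment
supplies the uniform integrability needed for the l-th one. -/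
lemma abs_descFactorial_sub_le (x l J : ℕ) (hJ : 1 ≤ J) :
    |(x.descFactorial l : ℝ) - ∑ k ∈ Finset.range (l + J),
      (k.descFactorial l : ℝ) * (if x = k then 1 else 0)| ≤
      1 / J * (x.descFactorial (l + 1) : ℝ) := by
  have hJ0 : (0 : ℝ) < J := by exact_mod_cast hJ
  simp only [mul_ite, mul_one, mul_zero, Finset.sum_ite_eq, Finset.mem_range]
  split_ifs with h
  · rw [sub_self, abs_zero]
    positivity
  · rw [sub_zero, Nat.abs_cast, one_div_mul_eq_div, le_div_iff₀ hJ0, Nat.descFactorial_succ,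
      mul_comm]
    have : J * x.descFactorial l ≤ (x - l) * x.descFactorial l :=
      Nat.mul_le_mul_right _ (by omega)
    exact_mod_cast this

/-- In the case of a Poisson limit, the factorial moments of the truncations converge. -/
lemma PoissonLimit.abs_mean_truncVal_sub_le {θ : ℝ} (hθ : 1 ≤ θ) {a : ℕ → ℕ → ℤ} {μ : NNReal}
    (h : PoissonLimit θ a μ) (l : ℕ) {ε : ℝ} (hε : 0 < ε) : ∃ m₀ : ℕ, ∀ m ≥ m₀, ∀ᶠ n in atTop,
      |mean θ n (fun s => ((truncVal m (a n) s).descFactorial l : ℝ)) - (μ : ℝ) ^ l| ≤ ε := by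
  obtain ⟨C₁, -, hC₁⟩ := h.exists_mean_truncVal_le hθ 1
  obtain ⟨C, hC0, hC⟩ := h.exists_mean_truncVal_le hθ (l + 1)
  have htail : Tendsto (fun J : ℕ => C / (J : ℝ)) atTop (𝓝 0) :=
    tendsto_const_div_atTop_nhds_zero_nat C
  have hser := tendsto_iff_dist_tendsto_zero.1
    (hasSum_descFactorial_mul_poissonMass μ l).tendsto_sum_nat
  have hser' := hser.comp (tendsto_add_atTop_nat l)
  -- The cut-off J can be fixed before m since C does not depend on m; below l+J only finitely many
  -- point probabilities remain, and they converge.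
  obtain ⟨J, hJ1, hJ2, hJ3⟩ := ((htail.eventually_le_const (show 0 < ε / 4 by positivity)).and
    ((hser'.eventually_le_const (show 0 < ε / 4 by positivity)).and
      (eventually_ge_atTop 1))).exists
  rw [Function.comp_apply, Real.dist_eq, add_comm J l] at hJ2
  set B := ∑ k ∈ Finset.range (l + J), (k.descFactorial l : ℝ) with hB
  have hB0 : 0 ≤ B := Finset.sum_nonneg fun i _ => Nat.cast_nonneg _
  set δ := ε / (8 * (B + 1)) with hδ
  have hδ0 : 0 < δ := by positivity
  have hBδ : B * (2 * δ) ≤ ε / 4 := by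
    rw [hδ, mul_div_assoc', mul_div_assoc', div_le_div_iff₀ (by positivity) (by norm_num)]
    nlinarith
  obtain ⟨m₀, hm₀⟩ := exists_prob_addVal_ne_truncVal_le hθ (h.negativePartNegligible hθ)
    (C := C₁) (m₁ := 0) (fun m _ => hC₁ m) hδ0
  refine ⟨m₀, fun m hm => ?_⟩
  have h1 : ∀ᶠ n in atTop, ∀ k ∈ Finset.range (l + J),
      |prob θ n (fun s => addVal (a n) s = k) - poissonMass μ k| ≤ δ := by
    rw [Filter.eventually_all_finset]
    intro k _
    have := (tendsto_iff_dist_tendsto_zero.1 (h.2 k)).eventually_le_const hδ0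
    simpa only [Real.dist_eq] using this
  filter_upwards [h1, hm₀ m hm, hC m] with n hn1 hn2 hn3
  set H := truncVal m (a n) with hH
  have h2 : |mean θ n (fun s => ((H s).descFactorial l : ℝ)) - ∑ k ∈ Finset.range (l + J),
      (k.descFactorial l : ℝ) * prob θ n (fun s => H s = k)| ≤ ε / 4 := by
    have e : mean θ n (fun s => ((H s).descFactorial l : ℝ)) - ∑ k ∈ Finset.range (l + J),
        (k.descFactorial l : ℝ) * prob θ n (fun s => H s = k) =
        mean θ n fun s => ((H s).descFactorial l : ℝ) - ∑ k ∈ Finset.range (l + J),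
          (k.descFactorial l : ℝ) * (if H s = k then 1 else 0) := by
      rw [mean_sub, mean_sum]
      simp_rw [mean_mul_left]
      congr 1
      refine Finset.sum_congr rfl fun k _ => ?_
      unfold prob
      congr 2
      funext s
      congr
    rw [e]
    have e1 := mean_mul_left (θ := θ) (n := n) (1 / J)
      fun s => ((H s).descFactorial (l + 1) : ℝ)
    rw [one_div_mul_eq_div] at e1
    refine (abs_mean_le hθ _).trans (le_trans ?_
      (e1.trans_le ((div_le_div_of_nonneg_right hn3 (Nat.cast_nonneg J)).trans hJ1)))
    exact mean_mono hθ fun p => abs_descFactorial_sub_le (H p.parts) l J hJ3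
  have h3 : |∑ k ∈ Finset.range (l + J), (k.descFactorial l : ℝ) * prob θ n (fun s => H s = k) -
      ∑ k ∈ Finset.range (l + J), (k.descFactorial l : ℝ) * poissonMass μ k| ≤ B * (2 * δ) := by
    rw [← Finset.sum_sub_distrib, hB, Finset.sum_mul]
    refine (Finset.abs_sum_le_sum_abs _ _).trans (Finset.sum_le_sum fun k hk => ?_)
    rw [← mul_sub, abs_mul, Nat.abs_cast]
    refine mul_le_mul_of_nonneg_left ?_ (Nat.cast_nonneg _)
    have e1 := abs_prob_sub_prob_le hθ n (fun s => addVal (a n) s = k) (fun s => H s = k)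
      (fun s => addVal (a n) s ≠ H s) fun s hs => by
        rw [not_not.1 hs]
        exact Nat.cast_inj
    rw [abs_sub_comm] at e1
    have e2 := hn1 k hk
    have e3 := abs_sub_le (prob θ n fun s => H s = k) (prob θ n fun s => addVal (a n) s = k)
      (poissonMass μ k)
    linarith
  have h4 := abs_sub_le (mean θ n (fun s => ((H s).descFactorial l : ℝ)))
    (∑ k ∈ Finset.range (l + J), (k.descFactorial l : ℝ) * prob θ n (fun s => H s = k))
    ((μ : ℝ) ^ l)
  have h5 := abs_sub_le
    (∑ k ∈ Finset.range (l + J), (k.descFactorial l : ℝ) * prob θ n (fun s => H s = k))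
    (∑ k ∈ Finset.range (l + J), (k.descFactorial l : ℝ) * poissonMass μ k) ((μ : ℝ) ^ l)
  linarith

end EwensAdditive

end

theorem corollary1 (θ : ℝ) (hθ : 1 ≤ θ) (μ : NNReal) (hμ : 0 < μ) (a : ℕ → ℕ → ℤ) :
    EwensAdditive.WeaklyConverges (EwensAdditive.T θ a) (EwensAdditive.poissonDF μ) ↔
      (EwensAdditive.NegativePartNegligible θ a ∧
        ∀ l : ℕ, 1 ≤ l →
          EwensAdditive.IsErrorTerm
            (fun n m => EwensAdditive.Upsilon θ a n l m - (μ : ℝ) ^ l)) := by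
  rw [EwensAdditive.weaklyConverges_iff hθ]
  refine ⟨fun h => ⟨h.negativePartNegligible hθ, fun l hl => ?_⟩,
    fun h => EwensAdditive.poissonLimit_of_isErrorTerm hθ h.1 h.2⟩
  exact (EwensAdditive.isErrorTerm_Upsilon_iff hθ a hl _).2 fun ε hε =>
    h.abs_mean_truncVal_sub_le hθ l hε
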